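/- Let $k$ be an algebraically closed field of characteristic $0$. All modules are finite-dimensional left modules, and $A\text{-mod}$ is the $k$-linear category of finite-dimensional left modules over a $k$-algebra $A$. **Labelled cell decompositions.** Consider a finite cell decomposition, with oriented edges, of a compact oriented surface $\Sigma$, possibly with boundary (the boundary is part of the 1-skeleton), in which every vertex is incident to at least one edge. A labelling consists of a finite-dimensional semisimple Hopf algebra $H_p$ for every 2-cell (plaquette) $p$, and of a finite-dimensional semisimple $H_p$-$H_{p'}$-bicomodule algebra $K_e$ for every edge $e$, where $p$ is the plaquette to the left of $e$ and $p'$ the one to the right; at a boundary edge one plaquette is missing and the corresponding Hopf algebra is replaced by $k$. Write $S$ for antipodes, $\varepsilon(\cdot)$ for counits and $x\mapsto x_{(-1)}\otimes x_{(0)}\otimes x_{(1)}$ for bicomodule structures. For a sign $\varepsilon$, put $H^{\varepsilon}=H$, $K^{\varepsilon}=K$, $a^{\langle\varepsilon\rangle}=a$ if $\varepsilon=+1$, and $H^{\varepsilon}=H^{\mathrm{op},\mathrm{cop}}$, $K^{\varepsilon}=K^{\mathrm{op}}$, $a^{\langle\varepsilon\rangle}=S(a)$ if $\varepsilon=-1$;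 for an $H_1$-$H_2$-bicomodule algebra $K$, the algebra $K^{\mathrm{op}}$ is an $H_2^{\mathrm{op},\mathrm{cop}}$-$H_1^{\mathrm{op},\mathrm{cop}}$-bicomodule algebra. **The vertex.** Let $v$ be a vertex. A half-edge $e$ at $v$ has the sign $\varepsilon_e=+1$ if the edge points away from $v$ there and $-1$ if it points towards $v$; thus $K_e^{\varepsilon_e}$ is an $H_p^{\varepsilon_e}$-$H_{p'}^{\varepsilon_e}$-bicomodule algebra, where $p$ is to the left and $p'$ to the right of $e$ as seen from $v$. A site at $v$ is a corner at $v$ of a plaquette $p$; in clockwise order around $v$ it lies between a half-edge $e'_p$ and the next half-edge $e_p$. Put $\varepsilon'=\varepsilon_{e'_p}$ and $\varepsilon=\varepsilon_{e_p}$. We write $p$ also for the site. **The category $\mathrm T(\mathbb L_v)$.** Put $K_v=\bigotimes_e K_e^{\varepsilon_e}$ over the half-edges at $v$, so that $K_v\text{-mod}$ is the Deligne product of the categories $K_e^{\varepsilon_e}\text{-mod}$. For each site $p$ and $X\in H_p\text{-mod}$, let $X\triangleright M=X\otimes M$ be the $K_v$-module on which $K_v$ acts through the left coaction of $H_p^{\varepsilon}$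 on the factor $K_{e_p}^{\varepsilon}$, and let $M\triangleleft X=M\otimes X$ be the one on which it acts through the right coaction of $H_p^{\varepsilon'}$ on the factor $K_{e'_p}^{\varepsilon'}$; here $a\in H_p^{\pm1}$ acts on $X$ by $a^{\langle\pm1\rangle}$ (for the sign $-1$ this is the dual of $X$ as an object of the opposite category). A balancing at $p$ on $M\in K_v\text{-mod}$ is a family of isomorphisms $\beta_X\colon X\triangleright M\to M\triangleleft X$ of $K_v$-modules, natural in $X\in H_p\text{-mod}$, with $\beta_{X\otimes Y}=(\beta_X\otimes\mathrm{id}_Y)(\mathrm{id}_X\otimes\beta_Y)$ and $\beta_k=\mathrm{id}_M$ (up to the canonical isomorphisms). The category $\mathrm T(\mathbb L_v)$ that the modular functor of Fuchs, Schaumann and Schweigert assigns to the circle around $v$ is obtained by iterating the construction of the category of balancings over all sites at $v$. Explicitly, its objects are $K_v$-modules $M$ with a balancing $\beta^p$ at each site $p$ such that for any two distinct sites $p,q$ the balancings commute: for $X\in H_p\text{-mod}$ and $Y\in H_q\text{-mod}$, the two maps $X\otimes Y\otimes M\to M\otimes X\otimes Y$ obtained by applying $\beta^p_X$ and $\beta^q_Y$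 in either order, with permutations of the factors $X$ and $Y$, agree. Its morphisms are the $K_v$-linear maps that are compatible with all balancings. **The vertex algebra $C_v$.** The dual $H_p^*$ is an algebra under $(fg)(x)=f(x_{(1)})g(x_{(2)})$. An element $a\in H_p^{\varepsilon}$ that comes from the left coaction on $K_{e_p}^{\varepsilon}$ acts on it by $f\mapsto f(?\cdot a^{\langle\varepsilon\rangle})$, and an element $a'\in H_p^{\varepsilon'}$ that comes from the right coaction on $K_{e'_p}^{\varepsilon'}$ acts by $f\mapsto f(a'^{\langle-\varepsilon'\rangle}\cdot ?)$. Let $C_v$ be the resulting crossed product algebra $\bigl(\bigotimes_p H_p^*\bigr)\otimes K_v$ over all sites $p$ at $v$, with multiplication $(f\otimes x)(g\otimes y)=f\,(x_{(-1)}.g)\otimes x_{(0)}y$, where $x\mapsto x_{(-1)}\otimes x_{(0)}$ collects all these coactions and the dot all these actions; this is an associative unital algebra. **Theorem.** There is a canonical equivalence of $k$-linear categories $$\mathrm T(\mathbb L_v)\;\simeq\; C_v\text{-mod}.$$ It is canonical in the following sense: up to a natural isomorphism, it sends $(M,(\beta^p)_p)$ to a $C_v$-module with underlying $K_v$-module $M$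 on which, for each site $p$, an element $f\in H_p^*$ acts by $f.m=(\mathrm{id}_M\otimes f)\bigl(\beta^p_{H_p}(1\otimes m)\bigr)$, where $H_p$ is the left regular module. -/

import Mathlib

open CategoryTheory TensorProduct

universe u

noncomputable section

/-- Finite-dimensional left modules over a `k`-algebra `A`: a finite-dimensional vector space `V`
with an algebra homomorphism `A → End_k(V)`. -/
structure FDMod (k : Type u) [Field k] (A : Type u) [Ring A] [Algebra k A] where
  V : Type u
  [addCommGroup : AddCommGroup V]
  [module : Module k V]
  [finite : Module.Finite k V]
  ρ : A →ₐ[k] Module.End k V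

namespace FDMod

attribute [instance] FDMod.addCommGroup FDMod.module FDMod.finite

variable {k : Type u} [Field k]

section
variable {A B : Type u} [Ring A] [Algebra k A] [Ring B] [Algebra k B]

/-- The vector space of `A`-linear maps. -/
def homs (M N : FDMod k A) : Submodule k (M.V →ₗ[k] N.V) where
  carrier := {f | ∀ a, f ∘ₗ M.ρ a = N.ρ a ∘ₗ f}
  add_mem' {f g} hf hg a := by
    simp only [Set.mem_ofPred_eq] at hf hg
    rw [LinearMap.add_comp, LinearMap.comp_add, hf, hg]
  zero_mem' a := by rw [LinearMap.zero_comp, LinearMap.comp_zero]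
  smul_mem' c f hf a := by
    simp only [Set.mem_ofPred_eq] at hf
    rw [LinearMap.smul_comp, LinearMap.comp_smul, hf]

instance : Category (FDMod k A) where
  Hom M N := homs M N
  id M := ⟨LinearMap.id, fun _ => rfl⟩
  comp {M N P} f g := ⟨g.1 ∘ₗ f.1, fun a => by
    rw [LinearMap.comp_assoc, f.2 a, ← LinearMap.comp_assoc, g.2 a, LinearMap.comp_assoc]⟩


/-- The underlying linear map of a morphism. -/
def lin {M N : FDMod k A} (f : M ⟶ N) : M.V →ₗ[k] N.V := Subtype.val (p := (· ∈ homs M N)) f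

instance : Preadditive (FDMod k A) where
  homGroup := fun M N => inferInstanceAs (AddCommGroup (homs M N))
  add_comp _ _ _ f f' g := Subtype.ext (LinearMap.comp_add f.1 f'.1 g.1)
  comp_add _ _ _ f g g' := Subtype.ext (LinearMap.add_comp f.1 g'.1 g.1)

instance : Linear k (FDMod k A) where
  homModule := fun M N => inferInstanceAs (Module k (homs M N))
  smul_comp _ _ _ r f g := Subtype.ext (LinearMap.comp_smul g.1 r f.1)
  comp_smul _ _ _ f r g := Subtype.ext (LinearMap.smul_comp r g.1 f.1)

/-- Restriction of scalars along an algebra homomorphism. -/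
abbrev restrict (φ : A →ₐ[k] B) (M : FDMod k B) : FDMod k A where
  V := M.V
  ρ := M.ρ.comp φ

/-- Restriction of scalars as a functor. -/
def restrictFunctor (φ : A →ₐ[k] B) : FDMod k B ⥤ FDMod k A where
  obj M := restrict φ M
  map f := ⟨f.1, fun a => f.2 (φ a)⟩

/-- The `A ⊗ B`-module `M ⊗ N`. -/
abbrev tensor (M : FDMod k A) (N : FDMod k B) : FDMod k (A ⊗[k] B) where
  V := M.V ⊗[k] N.V
  ρ := (Module.endTensorEndAlgHom (R := k) (S := k) (A := k) (M := M.V) (N := N.V)).comp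
    (Algebra.TensorProduct.map M.ρ N.ρ)

variable (k A) in
/-- The left regular module. -/
abbrev regular [Module.Finite k A] : FDMod k A where
  V := A
  ρ := Algebra.lmul k A

end

section
variable {H : Type u} [Ring H] [HopfAlgebra k H]

/-- The tensor product in the tensor category `H-mod`: `H` acts through its comultiplication. -/
abbrev tensorH (X Y : FDMod k H) : FDMod k H := (tensor X Y).restrict (Bialgebra.comulAlgHom k H)

variable (k H) in
/-- The unit of the tensor category `H-mod`: `H` acts on `k` through its counit. -/
abbrev unitH : FDMod k H where
  V := k
  ρ := (Algebra.lmul k k).comp (Bialgebra.counitAlgHom k H)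
end

end FDMod

section OpCop
variable {k : Type u} [Field k]  {H : Type u} [Ring H] [HopfAlgebra k H]

variable (k H) in
/-- The comultiplication of `H^{op,cop}`: `h ↦ h₍₂₎ ⊗ h₍₁₎`. -/
def comulOpCop : Hᵐᵒᵖ →ₗ[k] Hᵐᵒᵖ ⊗[k] Hᵐᵒᵖ :=
  TensorProduct.map (MulOpposite.opLinearEquiv k).toLinearMap
      (MulOpposite.opLinearEquiv k).toLinearMap ∘ₗ
    (TensorProduct.comm k H H).toLinearMap ∘ₗ Coalgebra.comul ∘ₗ
      (MulOpposite.opLinearEquiv k).symm.toLinearMap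

lemma comulOpCop_coassoc : (TensorProduct.assoc k Hᵐᵒᵖ Hᵐᵒᵖ Hᵐᵒᵖ).toLinearMap ∘ₗ
    (comulOpCop k H).rTensor _ ∘ₗ
    comulOpCop k H = (comulOpCop k H).lTensor _ ∘ₗ comulOpCop k H := by
  refine LinearMap.ext fun a => ?_
  let o : H →ₗ[k] Hᵐᵒᵖ := (MulOpposite.opLinearEquiv k).toLinearMap
  let R : H ⊗[k] (H ⊗[k] H) →ₗ[k] Hᵐᵒᵖ ⊗[k] (Hᵐᵒᵖ ⊗[k] Hᵐᵒᵖ) :=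
    TensorProduct.map o (TensorProduct.map o o) ∘ₗ (TensorProduct.assoc k H H H).toLinearMap ∘ₗ
      (TensorProduct.comm k H H).toLinearMap.rTensor H ∘ₗ
        (TensorProduct.comm k H (H ⊗[k] H)).toLinearMap
  have h1 : ∀ t : H ⊗[k] H, TensorProduct.assoc k _ _ _ ((comulOpCop k H).rTensor _
      (TensorProduct.map o o (TensorProduct.comm k H H t))) = R (Coalgebra.comul.lTensor H t) := by
    intro t
    induction t with
    | zero => simp
    | add x y hx hy => simp only [map_add, hx, hy]
    | tmul x y =>
      simp only [TensorProduct.comm_tmul, LinearMap.rTensor_tmul, LinearMap.lTensor_tmul,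
        TensorProduct.map_tmul]
      simp only [comulOpCop, LinearMap.comp_apply, o, LinearEquiv.coe_coe,
        LinearEquiv.symm_apply_apply]
      generalize (Coalgebra.comul (R := k) y) = s
      induction s with
      | zero => simp
      | add x y hx hy => simp only [map_add, TensorProduct.add_tmul, TensorProduct.tmul_add, hx, hy]
      | tmul a b => simp [R, o]
  have h2 : ∀ t : H ⊗[k] H, (comulOpCop k H).lTensor _
      (TensorProduct.map o o (TensorProduct.comm k H H t)) =
        R (TensorProduct.assoc k H H H (Coalgebra.comul.rTensor H t)) := by
    intro t
    induction t with
    | zero => simp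
    | add x y hx hy => simp only [map_add, hx, hy]
    | tmul x y =>
      simp only [TensorProduct.comm_tmul, LinearMap.rTensor_tmul, LinearMap.lTensor_tmul,
        TensorProduct.map_tmul]
      simp only [comulOpCop, LinearMap.comp_apply, o, LinearEquiv.coe_coe,
        LinearEquiv.symm_apply_apply]
      generalize (Coalgebra.comul (R := k) x) = s
      induction s with
      | zero => simp
      | add x y hx hy => simp only [map_add, TensorProduct.add_tmul, TensorProduct.tmul_add, hx, hy]
      | tmul a b => simp [R, o]
  refine (h1 (Coalgebra.comul a.unop)).trans ?_
  rw [← Coalgebra.coassoc_apply]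
  exact (h2 (Coalgebra.comul a.unop)).symm

lemma comulOpCop_mul (x y : Hᵐᵒᵖ) : comulOpCop k H (x * y) = comulOpCop k H x * comulOpCop k H y := by
  simp only [comulOpCop, LinearMap.comp_apply, LinearEquiv.coe_coe,
    MulOpposite.coe_opLinearEquiv_symm, MulOpposite.unop_mul, Bialgebra.comul_mul]
  generalize (Coalgebra.comul (R := k) x.unop) = s
  generalize (Coalgebra.comul (R := k) y.unop) = t
  induction s with
  | zero => simp
  | add x y hx hy => simp only [map_add, add_mul, mul_add, hx, hy]
  | tmul a b =>
    induction t with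
    | zero => simp
    | add x y hx hy => simp only [map_add, add_mul, mul_add, hx, hy]
    | tmul c d => simp

variable (k H) in
/-- The Hopf algebra structure of `H^{op,cop}`; the antipode is that of `H`. -/
@[reducible] def hopfOpCop : HopfAlgebra k Hᵐᵒᵖ where
  comul := comulOpCop k H
  counit := Coalgebra.counit ∘ₗ (MulOpposite.opLinearEquiv k).symm.toLinearMap
  coassoc := comulOpCop_coassoc
  rTensor_counit_comp_comul := by
    refine LinearMap.ext fun a => ?_
    have := Coalgebra.lTensor_counit_comul (R := k) a.unop
    have h : ∀ t : H ⊗[k] H, ((Coalgebra.counit ∘ₗ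
        (MulOpposite.opLinearEquiv k).symm.toLinearMap).rTensor Hᵐᵒᵖ) (TensorProduct.map
          (MulOpposite.opLinearEquiv k).toLinearMap (MulOpposite.opLinearEquiv k).toLinearMap
          (TensorProduct.comm k H H t)) = TensorProduct.comm k Hᵐᵒᵖ k
          ((MulOpposite.opLinearEquiv k).toLinearMap.rTensor k (Coalgebra.counit.lTensor H t)) := by
      intro t
      induction t with
      | zero => simp
      | add x y hx hy => simp only [map_add, hx, hy]
      | tmul x y => simp
    refine (h (Coalgebra.comul a.unop)).trans ?_
    rw [this]
    simp
  lTensor_counit_comp_comul := by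
    refine LinearMap.ext fun a => ?_
    have := Coalgebra.rTensor_counit_comul (R := k) a.unop
    have h : ∀ t : H ⊗[k] H, ((Coalgebra.counit ∘ₗ
        (MulOpposite.opLinearEquiv k).symm.toLinearMap).lTensor Hᵐᵒᵖ) (TensorProduct.map
          (MulOpposite.opLinearEquiv k).toLinearMap (MulOpposite.opLinearEquiv k).toLinearMap
          (TensorProduct.comm k H H t)) = TensorProduct.comm k k Hᵐᵒᵖ
          ((MulOpposite.opLinearEquiv k).toLinearMap.lTensor k (Coalgebra.counit.rTensor H t)) := by
      intro t
      induction t with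
      | zero => simp
      | add x y hx hy => simp only [map_add, hx, hy]
      | tmul x y => simp
    refine (h (Coalgebra.comul a.unop)).trans ?_
    rw [this]
    simp
  counit_one := Bialgebra.counit_one (R := k) (A := H)
  mul_compr₂_counit := LinearMap.ext₂ fun x y =>
    (Bialgebra.counit_mul (R := k) (A := H) y.unop x.unop).trans (mul_comm _ _)
  comul_one := by
    simp [comulOpCop, Algebra.TensorProduct.one_def]
  mul_compr₂_comul := LinearMap.ext₂ comulOpCop_mul
  antipode := (MulOpposite.opLinearEquiv k).toLinearMap ∘ₗ HopfAlgebra.antipode k ∘ₗ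
    (MulOpposite.opLinearEquiv k).symm.toLinearMap
  mul_antipode_rTensor_comul := by
    refine LinearMap.ext fun a => MulOpposite.unop_injective ?_
    refine Eq.trans ?_ (HopfAlgebra.mul_antipode_lTensor_comul_apply (R := k) a.unop)
    simp only [comulOpCop, LinearMap.comp_apply, LinearEquiv.coe_coe,
      MulOpposite.coe_opLinearEquiv_symm]
    generalize (Coalgebra.comul (R := k) a.unop) = s
    induction s with
    | zero => simp
    | add x y hx hy => simp only [map_add, MulOpposite.unop_add, hx, hy]
    | tmul a b => simp
  mul_antipode_lTensor_comul := by
    refine LinearMap.ext fun a => MulOpposite.unop_injective ?_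
    refine Eq.trans ?_ (HopfAlgebra.mul_antipode_rTensor_comul_apply (R := k) a.unop)
    simp only [comulOpCop, LinearMap.comp_apply, LinearEquiv.coe_coe,
      MulOpposite.coe_opLinearEquiv_symm]
    generalize (Coalgebra.comul (R := k) a.unop) = s
    induction s with
    | zero => simp
    | add x y hx hy => simp only [map_add, MulOpposite.unop_add, hx, hy]
    | tmul a b => simp


lemma comul_antipode_aux₁ (x z : H) (G : H ⊗[k] H →ₗ[k] H ⊗[k] H)
    (hG : ∀ y b, G (y ⊗ₜ b) =
      (HopfAlgebra.antipode k y ⊗ₜ HopfAlgebra.antipode k x) * Coalgebra.comul b) :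
    G (Coalgebra.comul z) = 1 ⊗ₜ (HopfAlgebra.antipode k x * z) := by
  let F : (H ⊗[k] H) ⊗[k] H →ₗ[k] H ⊗[k] H :=
    TensorProduct.map (LinearMap.mul' k H ∘ₗ (HopfAlgebra.antipode k).rTensor H)
      (LinearMap.mulLeft k (HopfAlgebra.antipode k x))
  have h1 : ∀ t : H ⊗[k] H, G t =
      F ((TensorProduct.assoc k H H H).symm (Coalgebra.comul.lTensor H t)) := by
    intro t
    induction t with
    | zero => simp only [map_zero]
    | add x y hx hy => simp only [map_add, hx, hy]
    | tmul y b =>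
      rw [hG, LinearMap.lTensor_tmul]
      generalize (Coalgebra.comul (R := k) b) = s
      induction s with
      | zero => simp only [map_zero, mul_zero, TensorProduct.tmul_zero]
      | add x y hx hy => simp only [map_add, mul_add, TensorProduct.tmul_add, hx, hy]
      | tmul a b => simp [F]
  have h2 : ∀ t : H ⊗[k] H, F (Coalgebra.comul.rTensor H t) =
      1 ⊗ₜ (HopfAlgebra.antipode k x * TensorProduct.lid k H (Coalgebra.counit.rTensor H t)) := by
    intro t
    induction t with
    | zero => simp only [map_zero, mul_zero, TensorProduct.tmul_zero]
    | add x y hx hy => simp only [map_add, mul_add, TensorProduct.tmul_add, hx, hy]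
    | tmul y b =>
      simp only [LinearMap.rTensor_tmul, F, TensorProduct.map_tmul, LinearMap.comp_apply,
        HopfAlgebra.mul_antipode_rTensor_comul_apply, LinearMap.mulLeft_apply,
        TensorProduct.lid_tmul, Algebra.mul_smul_comm, TensorProduct.tmul_smul,
        Algebra.algebraMap_eq_smul_one, TensorProduct.smul_tmul']
  rw [h1, Coalgebra.coassoc_symm_apply, h2, Coalgebra.rTensor_counit_comul]
  simp

lemma comul_antipode_aux₂ (h : H) : LinearMap.mul' k (H ⊗[k] H) (TensorProduct.map
    (TensorProduct.map (HopfAlgebra.antipode k) (HopfAlgebra.antipode k) ∘ₗ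
        (TensorProduct.comm k H H).toLinearMap ∘ₗ Coalgebra.comul) Coalgebra.comul
        (Coalgebra.comul (R := k) h)) =
    algebraMap k (H ⊗[k] H) (Coalgebra.counit h) := by
  let G : H ⊗[k] (H ⊗[k] H) →ₗ[k] H ⊗[k] H :=
    LinearMap.mul' k (H ⊗[k] H) ∘ₗ TensorProduct.map
      (TensorProduct.map (HopfAlgebra.antipode k) (HopfAlgebra.antipode k) ∘ₗ
        (TensorProduct.comm k H H).toLinearMap) Coalgebra.comul ∘ₗ
      (TensorProduct.assoc k H H H).symm.toLinearMap
  have h1 : ∀ t : H ⊗[k] H, LinearMap.mul' k (H ⊗[k] H) (TensorProduct.map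
      (TensorProduct.map (HopfAlgebra.antipode k) (HopfAlgebra.antipode k) ∘ₗ
        (TensorProduct.comm k H H).toLinearMap ∘ₗ Coalgebra.comul) Coalgebra.comul t) =
      G (TensorProduct.assoc k H H H (Coalgebra.comul.rTensor H t)) := by
    intro t
    induction t with
    | zero => simp only [map_zero]
    | add x y hx hy => simp only [map_add, hx, hy]
    | tmul x y => simp [G]
  have h2 : ∀ t : H ⊗[k] H, G (Coalgebra.comul.lTensor H t) =
      1 ⊗ₜ LinearMap.mul' k H ((HopfAlgebra.antipode k).rTensor H t) := by
    intro t
    induction t with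
    | zero => simp only [map_zero, TensorProduct.tmul_zero]
    | add x y hx hy => simp only [map_add, TensorProduct.tmul_add, hx, hy]
    | tmul x z =>
      refine comul_antipode_aux₁ x z (G ∘ₗ TensorProduct.mk k H (H ⊗[k] H) x) fun y b => ?_
      simp [G]
  rw [h1, Coalgebra.coassoc_apply, h2, HopfAlgebra.mul_antipode_rTensor_comul_apply]
  simp [Algebra.algebraMap_eq_smul_one, Algebra.TensorProduct.one_def, TensorProduct.tmul_smul]

lemma comul_antipode_eq :
    (Coalgebra.comul ∘ₗ HopfAlgebra.antipode k : H →ₗ[k] H ⊗[k] H) =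
      TensorProduct.map (HopfAlgebra.antipode k) (HopfAlgebra.antipode k) ∘ₗ
        (TensorProduct.comm k H H).toLinearMap ∘ₗ Coalgebra.comul := by
  apply WithConv.toConv_injective
  symm
  refine left_inv_eq_right_inv (a := WithConv.toConv Coalgebra.comul) ?_ LinearMap.comul_right_inv
  exact congrArg WithConv.toConv (LinearMap.ext comul_antipode_aux₂)

variable (k H) in
/-- The antipode as an algebra map `H^{op} → H`. -/
def antipodeOp : Hᵐᵒᵖ →ₐ[k] H :=
  (AlgEquiv.opOp k H).symm.toAlgHom.comp (AlgHom.op (HopfAlgebra.antipodeAlgHomOp k H))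

lemma comul_antipodeOp (x : Hᵐᵒᵖ) :
    Coalgebra.comul (R := k) (antipodeOp k H x) =
      TensorProduct.map (antipodeOp k H).toLinearMap (antipodeOp k H).toLinearMap
        (comulOpCop k H x) := by
  refine (LinearMap.congr_fun (comul_antipode_eq (k := k) (H := H)) x.unop).trans ?_
  simp only [comulOpCop, LinearMap.comp_apply]
  rw [← LinearMap.comp_apply (TensorProduct.map _ _) (TensorProduct.map _ _),
    ← TensorProduct.map_comp]
  rfl

lemma comul_unop (x : Hᵐᵒᵖ) :
    Coalgebra.comul (R := k) x.unop = TensorProduct.comm k H H (TensorProduct.map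
      (MulOpposite.opLinearEquiv k).symm.toLinearMap (MulOpposite.opLinearEquiv k).symm.toLinearMap
        (comulOpCop k H x)) := by
  simp only [comulOpCop, LinearMap.comp_apply]
  rw [← LinearMap.comp_apply (TensorProduct.map _ _) (TensorProduct.map _ _),
    ← TensorProduct.map_comp]
  simp

end OpCop

section Signs
variable {k : Type u} [Field k]

/-- The Hopf algebra `H^ε`: it is `H` for the sign `ε = +1` (`true`) and `H^{op,cop}` for the sign
`ε = -1` (`false`). -/
abbrev signedHopf : Bool → HopfAlgCat.{u} k → HopfAlgCat.{u} k
  | true, H => H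
  | false, H => @HopfAlgCat.of k _ Hᵐᵒᵖ _ (hopfOpCop k H)

/-- The algebra `K^ε`: it is `K` for `ε = +1` and `K^op` for `ε = -1`. -/
abbrev signedAlg : Bool → AlgCat.{u} k → AlgCat.{u} k
  | true, K => K
  | false, K => AlgCat.of k Kᵐᵒᵖ

/-- The algebra map `H^ε → H`, `a ↦ a^⟨ε⟩`, i.e. `a` if `ε = +1` and `S(a)` if `ε = -1`. -/
def signPow (H : HopfAlgCat.{u} k) : (ε : Bool) → signedHopf ε H →ₐ[k] H
  | true => AlgHom.id k H
  | false => antipodeOp k H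

/-- The algebra map `H^ε → H^op`, `a ↦ a^⟨-ε⟩`. -/
def signNegPow (H : HopfAlgCat.{u} k) : (ε : Bool) → signedHopf ε H →ₐ[k] Hᵐᵒᵖ
  | true => HopfAlgebra.antipodeAlgHomOp k H
  | false => AlgHom.id k Hᵐᵒᵖ

lemma comul_signPow (H : HopfAlgCat.{u} k) : (ε : Bool) → (x : signedHopf ε H) →
    Coalgebra.comul (R := k) (signPow H ε x) =
      TensorProduct.map (signPow H ε).toLinearMap (signPow H ε).toLinearMap
        (Coalgebra.comul (R := k) x)
  | true, x => (LinearMap.congr_fun TensorProduct.map_id (Coalgebra.comul (R := k) (A := H) x)).symm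
  | false, x => comul_antipodeOp (k := k) (H := H) x

lemma comul_signNegPow (H : HopfAlgCat.{u} k) : (ε : Bool) → (x : signedHopf ε H) →
    Coalgebra.comul (R := k) (signNegPow H ε x).unop =
      TensorProduct.comm k H H (TensorProduct.map
        ((MulOpposite.opLinearEquiv k).symm.toLinearMap ∘ₗ (signNegPow H ε).toLinearMap)
        ((MulOpposite.opLinearEquiv k).symm.toLinearMap ∘ₗ (signNegPow H ε).toLinearMap)
        (Coalgebra.comul (R := k) x))
  | true, x => by
    refine (LinearMap.congr_fun (comul_antipode_eq (k := k) (H := H)) x).trans ?_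
    simp only [LinearMap.comp_apply, LinearEquiv.coe_coe]
    generalize (Coalgebra.comul (R := k) (A := H) x) = s
    exact (TensorProduct.map_comm _ _ s)
  | false, x => comul_unop (k := k) (H := H) x

/-- The regrouping
`(h₁ ⊗ h₂) ⊗ (x ⊗ (g₁ ⊗ g₂)) ↦ h₁ ⊗ ((h₂ ⊗ (x ⊗ g₁)) ⊗ g₂)`. -/
def bicomoduleAssoc (k H₁ K H₂ : Type u) [Field k] [AddCommGroup H₁] [Module k H₁]
    [AddCommGroup K] [Module k K] [AddCommGroup H₂] [Module k H₂] :
    (H₁ ⊗[k] H₁) ⊗[k] (K ⊗[k] (H₂ ⊗[k] H₂)) ≃ₗ[k] H₁ ⊗[k] ((H₁ ⊗[k] (K ⊗[k] H₂)) ⊗[k] H₂) :=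
  TensorProduct.assoc k H₁ H₁ _ ≪≫ₗ
    LinearEquiv.lTensor H₁ (LinearEquiv.lTensor H₁ (TensorProduct.assoc k K H₂ H₂).symm ≪≫ₗ
      (TensorProduct.assoc k H₁ (K ⊗[k] H₂) H₂).symm)

/-- The isomorphism `(A ⊗ B ⊗ C)^op ≅ C^op ⊗ B^op ⊗ A^op` that reverses the order of the
factors. -/
def opReverse (k A B C : Type u) [Field k] [Ring A] [Algebra k A] [Ring B] [Algebra k B]
    [Ring C] [Algebra k C] :
    (A ⊗[k] (B ⊗[k] C))ᵐᵒᵖ ≃ₐ[k] Cᵐᵒᵖ ⊗[k] (Bᵐᵒᵖ ⊗[k] Aᵐᵒᵖ) :=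
  (Algebra.TensorProduct.opAlgEquiv k k A (B ⊗[k] C)).symm.trans <|
    (Algebra.TensorProduct.congr AlgEquiv.refl
      ((Algebra.TensorProduct.opAlgEquiv k k B C).symm.trans
        (Algebra.TensorProduct.comm k Bᵐᵒᵖ Cᵐᵒᵖ))).trans <|
    (Algebra.TensorProduct.comm k Aᵐᵒᵖ (Cᵐᵒᵖ ⊗[k] Bᵐᵒᵖ)).trans
      (Algebra.TensorProduct.assoc k k k Cᵐᵒᵖ Bᵐᵒᵖ Aᵐᵒᵖ)

@[simp] lemma opReverse_tmul {A B C : Type u} [Ring A] [Algebra k A] [Ring B] [Algebra k B]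
    [Ring C] [Algebra k C] (a : A) (b : B) (c : C) :
    opReverse k A B C (MulOpposite.op (a ⊗ₜ (b ⊗ₜ c))) =
      MulOpposite.op c ⊗ₜ (MulOpposite.op b ⊗ₜ MulOpposite.op a) := rfl


/-- The structure of an `H₁`-`H₂`-bicomodule algebra on `K`: an algebra map
`K → H₁ ⊗ K ⊗ H₂`, `x ↦ x₍₋₁₎ ⊗ x₍₀₎ ⊗ x₍₁₎`, that is coassociative and counital. -/
structure BicomoduleAlgebra (H₁ : HopfAlgCat.{u} k) (K : AlgCat.{u} k) (H₂ : HopfAlgCat.{u} k) where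
  coact : K →ₐ[k] H₁ ⊗[k] (K ⊗[k] H₂)
  coassoc : ∀ x, (coact.toLinearMap.rTensor H₂).lTensor H₁ (coact x) =
    bicomoduleAssoc k H₁ K H₂
      (TensorProduct.map Coalgebra.comul (Coalgebra.comul.lTensor K) (coact x))
  counit : ∀ x, TensorProduct.lid k K (TensorProduct.map Coalgebra.counit
    ((TensorProduct.rid k K).toLinearMap ∘ₗ Coalgebra.counit.lTensor K) (coact x)) = x

namespace BicomoduleAlgebra
variable {H₁ : HopfAlgCat.{u} k} {K : AlgCat.{u} k} {H₂ : HopfAlgCat.{u} k}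

set_option synthInstance.maxHeartbeats 200000 in
lemma coassoc_op (b : BicomoduleAlgebra H₁ K H₂) (x : Kᵐᵒᵖ) :
    (((opReverse k H₁ K H₂).toAlgHom.comp (AlgHom.op b.coact)).toLinearMap.rTensor
      H₁ᵐᵒᵖ).lTensor H₂ᵐᵒᵖ ((opReverse k H₁ K H₂).toAlgHom.comp (AlgHom.op b.coact) x) =
    bicomoduleAssoc k H₂ᵐᵒᵖ Kᵐᵒᵖ H₁ᵐᵒᵖ
      (TensorProduct.map (comulOpCop k H₂) ((comulOpCop k H₁).lTensor Kᵐᵒᵖ)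
        ((opReverse k H₁ K H₂).toAlgHom.comp (AlgHom.op b.coact) x)) := by
  let o {X : Type u} [Ring X] [Algebra k X] : X →ₗ[k] Xᵐᵒᵖ := (MulOpposite.opLinearEquiv k).toLinearMap
  let R : H₁ ⊗[k] (K ⊗[k] H₂) →ₗ[k] H₂ᵐᵒᵖ ⊗[k] (Kᵐᵒᵖ ⊗[k] H₁ᵐᵒᵖ) :=
    (opReverse k H₁ K H₂).toLinearMap ∘ₗ o
  let R' : H₁ ⊗[k] ((H₁ ⊗[k] (K ⊗[k] H₂)) ⊗[k] H₂) →ₗ[k]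
      H₂ᵐᵒᵖ ⊗[k] ((H₂ᵐᵒᵖ ⊗[k] (Kᵐᵒᵖ ⊗[k] H₁ᵐᵒᵖ)) ⊗[k] H₁ᵐᵒᵖ) :=
    TensorProduct.map o (TensorProduct.map R o) ∘ₗ (TensorProduct.assoc k _ _ _).toLinearMap ∘ₗ
      (TensorProduct.comm k _ _).toLinearMap.rTensor H₁ ∘ₗ (TensorProduct.comm k _ _).toLinearMap
  have h1 : ∀ t, (((opReverse k H₁ K H₂).toAlgHom.comp (AlgHom.op b.coact)).toLinearMap.rTensor
      H₁ᵐᵒᵖ).lTensor H₂ᵐᵒᵖ (R t) = R' ((b.coact.toLinearMap.rTensor H₂).lTensor H₁ t) := by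
    intro t
    induction t with
    | zero => simp only [map_zero]
    | add x y hx hy => simp only [map_add, hx, hy]
    | tmul x y =>
      induction y with
      | zero => simp only [map_zero, TensorProduct.tmul_zero]
      | add x y hx hy => simp only [map_add, TensorProduct.tmul_add, hx, hy]
      | tmul y z => rfl
  have h2 : ∀ t, bicomoduleAssoc k H₂ᵐᵒᵖ Kᵐᵒᵖ H₁ᵐᵒᵖ
      (TensorProduct.map (comulOpCop k H₂) ((comulOpCop k H₁).lTensor Kᵐᵒᵖ) (R t)) =
      R' (bicomoduleAssoc k H₁ K H₂
      (TensorProduct.map Coalgebra.comul (Coalgebra.comul.lTensor K) t)) := by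
    intro t
    induction t with
    | zero => simp
    | add x y hx hy => simp only [map_add, hx, hy]
    | tmul x y =>
      induction y with
      | zero => simp
      | add x y hx hy => simp only [map_add, TensorProduct.tmul_add, hx, hy]
      | tmul y z =>
        have e : R (x ⊗ₜ (y ⊗ₜ z)) =
          MulOpposite.op z ⊗ₜ (MulOpposite.op y ⊗ₜ MulOpposite.op x) := rfl
        rw [e]
        simp only [TensorProduct.map_tmul, LinearMap.lTensor_tmul, comulOpCop, LinearMap.comp_apply,
          LinearEquiv.coe_coe, MulOpposite.coe_opLinearEquiv_symm, MulOpposite.unop_op]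
        generalize (Coalgebra.comul (R := k) x) = s
        generalize (Coalgebra.comul (R := k) z) = t
        induction s with
        | zero => simp
        | add x y hx hy => simp only [map_add, TensorProduct.add_tmul, TensorProduct.tmul_add, hx, hy]
        | tmul a b =>
          induction t with
          | zero => simp
          | add x y hx hy => simp only [map_add, TensorProduct.add_tmul, TensorProduct.tmul_add, hx, hy]
          | tmul c d => rfl
  exact (h1 (b.coact x.unop)).trans ((congrArg R' (b.coassoc x.unop)).trans (h2 _).symm)

/-- The opposite algebra of an `H₁`-`H₂`-bicomodule algebra is an
`H₂^{op,cop}`-`H₁^{op,cop}`-bicomodule algebra. -/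
def op (b : BicomoduleAlgebra H₁ K H₂) :
    BicomoduleAlgebra (signedHopf false H₂) (signedAlg false K) (signedHopf false H₁) where
  coact := (opReverse k H₁ K H₂).toAlgHom.comp (AlgHom.op b.coact)
  coassoc := b.coassoc_op
  counit x := by
    refine Eq.trans ?_ (congrArg MulOpposite.op (b.counit x.unop))
    have h : ∀ t, TensorProduct.lid k Kᵐᵒᵖ (TensorProduct.map
      (Coalgebra.counit ∘ₗ (MulOpposite.opLinearEquiv k).symm.toLinearMap)
      ((TensorProduct.rid k Kᵐᵒᵖ).toLinearMap ∘ₗ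
        (Coalgebra.counit ∘ₗ (MulOpposite.opLinearEquiv k).symm.toLinearMap).lTensor Kᵐᵒᵖ)
        (opReverse k H₁ K H₂ (MulOpposite.op t))) =
      MulOpposite.op (TensorProduct.lid k K (TensorProduct.map Coalgebra.counit
        ((TensorProduct.rid k K).toLinearMap ∘ₗ Coalgebra.counit.lTensor K) t)) := by
      intro t
      induction t with
      | zero => simp
      | add x y hx hy => simp only [map_add, MulOpposite.op_add, hx, hy]
      | tmul x y =>
        induction y with
        | zero => simp
        | add x y hx hy =>
          simp only [map_add, TensorProduct.tmul_add, MulOpposite.op_add, hx, hy]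
        | tmul y z =>
          rw [opReverse_tmul]
          simp [smul_smul, mul_comm]
    exact h _

end BicomoduleAlgebra

/-- An `H₁`-`H₂`-bicomodule algebra structure on `K` if `ε = +1`, and an `H₂`-`H₁`-bicomodule
algebra structure on `K` if `ε = -1`. -/
def SignedBicomoduleAlgebra (H₁ : HopfAlgCat.{u} k) (K : AlgCat.{u} k) (H₂ : HopfAlgCat.{u} k) :
    Bool → Type u
  | true => BicomoduleAlgebra H₁ K H₂
  | false => BicomoduleAlgebra H₂ K H₁

/-- In both cases `K^ε` is an `H₁^ε`-`H₂^ε`-bicomodule algebra. -/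
def SignedBicomoduleAlgebra.toBicomoduleAlgebra {H₁ : HopfAlgCat.{u} k} {K : AlgCat.{u} k}
    {H₂ : HopfAlgCat.{u} k} : {ε : Bool} → SignedBicomoduleAlgebra H₁ K H₂ ε →
    BicomoduleAlgebra (signedHopf ε H₁) (signedAlg ε K) (signedHopf ε H₂)
  | true, b => b
  | false, b => BicomoduleAlgebra.op b

end Signs

section CommuteSingle
variable {k : Type u} [Field k] {ι : Type} [DecidableEq ι] {B : ι → Type u}
  [∀ i, Ring (B i)] [∀ i, Algebra k (B i)]

lemma commute_single {i j : ι} (h : i ≠ j) (x : B i) (y : B j) :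
    Commute (PiTensorProduct.singleAlgHom (R := k) (A := B) i x)
      (PiTensorProduct.singleAlgHom (R := k) (A := B) j y) :=
  Commute.tprod (Pi.mulSingle_commute h x y)

end CommuteSingle

section PiLift
variable {k : Type u} [Field k] {ι : Type} [Fintype ι] [DecidableEq ι] {B : ι → Type u}
  [∀ i, Ring (B i)] [∀ i, Algebra k (B i)] {S : Type u} [Semiring S] [Algebra k S]

/-- The monoid map `(bᵢ)ᵢ ↦ ∏ᵢ fᵢ(bᵢ)` for algebra maps `fᵢ` with pairwise commuting images. -/
def piHom (f : ∀ i, B i →ₐ[k] S) (hf : Pairwise fun i j => ∀ x y, Commute (f i x) (f j y)) :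
    (∀ i, B i) →* S :=
  MonoidHom.noncommPiCoprod (fun i => (f i : B i →* S)) fun _ _ h x y => hf h x y

lemma piHom_mulSingle (f : ∀ i, B i →ₐ[k] S)
    (hf : Pairwise fun i j => ∀ x y, Commute (f i x) (f j y)) (i : ι) (x : B i) :
    piHom f hf (Pi.mulSingle i x) = f i x :=
  MonoidHom.noncommPiCoprod_mulSingle (fun i => (f i : B i →* S)) i x

lemma piHom_update (f : ∀ i, B i →ₐ[k] S)
    (hf : Pairwise fun i j => ∀ x y, Commute (f i x) (f j y)) (m : ∀ i, B i) (i : ι) (x : B i) :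
    piHom f hf (Function.update m i x) =
      f i x * piHom f hf (Function.update m i 1) := by
  have h : Function.update m i x = Pi.mulSingle i x * Function.update m i 1 := by
    ext j
    by_cases hj : j = i
    · subst hj; simp
    · simp [hj]
  rw [h, map_mul, piHom_mulSingle]

/-- The algebra map `⨂ᵢ Bᵢ → S`, `⨂ᵢ bᵢ ↦ ∏ᵢ fᵢ(bᵢ)`, for algebra maps `fᵢ` with pairwise
commuting images. -/
def piLift (f : ∀ i, B i →ₐ[k] S) (hf : Pairwise fun i j => ∀ x y, Commute (f i x) (f j y)) :
    (⨂[k] i, B i) →ₐ[k] S :=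
  PiTensorProduct.liftAlgHom
    { toFun := piHom f hf
      map_update_add' := fun {d} m i x y => by
        cases Subsingleton.elim d ‹DecidableEq ι›
        have := piHom_update f hf m i
        rw [this, this x, this y, map_add, add_mul]
      map_update_smul' := fun {d} m i c x => by
        cases Subsingleton.elim d ‹DecidableEq ι›
        have := piHom_update f hf m i
        rw [this, this x, map_smul, smul_mul_assoc] }
    (map_one (piHom f hf)) (map_mul (piHom f hf))

@[simp] lemma piLift_single (f : ∀ i, B i →ₐ[k] S)
    (hf : Pairwise fun i j => ∀ x y, Commute (f i x) (f j y)) (i : ι) (x : B i) :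
    piLift f hf (PiTensorProduct.singleAlgHom i x) = f i x := by
  rw [piLift, PiTensorProduct.liftAlgHom_apply, PiTensorProduct.singleAlgHom_apply,
    PiTensorProduct.lift.tprod]
  exact piHom_mulSingle f hf i x

lemma eq_top_of_single (T : Subalgebra k (⨂[k] i, B i))
    (hT : ∀ i x, PiTensorProduct.singleAlgHom i x ∈ T) : T = ⊤ := by
  let g : (⨂[k] i, B i) →ₐ[k] T := piLift
    (fun i => (PiTensorProduct.singleAlgHom i).codRestrict T (hT i))
    fun i j h x y => Subtype.ext (commute_single h x y)
  have hg : T.val.comp g = AlgHom.id k _ := by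
    refine PiTensorProduct.algHom_ext fun i => AlgHom.ext fun x => ?_
    exact congrArg T.val (piLift_single _ _ i x)
  refine eq_top_iff.2 fun x _ => ?_
  have h : (g x : ⨂[k] i, B i) = x := AlgHom.congr_fun hg x
  exact h ▸ (g x).2

end PiLift

section Crossed
variable {k A K : Type u} [Field k] [Ring A] [Algebra k A] [Ring K] [Algebra k K]

/-- The action of `End(A) ⊗ K` on `A ⊗ K`: `(T ⊗ μ)(b ⊗ x) = T b ⊗ μ x`. -/
def crossedHat : Module.End k A ⊗[k] K →ₐ[k] Module.End k (A ⊗[k] K) :=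
  (Module.endTensorEndAlgHom (R := k) (S := k) (A := k) (M := A) (N := K)).comp
    (Algebra.TensorProduct.map (AlgHom.id k _) (Algebra.lmul k K))

@[simp] lemma crossedHat_tmul (T : Module.End k A) (μ : K) (b : A) (x : K) :
    crossedHat (k := k) (T ⊗ₜ μ) (b ⊗ₜ x) = T b ⊗ₜ (μ * x) := rfl

/-- The left multiplication by `a` on the first factor of `A ⊗ K`. -/
def crossedLeft : A →ₐ[k] Module.End k (A ⊗[k] K) :=
  (Module.endTensorEndAlgHom (R := k) (S := k) (A := k) (M := A) (N := K)).comp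
    (Algebra.TensorProduct.includeLeft.comp (Algebra.lmul k A))

@[simp] lemma crossedLeft_tmul (a b : A) (x : K) :
    crossedLeft (k := k) (K := K) a (b ⊗ₜ x) = (a * b) ⊗ₜ x := rfl

/-- `P a (T ⊗ μ)` is the composite of `(b ⊗ x ↦ (μ₍₋₁₎.b) ⊗ μ₍₀₎ x)` with left multiplication
by `T a`. -/
def crossedP (Θ : K →ₐ[k] Module.End k A ⊗[k] K) (a : A) :
    Module.End k A ⊗[k] K →ₗ[k] Module.End k (A ⊗[k] K) :=
  TensorProduct.lift ((LinearMap.mul k (Module.End k (A ⊗[k] K))).compl₁₂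
    (crossedLeft.toLinearMap ∘ₗ LinearMap.applyₗ a) (crossedHat.toLinearMap ∘ₗ Θ.toLinearMap))

@[simp] lemma crossedP_tmul (Θ : K →ₐ[k] Module.End k A ⊗[k] K) (a : A) (T : Module.End k A)
    (μ : K) : crossedP Θ a (T ⊗ₜ μ) = crossedLeft (T a) * crossedHat (Θ μ) := rfl

/-- A "coaction composed with an action": for a coaction `x ↦ x₍₋₁₎ ⊗ x₍₀₎` of a bialgebra on `K`
that acts on `A`, let `Θ x ∈ End(A) ⊗ K` be `(a ↦ x₍₋₁₎.a) ⊗ x₍₀₎`. The conditions say that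
`x₍₋₁₎.(a b) ⊗ x₍₀₎ = (x₍₋₂₎.a) (x₍₋₁₎.b) ⊗ x₍₀₎` and `x₍₋₁₎.1 ⊗ x₍₀₎ = 1 ⊗ x`, as for a comodule
algebra `K` and a module algebra `A`. -/
structure IsCrossed (Θ : K →ₐ[k] Module.End k A ⊗[k] K) : Prop where
  straighten : ∀ x a, crossedP Θ a (Θ x) = crossedHat (Θ x) * crossedLeft a
  unit : ∀ x, crossedHat (Θ x) (1 ⊗ₜ 1) = 1 ⊗ₜ x

lemma crossedP_mul {Θ : K →ₐ[k] Module.End k A ⊗[k] K} {x : K}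
    (hx : ∀ a, crossedP Θ a (Θ x) = crossedHat (Θ x) * crossedLeft a) (a : A)
    (y : Module.End k A ⊗[k] K) : crossedP Θ a (Θ x * y) = crossedHat (Θ x) * crossedP Θ a y := by
  induction y with
  | zero => simp only [map_zero, mul_zero]
  | add y z hy hz => simp only [map_add, mul_add, hy, hz]
  | tmul T μ =>
    rw [crossedP_tmul, ← mul_assoc, ← hx]
    generalize Θ x = t
    induction t with
    | zero => simp only [map_zero, zero_mul]
    | add y z hy hz => simp only [map_add, add_mul, hy, hz]
    | tmul T' μ' =>
      rw [Algebra.TensorProduct.tmul_mul_tmul, crossedP_tmul, crossedP_tmul, map_mul, map_mul,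
        mul_assoc]
      rfl

/-- The subalgebra of all `x` that satisfy the conditions of `IsCrossed`. -/
def crossedGood (Θ : K →ₐ[k] Module.End k A ⊗[k] K) : Subalgebra k K where
  carrier := {x | (∀ a, crossedP Θ a (Θ x) = crossedHat (Θ x) * crossedLeft a) ∧
    crossedHat (Θ x) (1 ⊗ₜ 1) = 1 ⊗ₜ x}
  mul_mem' {x y} hx hy := by
    refine ⟨fun a => ?_, ?_⟩
    · rw [map_mul, crossedP_mul hx.1, hy.1, map_mul, mul_assoc]
    · rw [map_mul, map_mul, Module.End.mul_apply, hy.2]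
      have : ∀ t : Module.End k A ⊗[k] K, crossedHat t (1 ⊗ₜ y) =
          (LinearMap.mulRight k y).lTensor A (crossedHat t (1 ⊗ₜ 1)) := by
        intro t
        induction t with
        | zero => simp only [map_zero, LinearMap.zero_apply]
        | add y z hy hz => simp only [map_add, LinearMap.add_apply, hy, hz]
        | tmul T' μ' => simp
      rw [this, hx.2]
      simp
  add_mem' {x y} hx hy := by
    refine ⟨fun a => ?_, ?_⟩
    · rw [map_add, map_add, map_add, hx.1, hy.1, add_mul]
    · rw [map_add, map_add, LinearMap.add_apply, hx.2, hy.2, TensorProduct.tmul_add]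
  algebraMap_mem' r := by
    refine ⟨fun a => ?_, ?_⟩
    · rw [AlgHom.commutes, AlgHom.commutes, Algebra.algebraMap_eq_smul_one, map_smul,
        Algebra.algebraMap_eq_smul_one, smul_mul_assoc, one_mul, Algebra.TensorProduct.one_def,
        crossedP_tmul]
      simp
    · rw [AlgHom.commutes, AlgHom.commutes, Algebra.algebraMap_eq_smul_one,
        Algebra.algebraMap_eq_smul_one]
      simp

lemma isCrossed_of_good {Θ : K →ₐ[k] Module.End k A ⊗[k] K} (h : crossedGood Θ = ⊤) :
    IsCrossed Θ where
  straighten x := (h ▸ Algebra.mem_top : x ∈ crossedGood Θ).1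
  unit x := (h ▸ Algebra.mem_top : x ∈ crossedGood Θ).2

/-- The left multiplication of the crossed product:
`(a ⊗ x)(b ⊗ y) = a (x₍₋₁₎.b) ⊗ x₍₀₎ y`. -/
def crossedMul (Θ : K →ₐ[k] Module.End k A ⊗[k] K) : A ⊗[k] K →ₗ[k] Module.End k (A ⊗[k] K) :=
  TensorProduct.lift ((LinearMap.mul k (Module.End k (A ⊗[k] K))).compl₁₂
    crossedLeft.toLinearMap (crossedHat.toLinearMap ∘ₗ Θ.toLinearMap))

@[simp] lemma crossedMul_tmul (Θ : K →ₐ[k] Module.End k A ⊗[k] K) (a : A) (x : K) :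
    crossedMul Θ (a ⊗ₜ x) = crossedLeft a * crossedHat (Θ x) := rfl

lemma crossedMul_left (Θ : K →ₐ[k] Module.End k A ⊗[k] K) (a : A) (z : A ⊗[k] K) :
    crossedMul Θ (crossedLeft a z) = crossedLeft a * crossedMul Θ z := by
  induction z with
  | zero => simp only [map_zero, mul_zero]
  | add y z hy hz => simp only [map_add, mul_add, hy, hz]
  | tmul b y => simp [mul_assoc]

lemma crossedMul_hat (Θ : K →ₐ[k] Module.End k A ⊗[k] K) (t : Module.End k A ⊗[k] K)
    (b : A) (y : K) :
    crossedMul Θ (crossedHat t (b ⊗ₜ y)) = crossedP Θ b t * crossedHat (Θ y) := by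
  induction t with
  | zero => simp only [map_zero, zero_mul, LinearMap.zero_apply]
  | add y z hy hz => simp only [map_add, add_mul, hy, hz, LinearMap.add_apply]
  | tmul T μ => simp [mul_assoc]

lemma crossedMul_mul {Θ : K →ₐ[k] Module.End k A ⊗[k] K} (h : IsCrossed Θ) (z w : A ⊗[k] K) :
    crossedMul Θ (crossedMul Θ z w) = crossedMul Θ z * crossedMul Θ w := by
  induction z with
  | zero => simp only [map_zero, zero_mul, LinearMap.zero_apply]
  | add y z hy hz => simp only [map_add, add_mul, hy, hz, LinearMap.add_apply]
  | tmul a x =>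
    induction w with
    | zero => simp only [map_zero, mul_zero]
    | add y z hy hz => simp only [map_add, mul_add, hy, hz]
    | tmul b y =>
      rw [crossedMul_tmul, crossedMul_tmul, Module.End.mul_apply, crossedMul_left, crossedMul_hat,
        h.straighten]
      simp only [mul_assoc]

lemma crossedMul_one_left (Θ : K →ₐ[k] Module.End k A ⊗[k] K) (z : A ⊗[k] K) :
    crossedMul Θ (1 ⊗ₜ 1) z = z := by
  rw [crossedMul_tmul, map_one, map_one, map_one, one_mul, Module.End.one_apply]

lemma crossedMul_one_right {Θ : K →ₐ[k] Module.End k A ⊗[k] K} (h : IsCrossed Θ) (z : A ⊗[k] K) :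
    crossedMul Θ z (1 ⊗ₜ 1) = z := by
  induction z with
  | zero => simp only [map_zero, LinearMap.zero_apply]
  | add y z hy hz => rw [map_add, LinearMap.add_apply, hy, hz]
  | tmul a x => rw [crossedMul_tmul, Module.End.mul_apply, h.unit]; simp

/-- The crossed product `A ⊗ K` with the multiplication `(a ⊗ x)(b ⊗ y) = a (x₍₋₁₎.b) ⊗ x₍₀₎ y`. -/
def CrossedProduct {Θ : K →ₐ[k] Module.End k A ⊗[k] K} (_ : IsCrossed Θ) : Type u := A ⊗[k] K

namespace CrossedProduct
variable {Θ : K →ₐ[k] Module.End k A ⊗[k] K} (h : IsCrossed Θ)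

instance : AddCommGroup (CrossedProduct h) := inferInstanceAs (AddCommGroup (A ⊗[k] K))
instance : Module k (CrossedProduct h) := inferInstanceAs (Module k (A ⊗[k] K))

instance : Ring (CrossedProduct h) where
  __ := (inferInstance : AddCommGroup (CrossedProduct h))
  mul z w := crossedMul Θ z w
  one := (1 : A) ⊗ₜ[k] (1 : K)
  mul_assoc x y z := LinearMap.congr_fun (crossedMul_mul h x y) z
  one_mul := crossedMul_one_left Θ
  mul_one := crossedMul_one_right h
  left_distrib x y z := map_add (crossedMul Θ x) y z
  right_distrib x y z := LinearMap.congr_fun (map_add (crossedMul Θ) x y) z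
  zero_mul z := LinearMap.congr_fun (map_zero (crossedMul Θ)) z
  mul_zero z := map_zero (crossedMul Θ z)

instance : Algebra k (CrossedProduct h) :=
  Algebra.ofModule (fun r x y => LinearMap.congr_fun (map_smul (crossedMul Θ) r x) y)
    (fun r x y => map_smul (crossedMul Θ x) r y)

/-- The inclusion `a ↦ a ⊗ 1`. -/
def inclLeft : A →ₐ[k] CrossedProduct h :=
  AlgHom.ofLinearMap ((TensorProduct.mk k A K).flip 1) rfl fun a b => by
    change (a * b) ⊗ₜ[k] (1 : K) = crossedMul Θ (a ⊗ₜ[k] (1 : K)) (b ⊗ₜ[k] (1 : K))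
    rw [crossedMul_tmul, map_one, map_one, mul_one, crossedLeft_tmul]

/-- The inclusion `x ↦ 1 ⊗ x`. -/
def inclRight : K →ₐ[k] CrossedProduct h :=
  AlgHom.ofLinearMap (TensorProduct.mk k A K 1) rfl fun x y => by
    change (1 : A) ⊗ₜ[k] (x * y) = crossedMul Θ ((1 : A) ⊗ₜ[k] x) ((1 : A) ⊗ₜ[k] y)
    have h1 := h.unit (x * y)
    rw [map_mul, map_mul, Module.End.mul_apply, h.unit] at h1
    rw [crossedMul_tmul, map_one, one_mul, h1]

end CrossedProduct
end Crossed

section ModuleAlgebra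
variable {k : Type u} [Field k]

/-- `l` makes `A` a module algebra over `H`, where `H` is equipped with the comultiplication `D`
and the counit `e`: `h.(a b) = (h₍₁₎.a) (h₍₂₎.b)` with `D h = h₍₁₎ ⊗ h₍₂₎`, and `h.1 = e(h) 1`. -/
structure IsModuleAlgebra {H A : Type u} [Ring H] [Algebra k H] [Ring A] [Algebra k A]
    (D : H →ₗ[k] H ⊗[k] H) (e : H →ₗ[k] k) (l : H →ₐ[k] Module.End k A) : Prop where
  mul : ∀ h a b, l h (a * b) = LinearMap.mul' k A
    (TensorProduct.map (LinearMap.applyₗ a ∘ₗ l.toLinearMap) (LinearMap.applyₗ b ∘ₗ l.toLinearMap)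
      (D h))
  one : ∀ h, l h 1 = e h • (1 : A)

variable {H₁ H₂ : HopfAlgCat.{u} k} {K : AlgCat.{u} k} {A KV : Type u} [Ring A] [Algebra k A]
  [Ring KV] [Algebra k KV]

/-- The algebra map `H₁ ⊗ (K ⊗ H₂) → End(A) ⊗ KV`, `h ⊗ (x ⊗ g) ↦ (a ↦ h.(g.a)) ⊗ x`, for two
commuting actions of `H₁` and `H₂` on `A` and an algebra map `K → KV`. -/
def actPair (l : H₁ →ₐ[k] Module.End k A) (r : H₂ →ₐ[k] Module.End k A)
    (hlr : ∀ h g, Commute (l h) (r g)) (s : K →ₐ[k] KV) :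
    H₁ ⊗[k] (K ⊗[k] H₂) →ₐ[k] Module.End k A ⊗[k] KV :=
  Algebra.TensorProduct.lift (Algebra.TensorProduct.includeLeft.comp l)
    (Algebra.TensorProduct.lift (Algebra.TensorProduct.includeRight.comp s)
      (Algebra.TensorProduct.includeLeft.comp r) fun x g => by
        simp [Commute, SemiconjBy])
    fun h t => by
      induction t with
      | zero => simp
      | add x y hx hy => rw [map_add]; exact hx.add_right hy
      | tmul x g =>
        change l h ⊗ₜ[k] 1 * (1 ⊗ₜ[k] s x * r g ⊗ₜ[k] 1) = (1 ⊗ₜ[k] s x * r g ⊗ₜ[k] 1) * l h ⊗ₜ[k] 1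
        simp [(hlr h g).eq]

@[simp] lemma actPair_tmul (l : H₁ →ₐ[k] Module.End k A) (r : H₂ →ₐ[k] Module.End k A)
    (hlr : ∀ h g, Commute (l h) (r g)) (s : K →ₐ[k] KV) (h : H₁) (x : K) (g : H₂) :
    actPair l r hlr s (h ⊗ₜ (x ⊗ₜ g)) = (l h * r g) ⊗ₜ s x := by
  change l h ⊗ₜ[k] 1 * (1 ⊗ₜ[k] s x * r g ⊗ₜ[k] 1) = _
  simp

variable {l : H₁ →ₐ[k] Module.End k A} {r : H₂ →ₐ[k] Module.End k A}

lemma actPair_straighten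
    (hlr : ∀ h g, Commute (l h) (r g)) (s : K →ₐ[k] KV)
    (hl : IsModuleAlgebra Coalgebra.comul Coalgebra.counit l)
    (hr : IsModuleAlgebra ((TensorProduct.comm k H₂ H₂).toLinearMap ∘ₗ Coalgebra.comul)
      Coalgebra.counit r) (b : BicomoduleAlgebra H₁ K H₂)
    (Θ : KV →ₐ[k] Module.End k A ⊗[k] KV) (hΘ : ∀ x, Θ (s x) = actPair l r hlr s (b.coact x))
    (x : K) (a : A) :
    crossedP Θ a (Θ (s x)) = crossedHat (Θ (s x)) * crossedLeft a := by
  let J := actPair l r hlr s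
  let Z : H₁ ⊗[k] ((H₁ ⊗[k] (K ⊗[k] H₂)) ⊗[k] H₂) →ₗ[k]
      Module.End k (A ⊗[k] KV) :=
    TensorProduct.lift (LinearMap.compr₂ (TensorProduct.mk k _ _) (LinearMap.mul' k (Module.End k (A ⊗[k] KV)) ∘ₗ
      TensorProduct.map crossedLeft.toLinearMap (crossedHat.toLinearMap ∘ₗ J.toLinearMap) ∘ₗ
      TensorProduct.map (TensorProduct.lift (l.toLinearMap.compl₂
        (LinearMap.applyₗ a ∘ₗ r.toLinearMap))) LinearMap.id ∘ₗ
        (TensorProduct.assoc k H₁ H₂ _).symm.toLinearMap ∘ₗ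
          (TensorProduct.comm k _ H₂).toLinearMap.lTensor H₁))
  have hZ : ∀ h t g, Z (h ⊗ₜ (t ⊗ₜ g)) = crossedLeft (l h (r g a)) * crossedHat (J t) := by
    intro h t g
    rfl
  have h1 : ∀ t, crossedP Θ a (J t) = Z ((b.coact.toLinearMap.rTensor H₂).lTensor H₁ t) := by
    intro t
    induction t with
    | zero => simp only [map_zero]
    | add x y hx hy => simp only [map_add, hx, hy]
    | tmul h t =>
      induction t with
      | zero => simp only [map_zero, TensorProduct.tmul_zero]
      | add x y hx hy => simp only [map_add, TensorProduct.tmul_add, hx, hy]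
      | tmul x g =>
        rw [LinearMap.lTensor_tmul, LinearMap.rTensor_tmul, hZ]
        simp only [J, actPair_tmul, crossedP_tmul, hΘ]
        rfl
  have h2 : ∀ t, crossedHat (J t) * crossedLeft a = Z (bicomoduleAssoc k H₁ K H₂
      (TensorProduct.map Coalgebra.comul (Coalgebra.comul.lTensor K) t)) := by
    intro t
    induction t with
    | zero => simp only [map_zero, zero_mul]
    | add x y hx hy => simp only [map_add, add_mul, hx, hy]
    | tmul h t =>
      induction t with
      | zero => simp only [map_zero, TensorProduct.tmul_zero, zero_mul]
      | add x y hx hy => simp only [map_add, TensorProduct.tmul_add, add_mul, hx, hy]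
      | tmul x g =>
        refine TensorProduct.ext' fun c y => ?_
        simp only [TensorProduct.map_tmul, LinearMap.lTensor_tmul]
        change crossedHat (J (h ⊗ₜ (x ⊗ₜ g))) ((a * c) ⊗ₜ y) = _
        simp only [J, actPair_tmul]
        rw [crossedHat_tmul, Module.End.mul_apply, hr.mul, LinearMap.comp_apply]
        generalize (Coalgebra.comul (R := k) g) = w
        induction w with
        | zero => simp only [map_zero, TensorProduct.tmul_zero, TensorProduct.zero_tmul,
            LinearMap.zero_apply]
        | add x y hx hy => simp only [map_add, TensorProduct.tmul_add, TensorProduct.add_tmul,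
            LinearMap.add_apply, hx, hy]
        | tmul g₁ g₂ =>
          rw [LinearEquiv.coe_coe, TensorProduct.comm_tmul, TensorProduct.map_tmul,
            LinearMap.mul'_apply]
          simp only [LinearMap.comp_apply, AlgHom.toLinearMap_apply, LinearMap.applyₗ_apply_apply, hl.mul]
          generalize (Coalgebra.comul (R := k) h) = v
          induction v with
          | zero => simp only [map_zero, TensorProduct.zero_tmul, LinearMap.zero_apply]
          | add x y hx hy => simp only [map_add, TensorProduct.add_tmul,
              LinearMap.add_apply, hx, hy]
          | tmul h₁ h₂ =>
            have e : bicomoduleAssoc k H₁ K H₂ ((h₁ ⊗ₜ h₂) ⊗ₜ (x ⊗ₜ (g₁ ⊗ₜ g₂))) =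
              h₁ ⊗ₜ ((h₂ ⊗ₜ (x ⊗ₜ g₁)) ⊗ₜ g₂) := rfl
            rw [e, hZ]
            simp [J]
  rw [hΘ, h2, ← b.coassoc]
  exact h1 _

lemma actPair_unit
    (hlr : ∀ h g, Commute (l h) (r g)) (s : K →ₐ[k] KV)
    (hl : IsModuleAlgebra Coalgebra.comul Coalgebra.counit l)
    (hr : IsModuleAlgebra ((TensorProduct.comm k H₂ H₂).toLinearMap ∘ₗ Coalgebra.comul)
      Coalgebra.counit r) (b : BicomoduleAlgebra H₁ K H₂) (x : K) :
    crossedHat (actPair l r hlr s (b.coact x)) (1 ⊗ₜ 1) = 1 ⊗ₜ s x := by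
  have h : ∀ t, crossedHat (actPair l r hlr s t) (1 ⊗ₜ 1) = (1 : A) ⊗ₜ s (TensorProduct.lid k K
      (TensorProduct.map Coalgebra.counit
        ((TensorProduct.rid k K).toLinearMap ∘ₗ Coalgebra.counit.lTensor K) t)) := by
    intro t
    induction t with
    | zero => simp
    | add x y hx hy => simp only [map_add, LinearMap.add_apply, TensorProduct.tmul_add, hx, hy]
    | tmul h t =>
      induction t with
      | zero => simp
      | add x y hx hy => simp only [map_add, LinearMap.add_apply, TensorProduct.tmul_add, hx, hy]
      | tmul x g =>
        rw [actPair_tmul, crossedHat_tmul, Module.End.mul_apply, hr.one, map_smul, hl.one]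
        simp [TensorProduct.smul_tmul, smul_smul, mul_comm]
  rw [h, b.counit]

end ModuleAlgebra

section DualActions
variable {k : Type u} [Field k]

/-- The dual `H^*` of a Hopf algebra, an algebra with the convolution product
`(f g)(x) = f(x₍₁₎) g(x₍₂₎)`. -/
abbrev HopfDual (H : HopfAlgCat.{u} k) : Type u := WithConv (H →ₗ[k] k)

/-- The left action `h.f = f(? · h)` of `H` on `H^*`. -/
def regL (H : HopfAlgCat.{u} k) : H →ₐ[k] Module.End k (HopfDual H) :=
  AlgHom.ofLinearMap
    { toFun := fun h =>
        { toFun := fun f => WithConv.toConv (f.ofConv ∘ₗ LinearMap.mulRight k h)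
          map_add' := fun _ _ => rfl
          map_smul' := fun _ _ => rfl }
      map_add' := fun h g => LinearMap.ext fun f => WithConv.ofConv_injective <|
        LinearMap.ext fun x => (congrArg f.ofConv (mul_add x h g)).trans (map_add f.ofConv _ _)
      map_smul' := fun c h => LinearMap.ext fun f => WithConv.ofConv_injective <|
        LinearMap.ext fun x =>
          (congrArg f.ofConv (mul_smul_comm c x h)).trans (map_smul f.ofConv c _) }
    (LinearMap.ext fun f => WithConv.ofConv_injective <| LinearMap.ext fun x =>
      congrArg f.ofConv (mul_one x))
    fun h g => LinearMap.ext fun f => WithConv.ofConv_injective <|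
      LinearMap.ext fun x => congrArg f.ofConv (mul_assoc x h g).symm

/-- The right action `f.h = f(h · ?)` of `H` on `H^*`, written as a left action of `H^op`. -/
def regR (H : HopfAlgCat.{u} k) : Hᵐᵒᵖ →ₐ[k] Module.End k (HopfDual H) :=
  AlgHom.ofLinearMap
    { toFun := fun h =>
        { toFun := fun f => WithConv.toConv (f.ofConv ∘ₗ LinearMap.mulLeft k h.unop)
          map_add' := fun _ _ => rfl
          map_smul' := fun _ _ => rfl }
      map_add' := fun h g => LinearMap.ext fun f => WithConv.ofConv_injective <|
        LinearMap.ext fun x =>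
          (congrArg f.ofConv (add_mul h.unop g.unop x)).trans (map_add f.ofConv _ _)
      map_smul' := fun c h => LinearMap.ext fun f => WithConv.ofConv_injective <|
        LinearMap.ext fun x =>
          (congrArg f.ofConv (smul_mul_assoc c h.unop x)).trans (map_smul f.ofConv c _) }
    (LinearMap.ext fun f => WithConv.ofConv_injective <| LinearMap.ext fun x =>
      congrArg f.ofConv (one_mul x))
    fun h g => LinearMap.ext fun f => WithConv.ofConv_injective <|
      LinearMap.ext fun x => congrArg f.ofConv (mul_assoc g.unop h.unop x)

lemma regL_apply (H : HopfAlgCat.{u} k) (h : H) (f : HopfDual H) (x : H) :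
    regL H h f x = f (x * h) := rfl

lemma regR_apply (H : HopfAlgCat.{u} k) (h : Hᵐᵒᵖ) (f : HopfDual H) (x : H) :
    regR H h f x = f (h.unop * x) := rfl

lemma regL_commute (H : HopfAlgCat.{u} k) (h : H) (g : Hᵐᵒᵖ) : Commute (regL H h) (regR H g) :=
  LinearMap.ext fun f => WithConv.ofConv_injective <| LinearMap.ext fun _ =>
    congrArg f.ofConv (mul_assoc _ _ _).symm

lemma regL_moduleAlgebra {H H' : HopfAlgCat.{u} k} (φ : H' →ₐ[k] H)
    (hφ : ∀ x, Coalgebra.comul (R := k) (φ x) =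
      TensorProduct.map φ.toLinearMap φ.toLinearMap (Coalgebra.comul (R := k) x))
    (hφ' : ∀ x, Coalgebra.counit (R := k) (φ x) = Coalgebra.counit (R := k) x) :
    IsModuleAlgebra (Coalgebra.comul (R := k) (A := H')) (Coalgebra.counit (R := k) (A := H'))
      ((regL H).comp φ) where
  mul h a b := by
    refine WithConv.ofConv_injective <| LinearMap.ext fun x => ?_
    refine (regL_apply H (φ h) (a * b) x).trans ?_
    rw [LinearMap.convMul_apply, Bialgebra.comul_mul, hφ]
    generalize Coalgebra.comul (R := k) h = t
    induction t with
    | zero => simp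
    | add y z hy hz =>
      simp only [map_add, mul_add, hy, hz]
      rfl
    | tmul g g' =>
      change _ = (regL H (φ g) a * regL H (φ g') b) x
      rw [LinearMap.convMul_apply]
      generalize Coalgebra.comul (R := k) x = s
      induction s with
      | zero => simp
      | add y z hy hz => simp only [map_add, add_mul, hy, hz]
      | tmul y z =>
        rw [TensorProduct.map_tmul, Algebra.TensorProduct.tmul_mul_tmul]
        rfl
  one h := by
    refine WithConv.ofConv_injective <| LinearMap.ext fun x => ?_
    refine (regL_apply H (φ h) 1 x).trans ?_
    rw [LinearMap.convOne_apply, Bialgebra.counit_mul, hφ', mul_comm]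
    simp

lemma regR_moduleAlgebra {H H' : HopfAlgCat.{u} k} (φ : H' →ₐ[k] Hᵐᵒᵖ)
    (hφ : ∀ x, Coalgebra.comul (R := k) (φ x).unop = TensorProduct.comm k H H (TensorProduct.map
        ((MulOpposite.opLinearEquiv k).symm.toLinearMap ∘ₗ φ.toLinearMap)
        ((MulOpposite.opLinearEquiv k).symm.toLinearMap ∘ₗ φ.toLinearMap)
        (Coalgebra.comul (R := k) x)))
    (hφ' : ∀ x, Coalgebra.counit (R := k) (φ x).unop = Coalgebra.counit (R := k) x) :
    IsModuleAlgebra ((TensorProduct.comm k H' H').toLinearMap ∘ₗ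
      Coalgebra.comul (R := k) (A := H')) (Coalgebra.counit (R := k) (A := H'))
      ((regR H).comp φ) where
  mul h a b := by
    refine WithConv.ofConv_injective <| LinearMap.ext fun x => ?_
    refine (regR_apply H (φ h) (a * b) x).trans ?_
    rw [LinearMap.convMul_apply, Bialgebra.comul_mul, hφ,
      LinearMap.comp_apply]
    generalize Coalgebra.comul (R := k) h = t
    induction t with
    | zero => simp
    | add y z hy hz =>
      simp only [map_add, add_mul, hy, hz]
      rfl
    | tmul g g' =>
      change _ = (regR H (φ g') a * regR H (φ g) b) x
      rw [LinearMap.convMul_apply]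
      generalize Coalgebra.comul (R := k) x = s
      induction s with
      | zero => simp
      | add y z hy hz => simp only [map_add, mul_add, hy, hz]
      | tmul y z =>
        rw [TensorProduct.map_tmul, TensorProduct.comm_tmul, Algebra.TensorProduct.tmul_mul_tmul]
        rfl
  one h := by
    refine WithConv.ofConv_injective <| LinearMap.ext fun x => ?_
    refine (regR_apply H (φ h) 1 x).trans ?_
    rw [LinearMap.convOne_apply, Bialgebra.counit_mul, hφ']
    simp

lemma counit_signPow (H : HopfAlgCat.{u} k) : (ε : Bool) → (x : signedHopf ε H) →
    Coalgebra.counit (R := k) (signPow H ε x) = Coalgebra.counit (R := k) x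
  | true, _ => rfl
  | false, x => HopfAlgebra.counit_antipode (R := k) (A := H) x.unop

lemma counit_signNegPow (H : HopfAlgCat.{u} k) : (ε : Bool) → (x : signedHopf ε H) →
    Coalgebra.counit (R := k) (signNegPow H ε x).unop = Coalgebra.counit (R := k) x
  | true, x => HopfAlgebra.counit_antipode (R := k) (A := H) x
  | false, _ => rfl

/-- The trivial action, through the counit. -/
def trivialAct (H : HopfAlgCat.{u} k) (A : Type u) [Ring A] [Algebra k A] :
    H →ₐ[k] Module.End k A :=
  (Algebra.ofId k (Module.End k A)).comp (Bialgebra.counitAlgHom k H)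

lemma trivialAct_apply (H : HopfAlgCat.{u} k) (A : Type u) [Ring A] [Algebra k A] (h : H) (a : A) :
    trivialAct H A h a = Coalgebra.counit (R := k) h • a := by
  simp [trivialAct, Algebra.ofId_apply]

lemma trivialAct_moduleAlgebra_aux (H : HopfAlgCat.{u} k) (A : Type u) [Ring A] [Algebra k A]
    (D : H →ₗ[k] H ⊗[k] H) (hD : ∀ h, LinearMap.mul' k k
      (TensorProduct.map Coalgebra.counit Coalgebra.counit (D h)) = Coalgebra.counit h) :
    IsModuleAlgebra D Coalgebra.counit (trivialAct H A) where
  mul h a b := by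
    rw [trivialAct_apply, ← hD]
    generalize D h = t
    induction t with
    | zero => simp
    | add x y hx hy => simp only [map_add, add_smul, hx, hy]
    | tmul x y => simp [trivialAct_apply, smul_smul, mul_comm]
  one h := trivialAct_apply H A h 1

lemma mul_counit_counit (H : HopfAlgCat.{u} k) (h : H) : LinearMap.mul' k k
    (TensorProduct.map Coalgebra.counit Coalgebra.counit (Coalgebra.comul (R := k) h)) =
      Coalgebra.counit h := by
  have e : ∀ t : H ⊗[k] H, LinearMap.mul' k k (TensorProduct.map Coalgebra.counit Coalgebra.counit t)
      = Coalgebra.counit (R := k) (TensorProduct.lid k H (Coalgebra.counit.rTensor H t)) := by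
    intro t
    induction t with
    | zero => simp
    | add x y hx hy => simp only [map_add, hx, hy]
    | tmul x y => simp
  rw [e, Coalgebra.rTensor_counit_comul]
  simp

lemma trivialAct_moduleAlgebra (H : HopfAlgCat.{u} k) (A : Type u) [Ring A] [Algebra k A] :
    IsModuleAlgebra Coalgebra.comul Coalgebra.counit (trivialAct H A) :=
  trivialAct_moduleAlgebra_aux H A _ (mul_counit_counit H)

lemma trivialAct_moduleAlgebra' (H : HopfAlgCat.{u} k) (A : Type u) [Ring A] [Algebra k A] :
    IsModuleAlgebra ((TensorProduct.comm k H H).toLinearMap ∘ₗ Coalgebra.comul) Coalgebra.counit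
      (trivialAct H A) := by
  refine trivialAct_moduleAlgebra_aux H A _ fun h => (Eq.trans ?_ (mul_counit_counit H h))
  rw [LinearMap.comp_apply]
  generalize Coalgebra.comul (R := k) h = t
  induction t with
  | zero => simp
  | add x y hx hy => simp only [map_add, hx, hy]
  | tmul x y => simp [mul_comm]

lemma trivialAct_commute (H : HopfAlgCat.{u} k) (A : Type u) [Ring A] [Algebra k A] (h : H)
    (T : Module.End k A) : Commute (trivialAct H A h) T :=
  Algebra.commutes (Coalgebra.counit (R := k) h) T

end DualActions

section EndSingle
variable {k : Type u} [Field k] {ι : Type} [DecidableEq ι] {B : ι → Type u}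
  [∀ i, Ring (B i)] [∀ i, Algebra k (B i)]

/-- An endomorphism of the `i`-th tensor factor as an endomorphism of the tensor product. -/
def endSingle (i : ι) : Module.End k (B i) →ₐ[k] Module.End k (⨂[k] i, B i) :=
  AlgHom.ofLinearMap
    { toFun := fun T => PiTensorProduct.map (Function.update 1 i T)
      map_add' := fun S T => PiTensorProduct.map_update_add _ i S T
      map_smul' := fun c T => PiTensorProduct.map_update_smul _ i c T }
    (by
      change PiTensorProduct.map (Function.update 1 i 1) = _
      exact (congrArg _ (Function.update_eq_self_iff.2 rfl)).trans PiTensorProduct.map_one)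
    fun S T => by
      change PiTensorProduct.map (Function.update 1 i (S * T)) =
        PiTensorProduct.map (Function.update 1 i S) * PiTensorProduct.map (Function.update 1 i T)
      rw [← PiTensorProduct.map_mul]
      congr 1
      exact (Pi.mulSingle_mul _ _ _)

lemma endSingle_tprod (i : ι) (T : Module.End k (B i)) (x : ∀ i, B i) :
    endSingle i T (PiTensorProduct.tprod k x) =
      PiTensorProduct.tprod k (Function.update x i (T (x i))) := by
  refine (PiTensorProduct.map_tprod _ _).trans ?_
  congr 1
  ext j
  by_cases h : j = i
  · subst h; simp
  · simp [h]

lemma endSingle_commute {i j : ι} (h : i ≠ j) (S : Module.End k (B i)) (T : Module.End k (B j)) :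
    Commute (endSingle (k := k) (B := B) i S) (endSingle j T) := by
  change PiTensorProduct.map (Function.update 1 i S) * PiTensorProduct.map (Function.update 1 j T) =
    PiTensorProduct.map (Function.update 1 j T) * PiTensorProduct.map (Function.update 1 i S)
  rw [← PiTensorProduct.map_mul, ← PiTensorProduct.map_mul]
  congr 1
  exact Pi.mulSingle_commute (f := fun i => Module.End k (B i)) h S T

lemma endSingle_moduleAlgebra (i : ι) {H : Type u} [Ring H] [Algebra k H] {D : H →ₗ[k] H ⊗[k] H}
    {e : H →ₗ[k] k} {l : H →ₐ[k] Module.End k (B i)} (hl : IsModuleAlgebra D e l) :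
    IsModuleAlgebra D e ((endSingle (k := k) (B := B) i).comp l) where
  mul h a b := by
    induction a using PiTensorProduct.induction_on with
    | add x y hx hy =>
      simp only [add_mul, map_add, hx, hy, LinearMap.add_comp, TensorProduct.map_add_left,
        LinearMap.add_apply]
    | smul_tprod r x =>
      induction b using PiTensorProduct.induction_on with
      | add x y hx hy =>
        simp only [mul_add, map_add, hx, hy, LinearMap.add_comp, TensorProduct.map_add_right,
          LinearMap.add_apply]
      | smul_tprod s y =>
        simp only [smul_mul_assoc, mul_smul_comm, map_smul, LinearMap.smul_comp,
          TensorProduct.map_smul_left, TensorProduct.map_smul_right, LinearMap.smul_apply]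
        congr 2
        simp only [PiTensorProduct.tprod_mul_tprod, AlgHom.comp_apply, endSingle_tprod,
          Pi.mul_apply, hl.mul]
        generalize D h = t
        induction t with
        | zero => simp only [map_zero, MultilinearMap.map_update_zero]
        | add x y hx hy => simp only [map_add, MultilinearMap.map_update_add, hx, hy]
        | tmul g g' =>
          simp [endSingle_tprod]
          congr 1
          ext j
          by_cases h : j = i
          · subst h; simp
          · simp [h]
  one h := by
    rw [PiTensorProduct.one_def, AlgHom.comp_apply, endSingle_tprod, Pi.one_apply, hl.one,
      MultilinearMap.map_update_smul]
    congr 2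
    exact Function.update_eq_self_iff.2 rfl

end EndSingle

/-- A circle with finitely many oriented marked points, together with its labels. Here `nxt i` is the
marked point that follows `i` in clockwise order, `sgn i` is the sign of `i` (`true` is `+1`), and
the segment between `nxt⁻¹ i` and `i` is indexed by `i`. The segments `p` with `isSite p` are those at
which balancings are considered. The segment `p` is labelled by the Hopf algebra `H p` and the marked
point `i` by `K i`, an `H i`-`H (nxt i)`-bicomodule algebra if `sgn i = +1` and an
`H (nxt i)`-`H i`-bicomodule algebra if `sgn i = -1`. -/
structure DecoratedCircle (k : Type u) [Field k] where
  pt : Type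
  [fintype : Fintype pt]
  [decEq : DecidableEq pt]
  [nonempty : Nonempty pt]
  nxt : Equiv.Perm pt
  cyclic : ∀ i j, nxt.SameCycle i j
  sgn : pt → Bool
  isSite : pt → Prop
  H : pt → HopfAlgCat.{u} k
  [finiteH : ∀ i, Module.Finite k (H i)]
  K : pt → AlgCat.{u} k
  bico : ∀ i, SignedBicomoduleAlgebra (H i) (K i) (H (nxt i)) (sgn i)

namespace DecoratedCircle

attribute [instance] DecoratedCircle.fintype DecoratedCircle.decEq DecoratedCircle.nonempty
  DecoratedCircle.finiteH

variable {k : Type u} [Field k] (C : DecoratedCircle k)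

/-- The algebra `K_i^ε`, where `ε` is the sign of `i`. -/
abbrev signedK (i : C.pt) : AlgCat.{u} k := signedAlg (C.sgn i) (C.K i)

/-- The `H_i^ε`-`H_{nxt i}^ε`-bicomodule algebra `K_i^ε`, where `ε` is the sign of `i`. -/
def bi (i : C.pt) : BicomoduleAlgebra (signedHopf (C.sgn i) (C.H i)) (C.signedK i)
    (signedHopf (C.sgn i) (C.H (C.nxt i))) :=
  (C.bico i).toBicomoduleAlgebra

/-- The algebra `⨂ᵢ K_i^ε`. Its category of modules is the Deligne product of the categories of
modules over the `K_i^ε`. -/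
def KAlg : Type u := ⨂[k] i, C.signedK i

instance : Ring C.KAlg := inferInstanceAs (Ring (⨂[k] i, C.signedK i))
instance : Algebra k C.KAlg := inferInstanceAs (Algebra k (⨂[k] i, C.signedK i))

/-- The sites: the segments at which balancings are considered. -/
abbrev Site : Type := {p // C.isSite p}

/-- The algebra `⨂_p H_p^*`, where `p` runs over the sites. -/
def DualAlg : Type u := ⨂[k] p : C.Site, HopfDual (C.H p)

instance : Ring C.DualAlg := inferInstanceAs (Ring (⨂[k] p : C.Site, HopfDual (C.H p)))
instance : Algebra k C.DualAlg :=
  inferInstanceAs (Algebra k (⨂[k] p : C.Site, HopfDual (C.H p)))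

/-- The inclusion of a tensor factor. -/
def single (i : C.pt) : C.signedK i →ₐ[k] C.KAlg :=
  PiTensorProduct.singleAlgHom (R := k) (A := fun i => (C.signedK i : Type u)) i

lemma single_commute {i j : C.pt} (h : i ≠ j) (x : C.signedK i) (y : C.signedK j) :
    Commute (C.single i x) (C.single j y) :=
  commute_single (k := k) (B := fun i => (C.signedK i : Type u)) h x y

/-- The algebra map on `⨂ᵢ K_i^ε` with given restrictions to the tensor factors, for restrictions
with pairwise commuting images. -/
def liftK {S : Type u} [Semiring S] [Algebra k S] (f : ∀ i, C.signedK i →ₐ[k] S)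
    (hf : Pairwise fun i j => ∀ x y, Commute (f i x) (f j y)) : C.KAlg →ₐ[k] S :=
  piLift (k := k) (B := fun i => (C.signedK i : Type u)) f hf

lemma liftK_single {S : Type u} [Semiring S] [Algebra k S] (f : ∀ i, C.signedK i →ₐ[k] S)
    (hf : Pairwise fun i j => ∀ x y, Commute (f i x) (f j y)) (i : C.pt) (x : C.signedK i) :
    C.liftK f hf (C.single i x) = f i x :=
  piLift_single (k := k) (B := fun i => (C.signedK i : Type u)) f hf i x

lemma eq_top_of_mem_single (T : Subalgebra k C.KAlg) (hT : ∀ i x, C.single i x ∈ T) : T = ⊤ :=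
  eq_top_of_single (k := k) (B := fun i => (C.signedK i : Type u)) T hT

/-- An endomorphism of `H_p^*` as an endomorphism of `⨂_q H_q^*`. -/
def endSite (p : C.Site) : Module.End k (HopfDual (C.H p)) →ₐ[k] Module.End k C.DualAlg :=
  endSingle (k := k) (B := fun p : C.Site => HopfDual (C.H p)) p

lemma endSite_commute {p q : C.Site} (h : p ≠ q) (S : Module.End k (HopfDual (C.H p)))
    (T : Module.End k (HopfDual (C.H q))) : Commute (C.endSite p S) (C.endSite q T) :=
  endSingle_commute (k := k) (B := fun p : C.Site => HopfDual (C.H p)) h S T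

lemma endSite_moduleAlgebra (p : C.Site) {H : Type u} [Ring H] [Algebra k H]
    {D : H →ₗ[k] H ⊗[k] H} {e : H →ₗ[k] k} {l : H →ₐ[k] Module.End k (HopfDual (C.H p))}
    (hl : IsModuleAlgebra D e l) : IsModuleAlgebra D e ((C.endSite p).comp l) :=
  endSingle_moduleAlgebra (B := fun p : C.Site => HopfDual (C.H p)) p hl

open Classical in
/-- The action of `H_p^ε` on `⨂_q H_q^*` by `a.f = f(? · a^⟨ε⟩)` on the factor `H_p^*`. If `p` is not
a site, then there is no such factor and the action is through the counit. -/
def actL (p : C.pt) (ε : Bool) : signedHopf ε (C.H p) →ₐ[k] Module.End k C.DualAlg :=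
  if h : C.isSite p then
    (C.endSite ⟨p, h⟩).comp
      ((regL (C.H p)).comp (signPow (C.H p) ε))
  else trivialAct (signedHopf ε (C.H p)) C.DualAlg

open Classical in
/-- The action of `H_p^ε` on `⨂_q H_q^*` by `a.f = f(a^⟨-ε⟩ · ?)` on the factor `H_p^*`. If `p` is not
a site, then there is no such factor and the action is through the counit. -/
def actR (p : C.pt) (ε : Bool) : signedHopf ε (C.H p) →ₐ[k] Module.End k C.DualAlg :=
  if h : C.isSite p then
    (C.endSite ⟨p, h⟩).comp
      ((regR (C.H p)).comp (signNegPow (C.H p) ε))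
  else trivialAct (signedHopf ε (C.H p)) C.DualAlg

lemma actL_moduleAlgebra (p : C.pt) (ε : Bool) :
    IsModuleAlgebra Coalgebra.comul Coalgebra.counit (C.actL p ε) := by
  unfold actL
  split_ifs with h
  · exact C.endSite_moduleAlgebra ⟨p, h⟩
      (regL_moduleAlgebra (signPow (C.H p) ε) (comul_signPow _ ε) (counit_signPow _ ε))
  · exact trivialAct_moduleAlgebra _ _

lemma actR_moduleAlgebra (p : C.pt) (ε : Bool) :
    IsModuleAlgebra ((TensorProduct.comm k _ _).toLinearMap ∘ₗ Coalgebra.comul) Coalgebra.counit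
      (C.actR p ε) := by
  unfold actR
  split_ifs with h
  · exact C.endSite_moduleAlgebra ⟨p, h⟩
      (regR_moduleAlgebra (signNegPow (C.H p) ε) (comul_signNegPow _ ε) (counit_signNegPow _ ε))
  · exact trivialAct_moduleAlgebra' _ _

lemma actL_actL_commute {p q : C.pt} (hpq : p ≠ q) (ε δ : Bool) (x : signedHopf ε (C.H p))
    (y : signedHopf δ (C.H q)) : Commute (C.actL p ε x) (C.actL q δ y) := by
  unfold actL
  split_ifs with h h' h'
  · exact C.endSite_commute (fun e => hpq (congrArg Subtype.val e)) _ _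
  · exact (trivialAct_commute _ _ _ _).symm
  · exact trivialAct_commute _ _ _ _
  · exact trivialAct_commute _ _ _ _

lemma actR_actR_commute {p q : C.pt} (hpq : p ≠ q) (ε δ : Bool) (x : signedHopf ε (C.H p))
    (y : signedHopf δ (C.H q)) : Commute (C.actR p ε x) (C.actR q δ y) := by
  unfold actR
  split_ifs with h h' h'
  · exact C.endSite_commute (fun e => hpq (congrArg Subtype.val e)) _ _
  · exact (trivialAct_commute _ _ _ _).symm
  · exact trivialAct_commute _ _ _ _
  · exact trivialAct_commute _ _ _ _

lemma actL_actR_commute (p q : C.pt) (ε δ : Bool) (x : signedHopf ε (C.H p))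
    (y : signedHopf δ (C.H q)) : Commute (C.actL p ε x) (C.actR q δ y) := by
  by_cases hpq : p = q
  · subst hpq
    unfold actL actR
    split_ifs with h
    · exact (regL_commute (C.H p) (signPow _ ε x) (signNegPow _ δ y)).map
        (C.endSite ⟨p, h⟩)
    · exact trivialAct_commute _ _ _ _
  · unfold actL actR
    split_ifs with h h' h'
    · exact C.endSite_commute (fun e => hpq (congrArg Subtype.val e)) _ _
    · exact (trivialAct_commute _ _ _ _).symm
    · exact trivialAct_commute _ _ _ _
    · exact trivialAct_commute _ _ _ _

lemma hlr (i : C.pt) (x : signedHopf (C.sgn i) (C.H i))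
    (y : signedHopf (C.sgn i) (C.H (C.nxt i))) :
    Commute (C.actL i (C.sgn i) x) (C.actR (C.nxt i) (C.sgn i) y) :=
  C.actL_actR_commute i (C.nxt i) (C.sgn i) (C.sgn i) x y

/-- The coaction of `K_i^ε` composed with the actions of `H_i^ε` and `H_{nxt i}^ε`: the map
`x ↦ (f ↦ x₍₋₁₎.(x₍₁₎.f)) ⊗ x₍₀₎`, where `x₍₋₁₎` acts by `actL` and `x₍₁₎` acts by `actR`. -/
def factorAct (i : C.pt) : C.signedK i →ₐ[k] Module.End k C.DualAlg ⊗[k] C.KAlg :=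
  (actPair (C.actL i (C.sgn i)) (C.actR (C.nxt i) (C.sgn i))
    (C.hlr i) (C.single i)).comp (C.bi i).coact

lemma actPair_commute {H₁ H₂ H₁' H₂' : HopfAlgCat.{u} k} {K K' : AlgCat.{u} k} {A KV : Type u}
    [Ring A] [Algebra k A] [Ring KV] [Algebra k KV] (l : H₁ →ₐ[k] Module.End k A)
    (r : H₂ →ₐ[k] Module.End k A) (hlr : ∀ h g, Commute (l h) (r g)) (s : K →ₐ[k] KV)
    (l' : H₁' →ₐ[k] Module.End k A) (r' : H₂' →ₐ[k] Module.End k A)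
    (hlr' : ∀ h g, Commute (l' h) (r' g)) (s' : K' →ₐ[k] KV)
    (h1 : ∀ x y, Commute (l x) (l' y)) (h2 : ∀ x y, Commute (l x) (r' y))
    (h3 : ∀ x y, Commute (r x) (l' y)) (h4 : ∀ x y, Commute (r x) (r' y))
    (h5 : ∀ x y, Commute (s x) (s' y)) (t : H₁ ⊗[k] (K ⊗[k] H₂)) (t' : H₁' ⊗[k] (K' ⊗[k] H₂')) :
    Commute (actPair l r hlr s t) (actPair l' r' hlr' s' t') := by
  induction t with
  | zero => rw [map_zero]; exact Commute.zero_left _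
  | add x y hx hy => rw [map_add]; exact hx.add_left hy
  | tmul a t =>
  induction t with
  | zero => rw [TensorProduct.tmul_zero, map_zero]; exact Commute.zero_left _
  | add x y hx hy => rw [TensorProduct.tmul_add, map_add]; exact hx.add_left hy
  | tmul b c =>
  induction t' with
  | zero => rw [map_zero]; exact Commute.zero_right _
  | add x y hx hy => rw [map_add]; exact hx.add_right hy
  | tmul a' t' =>
  induction t' with
  | zero => rw [TensorProduct.tmul_zero, map_zero]; exact Commute.zero_right _
  | add x y hx hy => rw [TensorProduct.tmul_add, map_add]; exact hx.add_right hy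
  | tmul b' c' =>
    rw [actPair_tmul, actPair_tmul]
    have e1 : Commute (l a * r c) (l' a' * r' c') :=
      ((h1 a a').mul_right (h2 a c')).mul_left ((h3 c a').mul_right (h4 c c'))
    have e2 := h5 b b'
    rw [Commute, SemiconjBy, Algebra.TensorProduct.tmul_mul_tmul,
      Algebra.TensorProduct.tmul_mul_tmul, e1.eq, e2.eq]

lemma factorAct_commute {i j : C.pt} (hij : i ≠ j) (x : C.signedK i) (y : C.signedK j) :
    Commute (C.factorAct i x) (C.factorAct j y) :=
  actPair_commute _ _ (C.hlr i) _ _ _ (C.hlr j) _ (C.actL_actL_commute hij _ _) (C.actL_actR_commute _ _ _ _)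
    (fun x y => (C.actL_actR_commute _ _ _ _ y x).symm)
    (C.actR_actR_commute (fun e => hij (C.nxt.injective e)) _ _) (C.single_commute hij) _ _

/-- The coaction of `⨂ᵢ K_i^ε` composed with the actions on `⨂_p H_p^*`. In particular the action of
`H_p^ε'` and `H_p^ε` on `H_p^*` is `(a' ⊗ a).f = f(a'^⟨-ε'⟩ · ? · a^⟨ε⟩)`, where `a'` comes from the
right coaction of the marked point before `p` and `a` from the left coaction of the one after `p`. -/
def act : C.KAlg →ₐ[k] Module.End k C.DualAlg ⊗[k] C.KAlg :=
  C.liftK C.factorAct fun _ _ h => C.factorAct_commute h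

lemma act_single (i : C.pt) (x : C.signedK i) : C.act (C.single i x) = C.factorAct i x :=
  C.liftK_single C.factorAct _ i x

lemma isCrossed_act : IsCrossed C.act :=
  isCrossed_of_good <| C.eq_top_of_mem_single _ fun i x =>
    ⟨actPair_straighten (C.hlr i) (C.single i)
      (C.actL_moduleAlgebra _ _) (C.actR_moduleAlgebra _ _) (C.bi i) C.act (C.act_single i) x, by
      rw [C.act_single]
      exact actPair_unit (C.hlr i) (C.single i)
        (C.actL_moduleAlgebra _ _) (C.actR_moduleAlgebra _ _)
        (C.bi i) x⟩

/-- The vertex algebra: the crossed product of `⨂_p H_p^*` and `⨂ᵢ K_i^ε`. -/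
abbrev VertexAlgebra : Type u := CrossedProduct C.isCrossed_act

end DecoratedCircle

namespace BicomoduleAlgebra
variable {k : Type u} [Field k] {H₁ : HopfAlgCat.{u} k} {K : AlgCat.{u} k} {H₂ : HopfAlgCat.{u} k}

/-- The left coaction `x ↦ x₍₋₁₎ ⊗ x₍₀₎`. -/
def leftCoact (b : BicomoduleAlgebra H₁ K H₂) : K →ₐ[k] H₁ ⊗[k] K :=
  (Algebra.TensorProduct.map (AlgHom.id k H₁) ((Algebra.TensorProduct.rid k k K).toAlgHom.comp
    (Algebra.TensorProduct.map (AlgHom.id k K) (Bialgebra.counitAlgHom k H₂)))).comp b.coact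

/-- The right coaction `x ↦ x₍₀₎ ⊗ x₍₁₎`. -/
def rightCoact (b : BicomoduleAlgebra H₁ K H₂) : K →ₐ[k] K ⊗[k] H₂ :=
  ((Algebra.TensorProduct.lid k (K ⊗[k] H₂)).toAlgHom.comp
    (Algebra.TensorProduct.map (Bialgebra.counitAlgHom k H₁) (AlgHom.id k (K ⊗[k] H₂)))).comp
      b.coact

end BicomoduleAlgebra

namespace DecoratedCircle
variable {k : Type u} [Field k] (C : DecoratedCircle k)

lemma commute_left {H : Type u} [Ring H] [Algebra k H] {i j : C.pt} (hij : i ≠ j)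
    (t : H ⊗[k] C.signedK i) (y : C.signedK j) :
    Commute (Algebra.TensorProduct.map (AlgHom.id k H) (C.single i) t)
      ((1 : H) ⊗ₜ[k] C.single j y) := by
  induction t with
  | zero => rw [map_zero]; exact Commute.zero_left _
  | add x y hx hy => rw [map_add]; exact hx.add_left hy
  | tmul a x => simp [Commute, SemiconjBy, (C.single_commute hij x y).eq]

lemma commute_right {H : Type u} [Ring H] [Algebra k H] {i j : C.pt} (hij : i ≠ j)
    (t : C.signedK i ⊗[k] H) (y : C.signedK j) :
    Commute (Algebra.TensorProduct.map (C.single i) (AlgHom.id k H) t)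
      (C.single j y ⊗ₜ[k] (1 : H)) := by
  induction t with
  | zero => rw [map_zero]; exact Commute.zero_left _
  | add x y hx hy => rw [map_add]; exact hx.add_left hy
  | tmul x a => simp [Commute, SemiconjBy, (C.single_commute hij x y).eq]

/-- The left coaction of `H_p^ε` on `⨂ᵢ K_i^ε` that comes from the left coaction on the factor
`K_p^ε`. -/
def lco (p : C.pt) : C.KAlg →ₐ[k] signedHopf (C.sgn p) (C.H p) ⊗[k] C.KAlg :=
  C.liftK (Function.update (fun i => Algebra.TensorProduct.includeRight.comp (C.single i)) p
      ((Algebra.TensorProduct.map (AlgHom.id k _) (C.single p)).comp (C.bi p).leftCoact)) <| by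
    intro i j hij x y
    by_cases hi : i = p
    · subst hi
      rw [Function.update_self, Function.update_of_ne (Ne.symm hij)]
      exact C.commute_left hij _ y
    · rw [Function.update_of_ne hi]
      by_cases hj : j = p
      · subst hj
        rw [Function.update_self]
        exact (C.commute_left (Ne.symm hij) _ x).symm
      · rw [Function.update_of_ne hj]
        exact (C.single_commute hij x y).map Algebra.TensorProduct.includeRight

/-- The right coaction of `H_{nxt d}^ε` on `⨂ᵢ K_i^ε` that comes from the right coaction on the
factor `K_d^ε`. -/
def rco (d : C.pt) : C.KAlg →ₐ[k] C.KAlg ⊗[k] signedHopf (C.sgn d) (C.H (C.nxt d)) :=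
  C.liftK (Function.update (fun i => (Algebra.TensorProduct.includeLeft (R := k) (S := k)
      (A := C.KAlg) (B := signedHopf (C.sgn d) (C.H (C.nxt d)))).comp (C.single i)) d
      ((Algebra.TensorProduct.map (C.single d) (AlgHom.id k _)).comp (C.bi d).rightCoact)) <| by
    intro i j hij x y
    by_cases hi : i = d
    · subst hi
      rw [Function.update_self, Function.update_of_ne (Ne.symm hij)]
      exact C.commute_right hij _ y
    · rw [Function.update_of_ne hi]
      by_cases hj : j = d
      · subst hj
        rw [Function.update_self]
        exact (C.commute_right (Ne.symm hij) _ x).symm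
      · rw [Function.update_of_ne hj]
        exact (C.single_commute hij x y).map (Algebra.TensorProduct.includeLeft (R := k) (S := k)
          (A := C.KAlg) (B := signedHopf (C.sgn d) (C.H (C.nxt d))))

/-- The object `X^ε ▷ M`, where `ε` is the sign of `p`: the tensor product `X ⊗ M` with the action
`x.(v ⊗ m) = x₍₋₁₎^⟨ε⟩.v ⊗ x₍₀₎.m`. For `ε = -1`, the object `X^ε` of the opposite category
`H^{op,cop}-mod` is the dual of `X`, that is `X` with the action pulled back along the antipode. -/
abbrev lact (p : C.pt) (X : FDMod k (C.H p)) (M : FDMod k C.KAlg) : FDMod k C.KAlg :=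
  ((X.restrict (signPow (C.H p) (C.sgn p))).tensor M).restrict (C.lco p)

/-- The object `M ◁ X^ε`, where `ε` is the sign of `d`: the tensor product `M ⊗ X` with the action
`x.(m ⊗ v) = x₍₀₎.m ⊗ x₍₁₎^⟨ε⟩.v`. -/
abbrev ract (d : C.pt) (M : FDMod k C.KAlg) (X : FDMod k (C.H (C.nxt d))) : FDMod k C.KAlg :=
  (M.tensor (X.restrict (signPow (C.H (C.nxt d)) (C.sgn d)))).restrict (C.rco d)

/-- An object of the category assigned to a labelled circle: an object of the Deligne product
`(⨂ᵢ K_i^ε)-mod` with a balancing for each site. A balancing is a natural family of isomorphisms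
`X^ε ▷ M ≅ M ◁ X^ε'` (field `iso`, for the site `p = nxt d` between `d` and `nxt d`) with
`β_{X ⊗ Y} = (β_X ◁ Y) ∘ (X ▷ β_Y)` and `β_𝟙 = id`, up to the constraint isomorphisms. This is the
iteration of the construction of the category of balancings over all sites: the condition `compat`
for two distinct sites says that the balancing for the one is a morphism of objects with a balancing
for the other. As the bimodule structures for distinct sites commute, the balancing of `X ▷ M` and
`M ◁ X` for the other site is that of `M`, and the condition is symmetric in the two sites. -/
structure GluingCategory where
  obj : FDMod k C.KAlg
  iso : ∀ d, C.isSite (C.nxt d) → ∀ X : FDMod k (C.H (C.nxt d)),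
    C.lact (C.nxt d) X obj ≅ C.ract d obj X
  natural : ∀ d hd {X Y : FDMod k (C.H (C.nxt d))} (f : X ⟶ Y),
    FDMod.lin (iso d hd Y).hom ∘ₗ (FDMod.lin f).rTensor obj.V =
      (FDMod.lin f).lTensor obj.V ∘ₗ FDMod.lin (iso d hd X).hom
  hexagon : ∀ d hd (X Y : FDMod k (C.H (C.nxt d))),
    FDMod.lin (iso d hd (X.tensorH Y)).hom =
      (TensorProduct.assoc k obj.V X.V Y.V).toLinearMap ∘ₗ
        (FDMod.lin (iso d hd X).hom).rTensor Y.V ∘ₗ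
        (TensorProduct.assoc k X.V obj.V Y.V).symm.toLinearMap ∘ₗ
        (FDMod.lin (iso d hd Y).hom).lTensor X.V ∘ₗ
        (TensorProduct.assoc k X.V Y.V obj.V).toLinearMap
  unit : ∀ d hd, FDMod.lin (iso d hd (FDMod.unitH k (C.H (C.nxt d)))).hom =
    (TensorProduct.rid k obj.V).symm.toLinearMap ∘ₗ (TensorProduct.lid k obj.V).toLinearMap
  compat : ∀ d d' hd hd', d ≠ d' → ∀ (X : FDMod k (C.H (C.nxt d))) (Y : FDMod k (C.H (C.nxt d'))),
    (FDMod.lin (iso d' hd' Y).hom).rTensor X.V ∘ₗ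
        (TensorProduct.assoc k Y.V obj.V X.V).symm.toLinearMap ∘ₗ
        (FDMod.lin (iso d hd X).hom).lTensor Y.V ∘ₗ
        (TensorProduct.leftComm k X.V Y.V obj.V).toLinearMap =
      (TensorProduct.rightComm k obj.V X.V Y.V).toLinearMap ∘ₗ
        (FDMod.lin (iso d hd X).hom).rTensor Y.V ∘ₗ
        (TensorProduct.assoc k X.V obj.V Y.V).symm.toLinearMap ∘ₗ
        (FDMod.lin (iso d' hd' Y).hom).lTensor X.V

namespace GluingCategory
variable {C}

/-- The linear map `X ⊗ M → M ⊗ X` that underlies the balancing for the site `nxt d`. -/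
def balancing (M : C.GluingCategory) (d : C.pt) (hd : C.isSite (C.nxt d))
    (X : FDMod k (C.H (C.nxt d))) : X.V ⊗[k] M.obj.V →ₗ[k] M.obj.V ⊗[k] X.V :=
  FDMod.lin (M.iso d hd X).hom

/-- The vector space of morphisms: the module maps that are compatible with all balancings. -/
def homs (M N : C.GluingCategory) : Submodule k (M.obj ⟶ N.obj) where
  carrier := {f | ∀ d hd X, N.balancing d hd X ∘ₗ (FDMod.lin f).lTensor X.V =
    (FDMod.lin f).rTensor X.V ∘ₗ M.balancing d hd X}
  add_mem' {f g} hf hg d hd X := by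
    have hf := hf d hd X
    have hg := hg d hd X
    have e : FDMod.lin (f + g) = FDMod.lin f + FDMod.lin g := rfl
    rw [e, LinearMap.lTensor_add, LinearMap.rTensor_add, LinearMap.comp_add, LinearMap.add_comp,
      hf, hg]
  zero_mem' d hd X := by
    have e : FDMod.lin (0 : M.obj ⟶ N.obj) = 0 := rfl
    rw [e, LinearMap.lTensor_zero, LinearMap.rTensor_zero, LinearMap.comp_zero,
      LinearMap.zero_comp]
  smul_mem' c f hf d hd X := by
    have hf := hf d hd X
    have e : FDMod.lin (c • f) = c • FDMod.lin f := rfl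
    rw [e, LinearMap.lTensor_smul, LinearMap.rTensor_smul, LinearMap.comp_smul,
      LinearMap.smul_comp, hf]

instance : Category C.GluingCategory where
  Hom M N := homs M N
  id M := ⟨𝟙 M.obj, fun d hd X => by
    have e : FDMod.lin (𝟙 M.obj) = LinearMap.id := rfl
    rw [e, LinearMap.lTensor_id, LinearMap.rTensor_id, LinearMap.comp_id, LinearMap.id_comp]⟩
  comp {M N P} f g := ⟨f.1 ≫ g.1, fun d hd X => by
    have hf := f.2 d hd X
    have hg := g.2 d hd X
    have e : FDMod.lin (f.1 ≫ g.1) = FDMod.lin g.1 ∘ₗ FDMod.lin f.1 := rfl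
    rw [e, LinearMap.lTensor_comp, LinearMap.rTensor_comp, ← LinearMap.comp_assoc, hg,
      LinearMap.comp_assoc, hf, LinearMap.comp_assoc]⟩
  id_comp f := Subtype.ext (Category.id_comp f.1)
  comp_id f := Subtype.ext (Category.comp_id f.1)
  assoc f g h := Subtype.ext (Category.assoc f.1 g.1 h.1)

instance : Preadditive C.GluingCategory where
  homGroup := fun M N => inferInstanceAs (AddCommGroup (homs M N))
  add_comp _ _ _ f g h := Subtype.ext (Preadditive.add_comp _ _ _ f.1 g.1 h.1)
  comp_add _ _ _ f g h := Subtype.ext (Preadditive.comp_add _ _ _ f.1 g.1 h.1)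

instance : Linear k C.GluingCategory where
  homModule := fun M N => inferInstanceAs (Module k (homs M N))
  smul_comp _ _ _ r f g := Subtype.ext (Linear.smul_comp _ _ _ r f.1 g.1)
  comp_smul _ _ _ f r g := Subtype.ext (Linear.comp_smul _ _ _ f.1 r g.1)

variable (C) in
/-- The functor that forgets the balancings. -/
def forget : C.GluingCategory ⥤ FDMod k C.KAlg where
  obj M := M.obj
  map f := f.1

end GluingCategory

/-- The inclusion of `H_p^*` into the vertex algebra. -/
def incDual (p : C.Site) : HopfDual (C.H p) →ₐ[k] C.VertexAlgebra :=
  (CrossedProduct.inclLeft C.isCrossed_act).comp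
    (PiTensorProduct.singleAlgHom (R := k) (A := fun p : C.Site => HopfDual (C.H p)) p)

/-- The inclusion of `⨂ᵢ K_i^ε` into the vertex algebra. -/
def incK : C.KAlg →ₐ[k] C.VertexAlgebra := CrossedProduct.inclRight C.isCrossed_act

end DecoratedCircle

/-- A cell decomposition of a closed oriented surface, given by its 1-skeleton with a clockwise order
of the half-edges at each vertex. The half-edge `(e, true)` of an oriented edge `e` is the one at the
source of `e`, so that `e` points away from the vertex there, and `(e, false)` is the one at its
target. `rot d` is the half-edge that follows `d` in clockwise order around the vertex of `d`. -/
structure RibbonGraph where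
  Edge : Type
  [fintype : Fintype Edge]
  [decEq : DecidableEq Edge]
  rot : Equiv.Perm (Edge × Bool)

namespace RibbonGraph
attribute [instance] RibbonGraph.fintype RibbonGraph.decEq
variable (Γ : RibbonGraph)

/-- The half-edges. -/
abbrev HalfEdge : Type := Γ.Edge × Bool

/-- The other half of the same edge. -/
def flip : Equiv.Perm Γ.HalfEdge := Equiv.prodCongr (Equiv.refl Γ.Edge) Equiv.boolNot

/-- The vertices: the cycles of half-edges under `rot`. -/
def Vertex : Type := Quotient (Equiv.Perm.SameCycle.setoid Γ.rot)

/-- The vertex to which a half-edge is attached. -/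
def vertex (d : Γ.HalfEdge) : Γ.Vertex := Quotient.mk _ d

/-- The faces (2-cells): the cycles of half-edges under `d ↦ rot (flip d)`. If one travels along `d`,
starting at its vertex, and then turns left into the next half-edge, that is `rot (flip d)`, the face
on the left remains the same. -/
def Face : Type := Quotient (Equiv.Perm.SameCycle.setoid (Γ.rot * Γ.flip))

/-- The face to the left of a half-edge, seen from its vertex. The corner of this face between
`rot⁻¹ d` and `d` is indexed by `d`. -/
def leftFace (d : Γ.HalfEdge) : Γ.Face := Quotient.mk _ d

lemma vertex_rot (d : Γ.HalfEdge) : Γ.vertex (Γ.rot d) = Γ.vertex d :=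
  Quotient.sound (Equiv.Perm.sameCycle_apply_left.2 (Equiv.Perm.SameCycle.refl _ d))

lemma leftFace_rot (d : Γ.HalfEdge) : Γ.leftFace (Γ.rot d) = Γ.leftFace (Γ.flip d) := by
  have h : (Γ.rot * Γ.flip) (Γ.flip d) = Γ.rot d := by
    rcases d with ⟨e, _ | _⟩ <;> rfl
  rw [← h]
  exact Quotient.sound (Equiv.Perm.sameCycle_apply_left.2 (Equiv.Perm.SameCycle.refl _ _))

end RibbonGraph

/-- A cell decomposition of a compact oriented surface, possibly with boundary, where the boundary is
part of the 1-skeleton. Each boundary circle is filled with a further face, a hole, so that the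
plaquettes are the faces that are not holes. As the boundary is a 1-manifold, no edge has holes on
both sides and no vertex meets holes in more than one corner. -/
structure CellDecomposition extends RibbonGraph where
  IsHole : toRibbonGraph.Face → Prop
  hole_edge : ∀ d : toRibbonGraph.HalfEdge,
    ¬ (IsHole (toRibbonGraph.leftFace d) ∧ IsHole (toRibbonGraph.leftFace (toRibbonGraph.flip d)))
  hole_vertex : ∀ d d' : toRibbonGraph.HalfEdge, toRibbonGraph.vertex d = toRibbonGraph.vertex d' →
    IsHole (toRibbonGraph.leftFace d) → IsHole (toRibbonGraph.leftFace d') → d = d'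

/-- A labelling of a cell decomposition: plaquettes are labelled by finite-dimensional semisimple Hopf
algebras, and an edge `e` by a finite-dimensional semisimple bicomodule algebra over the Hopf algebras
to the left and to the right of `e`. At a boundary edge there is a plaquette on one side only and the
label is a one-sided comodule algebra; this is the same as a bicomodule algebra where the other Hopf
algebra is the field `k`, so that holes carry the label `k`. -/
structure Labelling (k : Type u) [Field k] (S : CellDecomposition) where
  H : S.Face → HopfAlgCat.{u} k
  [finiteH : ∀ p, Module.Finite k (H p)]
  [semisimpleH : ∀ p, IsSemisimpleRing (H p)]
  hole : ∀ p, S.IsHole p → Function.Bijective (algebraMap k (H p))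
  K : S.Edge → AlgCat.{u} k
  [finiteK : ∀ e, Module.Finite k (K e)]
  [semisimpleK : ∀ e, IsSemisimpleRing (K e)]
  coact : ∀ e, BicomoduleAlgebra (H (S.leftFace (e, true))) (K e) (H (S.leftFace (e, false)))

namespace Labelling
attribute [instance] Labelling.finiteH
variable {k : Type u} [Field k] {S : CellDecomposition} (L : Labelling k S)

/-- The label of the edge of a half-edge `d`, seen from the vertex of `d`. -/
def signedCoact : ∀ d : S.HalfEdge,
    SignedBicomoduleAlgebra (L.H (S.leftFace d)) (L.K d.1) (L.H (S.leftFace (S.flip d))) d.2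
  | (e, true) => L.coact e
  | (e, false) => L.coact e

open Classical in
/-- The circle around a vertex `v`: its marked points are the half-edges at `v` in clockwise order,
with the sign `+1` if the edge points away from `v` and `-1` if it points towards `v`. Its segments
are the corners of faces at `v`, and its sites are the corners of plaquettes. -/
def circle (v : S.Vertex) : DecoratedCircle k where
  pt := {d : S.HalfEdge // S.vertex d = v}
  nonempty := let ⟨d, hd⟩ := Quotient.exists_rep v; ⟨⟨d, hd⟩⟩
  nxt := S.rot.subtypePerm fun d => by rw [S.vertex_rot]
  cyclic i j := Equiv.Perm.sameCycle_subtypePerm.2 (Quotient.exact (i.2.trans j.2.symm))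
  sgn i := i.1.2
  isSite i := ¬ S.IsHole (S.leftFace i.1)
  H i := L.H (S.leftFace i.1)
  K i := L.K i.1.1
  bico i := (S.leftFace_rot i.1).symm ▸ L.signedCoact i.1

end Labelling

end

/-!
The equivalence rests on the fact that a balancing is determined by its value at the regular module.
Fix a site and let `H` be the Hopf algebra of its plaquette. By naturality,
`β_X(v ⊗ m) = m₍₀₎ ⊗ m₍₁₎ v` with `m₍₀₎ ⊗ m₍₁₎ = β_H(1 ⊗ m)` (`balancing_tmul`), so `β` is the action of an
element `D` of `End(M) ⊗ H` (`elt`, `actOn`). Applying functionals on `H` to the second factor (`slice`)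
identifies such elements with linear maps `H^* → End(M)`, and the axioms translate as follows.

* Naturality holds for every `D`. The hexagon and the unit axiom say that `H^* → End(M)` is an algebra
  map (`coactionAct`, `lTensor_comul_eq_legMul`). Then `D` is invertible, with inverse `(1 ⊗ S) D`
  (`mul_lTensor_antipode`).
* The balancings at two sites commute if and only if the actions of the two duals commute
  (`dualAct_commute`, `legMul_comm`), so that all sites together give an action of `⨂_p H_p^*`.
* For edges of sign `+1`, the balancing is `K_v`-linear if and only if `D (x₍₀₎ ⊗ x₍₋₁₎) = (x₍₀₎ ⊗ x₍₁₎) D`. The relation of the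
  crossed product says that `x f = (x₍₋₁₎ . f . S(x₍₁₎)) x₍₀₎`, which is the same identity with the factor
  `x₍₁₎` moved to the other side (`mul_leftHat_iff`, `intertwine_iff_straight`); for the sign `-1` the
  elements `x₍₋₁₎` and `x₍₁₎` are replaced by their antipodes, and `S(x₍₁₎)` by `x₍₁₎`. It is enough to know this
  relation for `f` in one factor `H_p^*` and `x` in one factor `K_e^ε`, as the elements that satisfy it
  form subalgebras (`straight_of_singleDual`, `CrossedProduct.lift`).

Moving `x₍₁₎` to the other side is done with the antipode axiom if the sign of the edge is `-1`. For the
sign `+1` it needs `S(g₍₂₎) g₍₁₎ = ε(g)`, which amounts to `S² = 1`. Here semisimplicity and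
characteristic zero enter, through the theorem of Larson and Radford
(`antipode_antipode_of_isSemisimpleRing`). The functional `λ(x) = Tr(L_x ∘ S²)` is an integral of `H^*`
with `λ(Λ) = 1` for the normalized integral `Λ` of `H`, and `Δ(Λ)` provides dual bases for the form
`λ(x y)`. This gives Radford's formula `w a = a S⁴(w)` with a group-like element `a` of finite order (`mul_distinguished`). Since `λ` is a
nondegenerate functional on a product of matrix algebras, `S²` is inner, and on each block it can be
implemented by a matrix of finite order. Hence `Tr(S²)` is a sum of squared absolute values of algebraic
numbers and is not zero (`traceIntegral_one_ne_zero`), which gives `a = 1` and `S⁴ = 1`. Finally,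
`Tr(S²)` is a nonzero integer multiple of `dim H`, which forces `S² = 1`.

The functor `toVertexMod` that results keeps the underlying vector spaces and maps. It is full and
faithful, as compatibility with the balancings can be tested on the actions of the `H_p^*`, and it is
essentially surjective, as the translation can be read backwards (`ofModule`).
-/

noncomputable section

/-! ### Sweedler calculus -/

section Sweedler
variable {k H : Type u} [Field k] [Ring H] [HopfAlgebra k H]
open HopfAlgebra Coalgebra

/-- If `P(y₍₁₎ ⊗ y₍₂₎) = ε(y) v`, then `P(y₍₁₎ ⊗ y₍₂₎) ⊗ Q(y₍₃₎) = v ⊗ Q(y)`. -/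
lemma map_rTensor_comul {V W : Type u} [AddCommGroup V] [Module k V] [AddCommGroup W] [Module k W]
    {P : H ⊗[k] H →ₗ[k] V} {v : V} (hP : ∀ y, P (comul y) = counit (R := k) y • v) (Q : H →ₗ[k] W)
    (y : H) : TensorProduct.map P Q (comul.rTensor H (comul y)) = v ⊗ₜ Q y := by
  have h : ∀ t : H ⊗[k] H, TensorProduct.map P Q (comul.rTensor H t) =
      v ⊗ₜ Q (TensorProduct.lid k H (counit.rTensor H t)) := by
    intro t
    induction t with
    | zero => simp
    | add x y hx hy => simp only [map_add, TensorProduct.tmul_add, hx, hy]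
    | tmul x y => simp [hP, TensorProduct.smul_tmul]
  rw [h, rTensor_counit_comul]
  simp

/-- If `P(y₍₁₎ ⊗ y₍₂₎) = ε(y) v`, then `Q(y₍₁₎) ⊗ P(y₍₂₎ ⊗ y₍₃₎) = Q(y) ⊗ v`. -/
lemma map_lTensor_comul {V W : Type u} [AddCommGroup V] [Module k V] [AddCommGroup W] [Module k W]
    {P : H ⊗[k] H →ₗ[k] V} {v : V} (hP : ∀ y, P (comul y) = counit (R := k) y • v) (Q : H →ₗ[k] W)
    (y : H) : TensorProduct.map Q P (comul.lTensor H (comul y)) = Q y ⊗ₜ v := by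
  have h : ∀ t : H ⊗[k] H, TensorProduct.map Q P (comul.lTensor H t) =
      Q (TensorProduct.rid k H (counit.lTensor H t)) ⊗ₜ v := by
    intro t
    induction t with
    | zero => simp
    | add x y hx hy => simp only [map_add, TensorProduct.add_tmul, hx, hy]
    | tmul x y => simp [hP, TensorProduct.smul_tmul]
  rw [h, lTensor_counit_comul]
  simp

variable (k H) in
/-- The square of the antipode, an algebra endomorphism. -/
def antipodeSq : H →ₐ[k] H :=
  AlgHom.ofLinearMap (antipode k ∘ₗ antipode k) (by simp) fun x y => by
    simp [antipode_mul_antidistrib]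

lemma antipodeSq_apply (x : H) : antipodeSq k H x = antipode k (antipode k x) := rfl

lemma comul_antipode_apply (x : H) : comul (R := k) (antipode k x) =
    TensorProduct.map (antipode k) (antipode k) (TensorProduct.comm k H H (comul x)) :=
  LinearMap.congr_fun (comul_antipode_eq (k := k) (H := H)) x

lemma comul_antipodeSq (x : H) : comul (R := k) (antipodeSq k H x) =
    TensorProduct.map (antipodeSq k H).toLinearMap (antipodeSq k H).toLinearMap (comul x) := by
  rw [antipodeSq_apply, comul_antipode_apply, comul_antipode_apply]
  generalize (comul (R := k) x) = t
  induction t with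
  | zero => simp
  | add x y hx hy => simp only [map_add, hx, hy]
  | tmul x y => simp [antipodeSq_apply]

lemma counit_antipodeSq (x : H) : counit (R := k) (antipodeSq k H x) = counit (R := k) x := by
  simp [antipodeSq_apply]

end Sweedler

/-! ### Integrals of a semisimple Hopf algebra and of its dual -/

section Integral
variable {k H : Type u} [Field k] [Ring H] [HopfAlgebra k H]
open HopfAlgebra Coalgebra

variable (k) in
/-- A two-sided integral of a Hopf algebra, normalized by `ε(Λ) = 1`. -/
structure IsNormalizedIntegral (Λ : H) : Prop where
  left : ∀ x : H, x * Λ = counit (R := k) x • Λ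
  right : ∀ x : H, Λ * x = counit (R := k) x • Λ
  counit : counit (R := k) Λ = 1

/-- A character of a semisimple algebra has a complement to its kernel, and the generator of this left
ideal is a left integral with respect to the character. -/
lemma exists_complement_counit (A : Type u) [Ring A] [Algebra k A] [IsSemisimpleRing A]
    (e : A →ₐ[k] k) : ∃ Λ : A, (∀ x, x * Λ = e x • Λ) ∧ e Λ = 1 := by
  let I : Submodule A A := RingHom.ker e
  obtain ⟨J, hJ⟩ := exists_isCompl I
  have h1 : (1 : A) ∈ I ⊔ J := by rw [hJ.sup_eq_top]; trivial
  obtain ⟨u, hu, Λ, hΛ, h⟩ := Submodule.mem_sup.1 h1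
  have hu : e u = 0 := hu
  have hΛ1 : e Λ = 1 := by simpa [hu] using congrArg e h
  refine ⟨Λ, fun x => ?_, hΛ1⟩
  have h2 : (x - algebraMap k A (e x)) * Λ ∈ I ⊓ J := by
    refine ⟨?_, J.smul_mem _ hΛ⟩
    change e _ = 0
    simp
  rw [hJ.inf_eq_bot, Submodule.mem_bot, sub_mul, sub_eq_zero] at h2
  rw [h2, Algebra.smul_def]

variable (k H) in
lemma exists_isNormalizedIntegral [IsSemisimpleRing H] :
    ∃ Λ : H, IsNormalizedIntegral k Λ := by
  obtain ⟨Λ, hΛ, hΛ1⟩ := exists_complement_counit H (Bialgebra.counitAlgHom k H)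
  obtain ⟨R, hR, hR1⟩ := exists_complement_counit Hᵐᵒᵖ
    ((Bialgebra.counitAlgHom k H).fromOpposite fun x y => mul_comm _ _)
  have hR' : ∀ x : H, R.unop * x = counit (R := k) x • R.unop := fun x =>
    congrArg MulOpposite.unop (hR (MulOpposite.op x))
  have hR1' : counit (R := k) R.unop = 1 := hR1
  have hΛ' : ∀ x : H, x * Λ = counit (R := k) x • Λ := hΛ
  have hΛ1' : counit (R := k) Λ = 1 := hΛ1
  have e : R.unop = Λ := by
    have := (hR' Λ).symm.trans (hΛ' R.unop)
    rwa [hΛ1', hR1', one_smul, one_smul] at this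
  exact ⟨Λ, hΛ', e ▸ hR', hΛ1'⟩

/-- A left integral of the dual Hopf algebra: a functional `μ` with `x₍₁₎ μ(x₍₂₎) = μ(x) 1`, that is
`g μ = g(1) μ` for all functionals `g`. -/
def IsDualIntegral (μ : H →ₗ[k] k) : Prop :=
  ∀ g : H →ₗ[k] k, WithConv.toConv g * WithConv.toConv μ = g 1 • WithConv.toConv μ

lemma IsDualIntegral.apply {μ : H →ₗ[k] k} (hμ : IsDualIntegral μ) (x : H) :
    TensorProduct.rid k H (μ.lTensor H (comul x)) = μ x • (1 : H) := by
  refine sub_eq_zero.1 ((Module.forall_dual_apply_eq_zero_iff k _).1 fun g => ?_)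
  have h := congrArg (fun f : WithConv (H →ₗ[k] k) => f x) (hμ g)
  have e : ∀ t : H ⊗[k] H, g (TensorProduct.rid k H (μ.lTensor H t)) =
      LinearMap.mul' k k (TensorProduct.map g μ t) := by
    intro t
    induction t with
    | zero => simp
    | add x y hx hy => simp only [map_add, hx, hy]
    | tmul x y => simp [mul_comm]
  rw [map_sub, e, sub_eq_zero, map_smul, smul_eq_mul, mul_comm]
  exact h

/-- For fixed `y` the map `x ↦ y₍₁₎ μ(x y₍₂₎)`. -/
def dualIntegralShift (μ : H →ₗ[k] k) (y : H) : H →ₗ[k] H where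
  toFun x := TensorProduct.rid k H ((μ ∘ₗ LinearMap.mulLeft k x).lTensor H (comul y))
  map_add' x x' := by
    rw [← map_add, ← LinearMap.add_apply, ← LinearMap.lTensor_add, ← LinearMap.comp_add]
    congr 4
    ext z
    simp [add_mul]
  map_smul' c x := by
    rw [RingHom.id_apply, ← map_smul, ← LinearMap.smul_apply, ← LinearMap.lTensor_smul,
      ← LinearMap.comp_smul]
    congr 4
    ext z
    simp

/-- `S(x₍₁₎) μ(x₍₂₎ y) = y₍₁₎ μ(x y₍₂₎)` for a left integral `μ` of the dual. -/
lemma IsDualIntegral.antipode_mul {μ : H →ₗ[k] k} (hμ : IsDualIntegral μ) (x y : H) :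
    TensorProduct.rid k H (TensorProduct.map (antipode k) (μ ∘ₗ LinearMap.mulRight k y) (comul x)) =
      TensorProduct.rid k H ((μ ∘ₗ LinearMap.mulLeft k x).lTensor H (comul y)) := by
  let G := WithConv.toConv (dualIntegralShift μ y)
  let F : WithConv (H →ₗ[k] H) :=
    WithConv.toConv ((μ ∘ₗ LinearMap.mulRight k y).smulRight (1 : H))
  -- `x₍₁₎ y₍₁₎ μ(x₍₂₎ y₍₂₎) = μ(x y)`, to be multiplied by the antipode on the left
  have h1 : WithConv.toConv LinearMap.id * G = F := by
    refine WithConv.ofConv_injective (LinearMap.ext fun z => ?_)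
    have e : ∀ t : H ⊗[k] H, LinearMap.mul' k H (TensorProduct.map LinearMap.id
        (dualIntegralShift μ y) t) =
          TensorProduct.rid k H (μ.lTensor H (t * comul (R := k) y)) := by
      intro t
      induction t with
      | zero => simp
      | add x y hx hy => simp only [map_add, add_mul, hx, hy]
      | tmul u v =>
        rw [TensorProduct.map_tmul, LinearMap.mul'_apply]
        change u * TensorProduct.rid k H ((μ ∘ₗ LinearMap.mulLeft k v).lTensor H (comul y)) = _
        generalize (comul (R := k) y) = s
        induction s with
        | zero => simp
        | add x y hx hy => simp only [map_add, mul_add, hx, hy]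
        | tmul a b => simp
    refine (e (comul z)).trans ?_
    rw [← Bialgebra.comul_mul, hμ.apply]
    rfl
  have h2 : G = WithConv.toConv (antipode k) * F := by
    rw [← h1, ← mul_assoc, LinearMap.antipode_mul_id, one_mul]
  have h3 := congrArg (fun f : WithConv (H →ₗ[k] H) => f x) h2
  refine Eq.trans ?_ h3.symm
  change _ = LinearMap.mul' k H (TensorProduct.map (antipode k)
    ((μ ∘ₗ LinearMap.mulRight k y).smulRight (1 : H)) (comul x))
  generalize (comul (R := k) x) = s
  induction s with
  | zero => simp
  | add x y hx hy => simp only [map_add, hx, hy]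
  | tmul a b => simp

variable (k H) in
/-- The functional `x ↦ Tr(L_x ∘ S²)`, where `L_x` is the left multiplication by `x`. -/
def traceIntegral : H →ₗ[k] k :=
  LinearMap.trace k H ∘ₗ LinearMap.mulRight k (antipodeSq k H).toLinearMap ∘ₗ
    (Algebra.lmul k H).toLinearMap

lemma traceIntegral_apply (x : H) : traceIntegral k H x =
    LinearMap.trace k H (LinearMap.mulLeft k x ∘ₗ (antipodeSq k H).toLinearMap) := rfl

lemma traceIntegral_mul_comm (x z : H) :
    traceIntegral k H (x * z) = traceIntegral k H (z * antipodeSq k H x) := by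
  have h1 : LinearMap.mulLeft k (x * z) ∘ₗ (antipodeSq k H).toLinearMap =
      LinearMap.mulLeft k x * (LinearMap.mulLeft k z ∘ₗ (antipodeSq k H).toLinearMap) := by
    ext y; simp
  have h2 : LinearMap.mulLeft k (z * antipodeSq k H x) ∘ₗ (antipodeSq k H).toLinearMap =
      (LinearMap.mulLeft k z ∘ₗ (antipodeSq k H).toLinearMap) * LinearMap.mulLeft k x := by
    ext y; simp
  rw [traceIntegral_apply, traceIntegral_apply, h1, h2, LinearMap.trace_mul_comm]

/-- `S²(y₍₂₎) S(y₍₁₎) = ε(y) 1`. -/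
lemma antipodeSq_mul_antipode (y : H) :
    LinearMap.mul' k H (TensorProduct.comm k H H (TensorProduct.map (antipode k)
      (antipodeSq k H).toLinearMap (comul y))) = counit (R := k) y • (1 : H) := by
  have e : ∀ t : H ⊗[k] H, LinearMap.mul' k H (TensorProduct.comm k H H (TensorProduct.map
      (antipode k) (antipodeSq k H).toLinearMap t)) =
        antipode k (LinearMap.mul' k H ((antipode k).lTensor H t)) := by
    intro t
    induction t with
    | zero => simp
    | add x y hx hy => simp only [map_add, hx, hy]
    | tmul u v => simp [antipode_mul_antidistrib, antipodeSq_apply]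
  rw [e, mul_antipode_lTensor_comul_apply, Algebra.algebraMap_eq_smul_one, map_smul, antipode_one]

variable [Module.Finite k H]

lemma traceIntegral_integral {Λ : H} (hΛ : IsNormalizedIntegral k Λ) : traceIntegral k H Λ = 1 := by
  have h : LinearMap.mulLeft k Λ ∘ₗ (antipodeSq k H).toLinearMap =
      (counit (R := k) (A := H)).smulRight Λ := by
    ext y
    simp [hΛ.right, counit_antipodeSq]
  rw [traceIntegral_apply, h]
  exact (LinearMap.trace_smulRight _ _).trans hΛ.counit

/-- The trace `Tr(L_x ∘ S²)` is a left integral of the dual. The operator `y ↦ f(x₍₁₎) x₍₂₎ S²(y)`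
is a sum of composites `W_i U_i` with `W_i(b) = f(b₍₁₎ e_i) b₍₂₎` and
`U_i(y) = e^i(S(y₍₁₎)) x S²(y₍₂₎)` for dual bases `e_i`, `e^i`, and the sum of the `U_i W_i`
is `f(1) L_x S²`. -/
lemma traceIntegral_isDualIntegral : IsDualIntegral (traceIntegral k H) := by
  intro f
  refine WithConv.ofConv_injective (LinearMap.ext fun x => ?_)
  let b := Module.finBasis k H
  let W (i) : H →ₗ[k] H := (TensorProduct.lid k H).toLinearMap ∘ₗ
    (f ∘ₗ LinearMap.mulRight k (b i)).rTensor H ∘ₗ comul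
  let U (i) : H →ₗ[k] H := LinearMap.mulLeft k x ∘ₗ (TensorProduct.lid k H).toLinearMap ∘ₗ
    TensorProduct.map (b.coord i ∘ₗ antipode k) (antipodeSq k H).toLinearMap ∘ₗ comul
  have hb : ∀ u v : H, ∑ i, b.repr v i * f (u * b i) = f (u * v) := by
    intro u v
    conv_rhs => rw [← b.sum_repr v, Finset.mul_sum, map_sum]
    refine Finset.sum_congr rfl fun i _ => ?_
    simp
  have h1 : ∑ i, W i ∘ₗ U i = (TensorProduct.lid k (H →ₗ[k] H)) (TensorProduct.map f
      (LinearMap.mulRight k (antipodeSq k H).toLinearMap ∘ₗ (Algebra.lmul k H).toLinearMap)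
        (comul (R := k) x)) := by
    refine LinearMap.ext fun y => ?_
    have e : ∀ t : H ⊗[k] H, ∑ i, W i (x * TensorProduct.lid k H (TensorProduct.map
        (b.coord i ∘ₗ antipode k) (antipodeSq k H).toLinearMap t)) =
        TensorProduct.lid k H (f.rTensor H (comul x * TensorProduct.map (LinearMap.mul' k H ∘ₗ
          (TensorProduct.comm k H H).toLinearMap ∘ₗ TensorProduct.map (antipode k)
            (antipodeSq k H).toLinearMap) (antipodeSq k H).toLinearMap
            ((TensorProduct.assoc k H H H).symm (comul.lTensor H t)))) := by
      intro t
      induction t with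
      | zero => simp
      | add x y hx hy => simp only [map_add, mul_add, Finset.sum_add_distrib, hx, hy]
      | tmul p q =>
        simp only [TensorProduct.map_tmul, LinearMap.lTensor_tmul, TensorProduct.lid_tmul,
          LinearMap.comp_apply, AlgHom.toLinearMap_apply, mul_smul_comm, map_smul, W,
          LinearEquiv.coe_coe, Bialgebra.comul_mul, comul_antipodeSq]
        generalize (comul (R := k) q) = s
        generalize (comul (R := k) x) = r
        induction s with
        | zero => simp
        | add x y hx hy => simp only [map_add, mul_add, TensorProduct.tmul_add, smul_add,
            Finset.sum_add_distrib, hx, hy]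
        | tmul q q' =>
          induction r with
          | zero => simp
          | add x y hx hy => simp only [map_add, add_mul, smul_add, Finset.sum_add_distrib, hx, hy]
          | tmul r r' =>
            simp [smul_smul, ← Finset.sum_smul, ← mul_assoc, hb]
    have e' : ∀ t : H ⊗[k] H, TensorProduct.lid k H (f.rTensor H (t * (1 ⊗ₜ antipodeSq k H y))) =
        (TensorProduct.lid k (H →ₗ[k] H)) (TensorProduct.map f
      (LinearMap.mulRight k (antipodeSq k H).toLinearMap ∘ₗ (Algebra.lmul k H).toLinearMap) t) y := by
      intro t
      induction t with
      | zero => simp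
      | add x y hx hy => simp only [map_add, add_mul, LinearMap.add_apply, hx, hy]
      | tmul p q => simp
    rw [LinearMap.sum_apply]
    refine (e (comul y)).trans ?_
    rw [coassoc_symm_apply, map_rTensor_comul (v := (1 : H)) antipodeSq_mul_antipode]
    exact e' _
  have h2 : ∑ i, U i ∘ₗ W i = f 1 • (LinearMap.mulLeft k x ∘ₗ (antipodeSq k H).toLinearMap) := by
    refine LinearMap.ext fun y => ?_
    have e : ∀ t : H ⊗[k] H, ∑ i, U i (TensorProduct.lid k H
        ((f ∘ₗ LinearMap.mulRight k (b i)).rTensor H t)) = x * TensorProduct.lid k H (f.rTensor H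
          (TensorProduct.map (LinearMap.mul' k H ∘ₗ (antipode k).lTensor H)
            (antipodeSq k H).toLinearMap
              ((TensorProduct.assoc k H H H).symm (comul.lTensor H t)))) := by
      intro t
      induction t with
      | zero => simp
      | add x y hx hy => simp only [map_add, mul_add, Finset.sum_add_distrib, hx, hy]
      | tmul p q =>
        simp only [LinearMap.lTensor_tmul, LinearMap.rTensor_tmul, TensorProduct.lid_tmul,
          LinearMap.comp_apply, map_smul, U, LinearEquiv.coe_coe]
        generalize (comul (R := k) q) = s
        induction s with
        | zero => simp
        | add x y hx hy => simp only [map_add, TensorProduct.tmul_add, smul_add,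
            Finset.sum_add_distrib, mul_add, hx, hy]
        | tmul q q' =>
          have hb' : ∑ i, f (p * b i) * b.repr (antipode k q) i = f (p * antipode k q) := by
            rw [← hb]
            exact Finset.sum_congr rfl fun i _ => mul_comm _ _
          simp [smul_smul, ← Finset.sum_smul, hb']
    rw [LinearMap.sum_apply]
    refine (e (comul y)).trans ?_
    rw [coassoc_symm_apply, map_rTensor_comul (v := (1 : H)) fun y => by
      rw [LinearMap.comp_apply, mul_antipode_lTensor_comul_apply, Algebra.algebraMap_eq_smul_one]]
    simp
  have h3 : ∀ t : H ⊗[k] H, LinearMap.trace k H ((TensorProduct.lid k (H →ₗ[k] H))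
      (TensorProduct.map f (LinearMap.mulRight k (antipodeSq k H).toLinearMap ∘ₗ
        (Algebra.lmul k H).toLinearMap) t)) =
        LinearMap.mul' k k (TensorProduct.map f (traceIntegral k H) t) := by
    intro t
    induction t with
    | zero => simp
    | add x y hx hy => simp only [map_add, hx, hy]
    | tmul u v => simp [traceIntegral]
  refine (h3 _).symm.trans ?_
  rw [← h1, map_sum]
  simp_rw [fun i => LinearMap.trace_comp_comm' (U i) (W i)]
  rw [← map_sum, h2, map_smul]
  rfl

end Integral

/-! ### The trace integral and the distinguished group-like element -/

section Integral
variable {k H : Type u} [Field k] [Ring H] [HopfAlgebra k H] [Module.Finite k H]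
open HopfAlgebra Coalgebra

omit [Module.Finite k H] in
/-- `S(Λ₍₁₎) μ(Λ₍₂₎ y) = μ(Λ) y`. -/
lemma IsDualIntegral.antipode_mul_integral {μ : H →ₗ[k] k} (hμ : IsDualIntegral μ) {Λ : H}
    (hΛ : IsNormalizedIntegral k Λ) (y : H) :
    TensorProduct.rid k H (TensorProduct.map (antipode k) (μ ∘ₗ LinearMap.mulRight k y) (comul Λ)) =
      μ Λ • y := by
  have h : μ ∘ₗ LinearMap.mulLeft k Λ = μ Λ • counit := by
    ext y
    simp [hΛ.right, mul_comm]
  rw [hμ.antipode_mul, h, LinearMap.lTensor_smul, LinearMap.smul_apply, lTensor_counit_comul]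
  simp

lemma traceIntegral_dualBasis {Λ : H} (hΛ : IsNormalizedIntegral k Λ) (y : H) :
    TensorProduct.rid k H (TensorProduct.map (antipode k)
      (traceIntegral k H ∘ₗ LinearMap.mulRight k y) (comul Λ)) = y := by
  rw [traceIntegral_isDualIntegral.antipode_mul_integral hΛ, traceIntegral_integral hΛ, one_smul]

/-- The antipode is bijective, as `y = S(Λ₍₁₎) λ(Λ₍₂₎ y)`. -/
lemma antipode_bijective {Λ : H} (hΛ : IsNormalizedIntegral k Λ) :
    Function.Bijective (antipode k (A := H)) := by
  have h : Function.Surjective (antipode k (A := H)) := fun y => by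
    refine ⟨TensorProduct.rid k H ((traceIntegral k H ∘ₗ LinearMap.mulRight k y).lTensor H
      (comul Λ)), Eq.trans ?_ (traceIntegral_dualBasis hΛ y)⟩
    generalize (comul (R := k) Λ) = s
    induction s with
    | zero => simp
    | add x y hx hy => simp only [map_add, hx, hy]
    | tmul a b => simp
  exact ⟨LinearMap.injective_iff_surjective.2 h, h⟩

lemma traceIntegral_nondegenerate {Λ : H} (hΛ : IsNormalizedIntegral k Λ) {y : H}
    (hy : ∀ z, traceIntegral k H (z * y) = 0) : y = 0 := by
  have h : traceIntegral k H ∘ₗ LinearMap.mulRight k y = 0 := LinearMap.ext hy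
  rw [← traceIntegral_dualBasis hΛ y, h, TensorProduct.map_zero_right]
  simp

/-- Uniqueness of left integrals of the dual. -/
lemma IsDualIntegral.eq_smul {μ : H →ₗ[k] k} (hμ : IsDualIntegral μ) {Λ : H}
    (hΛ : IsNormalizedIntegral k Λ) : μ = μ Λ • traceIntegral k H := by
  let F : (H →ₗ[k] k) →ₗ[k] H :=
    { toFun := fun f => TensorProduct.rid k H (TensorProduct.map (antipode k) f (comul Λ))
      map_add' := fun f g => by
        rw [TensorProduct.map_add_right, LinearMap.add_apply, map_add]
      map_smul' := fun c f => by
        rw [TensorProduct.map_smul_right, LinearMap.smul_apply, map_smul, RingHom.id_apply] }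
  have hs : Function.Surjective F := fun y => ⟨_, traceIntegral_dualBasis hΛ y⟩
  have hi : Function.Injective F :=
    (LinearMap.injective_iff_surjective_of_finrank_eq_finrank Subspace.dual_finrank_eq).2 hs
  apply hi
  have h1 := hμ.antipode_mul_integral hΛ 1
  have h2 := traceIntegral_dualBasis hΛ 1
  rw [LinearMap.mulRight_one, LinearMap.comp_id] at h1 h2
  rw [map_smul]
  exact h1.trans (congrArg (μ Λ • ·) h2.symm)

/-- The distinguished element `a = λ(Λ₍₁₎) Λ₍₂₎`. -/
def distinguished (Λ : H) : H := TensorProduct.lid k H ((traceIntegral k H).rTensor H (comul Λ))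

/-- `λ(x₍₁₎) x₍₂₎ = λ(x) a`. -/
lemma traceIntegral_rTensor {Λ : H} (hΛ : IsNormalizedIntegral k Λ) (x : H) :
    TensorProduct.lid k H ((traceIntegral k H).rTensor H (comul x)) =
      traceIntegral k H x • distinguished (k := k) Λ := by
  refine sub_eq_zero.1 ((Module.forall_dual_apply_eq_zero_iff k _).1 fun g => ?_)
  have e : ∀ t : H ⊗[k] H, g (TensorProduct.lid k H ((traceIntegral k H).rTensor H t)) =
      LinearMap.mul' k k (TensorProduct.map (traceIntegral k H) g t) := by
    intro t
    induction t with
    | zero => simp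
    | add x y hx hy => simp only [map_add, hx, hy]
    | tmul x y => simp
  let μ := WithConv.toConv (traceIntegral k H) * WithConv.toConv g
  have hμ : IsDualIntegral μ.ofConv := fun f => by
    rw [WithConv.toConv_ofConv, ← mul_assoc, traceIntegral_isDualIntegral, smul_mul_assoc]
  have h := LinearMap.congr_fun (hμ.eq_smul hΛ) x
  rw [map_sub, map_smul, distinguished, e, e, sub_eq_zero, smul_eq_mul, mul_comm]
  exact h

lemma isGroupLikeElem_distinguished {Λ : H} (hΛ : IsNormalizedIntegral k Λ) :
    IsGroupLikeElem k (distinguished (k := k) Λ) where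
  counit_eq_one := by
    have e : ∀ t : H ⊗[k] H, counit (R := k) (TensorProduct.lid k H
        ((traceIntegral k H).rTensor H t)) =
          traceIntegral k H (TensorProduct.rid k H (counit.lTensor H t)) := by
      intro t
      induction t with
      | zero => simp
      | add x y hx hy => simp only [map_add, hx, hy]
      | tmul x y => simp [mul_comm]
    rw [distinguished, e, lTensor_counit_comul]
    simp [traceIntegral_integral hΛ]
  comul_eq_tmul_self := by
    have e : ∀ t : H ⊗[k] H, comul (R := k) (TensorProduct.lid k H
        ((traceIntegral k H).rTensor H t)) =
          ((TensorProduct.lid k H).toLinearMap ∘ₗ (traceIntegral k H).rTensor H).rTensor H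
            ((TensorProduct.assoc k H H H).symm (comul.lTensor H t)) := by
      intro t
      induction t with
      | zero => simp
      | add x y hx hy => simp only [map_add, hx, hy]
      | tmul x y =>
        simp only [LinearMap.rTensor_tmul, LinearMap.lTensor_tmul, TensorProduct.lid_tmul, map_smul]
        generalize (comul (R := k) y) = s
        induction s with
        | zero => simp
        | add x y hx hy => simp only [map_add, smul_add, TensorProduct.tmul_add, hx, hy]
        | tmul a b => simp [TensorProduct.smul_tmul']
    have e' : ∀ t : H ⊗[k] H, ((TensorProduct.lid k H).toLinearMap ∘ₗ
        (traceIntegral k H).rTensor H).rTensor H (comul.rTensor H t) =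
          distinguished (k := k) Λ ⊗ₜ TensorProduct.lid k H ((traceIntegral k H).rTensor H t) := by
      intro t
      induction t with
      | zero => simp
      | add x y hx hy => simp only [map_add, TensorProduct.tmul_add, hx, hy]
      | tmul x y =>
        simp only [LinearMap.rTensor_tmul, TensorProduct.lid_tmul, LinearMap.comp_apply,
          LinearEquiv.coe_coe, traceIntegral_rTensor hΛ, TensorProduct.smul_tmul]
    rw [distinguished, e, coassoc_symm_apply, e', distinguished]

omit [Module.Finite k H] in
lemma IsGroupLikeElem.mul_antipode {a : H} (ha : IsGroupLikeElem k a) : a * antipode k a = 1 := by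
  have h := mul_antipode_lTensor_comul_apply (R := k) a
  rwa [ha.comul_eq_tmul_self, LinearMap.lTensor_tmul, LinearMap.mul'_apply, ha.counit_eq_one,
    map_one] at h

omit [Module.Finite k H] in
lemma IsGroupLikeElem.antipode_mul {a : H} (ha : IsGroupLikeElem k a) : antipode k a * a = 1 := by
  have h := mul_antipode_rTensor_comul_apply (R := k) a
  rwa [ha.comul_eq_tmul_self, LinearMap.rTensor_tmul, LinearMap.mul'_apply, ha.counit_eq_one,
    map_one] at h

/-- Group-like elements are linearly independent, so they have finite order. -/
lemma IsGroupLikeElem.exists_pow_eq_one {a : H} (ha : IsGroupLikeElem k a) :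
    ∃ n, 0 < n ∧ a ^ n = 1 := by
  have hf : {a : H | IsGroupLikeElem k a}.Finite :=
    (linearIndepOn_isGroupLikeElem (R := k) (A := H)).linearIndependent.setFinite
  let u : Hˣ := ⟨a, antipode k a, ha.mul_antipode, ha.antipode_mul⟩
  have hfin : IsOfFinOrder u := by
    rw [isOfFinOrder_iff_pow_eq_one]
    obtain ⟨i, -, j, -, hij, h⟩ := Set.infinite_univ.exists_lt_map_eq_of_mapsTo
      (f := fun n : ℕ => a ^ n) (fun n _ => ha.pow) hf
    refine ⟨j - i, Nat.sub_pos_of_lt hij, ?_⟩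
    have h' : u ^ i = u ^ j := Units.ext (by simpa [u] using h)
    rw [pow_sub _ hij.le, h', mul_inv_cancel]
  obtain ⟨n, hn, h⟩ := isOfFinOrder_iff_pow_eq_one.1 hfin
  exact ⟨n, hn, by simpa [u] using congrArg Units.val h⟩

lemma antipode_integral {Λ : H} (hΛ : IsNormalizedIntegral k Λ) : antipode k Λ = Λ := by
  have h1 := hΛ.left (antipode k Λ)
  have h2 : antipode k Λ * Λ = antipode k Λ := by
    obtain ⟨y, hy⟩ := (antipode_bijective hΛ).2 Λ
    have hc : counit (R := k) y = 1 := by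
      rw [← counit_antipode (R := k) y, hy, hΛ.counit]
    have h := antipode_mul_antidistrib (R := k) y Λ
    rwa [hΛ.left, hc, one_smul, hy, eq_comm] at h
  rw [← h2, h1, counit_antipode, hΛ.counit, one_smul]

/-- `λ(S(x) a) = λ(x)`: the left hand side is a left integral as a function of `x`. -/
lemma traceIntegral_antipode_mul {Λ : H} (hΛ : IsNormalizedIntegral k Λ) (x : H) :
    traceIntegral k H (antipode k x * distinguished (k := k) Λ) = traceIntegral k H x := by
  set a := distinguished (k := k) Λ with ha
  have hg : IsGroupLikeElem k a := isGroupLikeElem_distinguished hΛ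
  let μ : H →ₗ[k] k := traceIntegral k H ∘ₗ LinearMap.mulRight k a ∘ₗ antipode k
  have h1 : ∀ x, TensorProduct.rid k H (μ.lTensor H (comul x)) = μ x • (1 : H) := by
    intro x
    apply (antipode_bijective hΛ).1
    have e : ∀ t : H ⊗[k] H, antipode k (TensorProduct.rid k H (μ.lTensor H t)) =
        TensorProduct.lid k H ((traceIntegral k H).rTensor H (TensorProduct.map (antipode k)
          (antipode k) (TensorProduct.comm k H H t) * (a ⊗ₜ a))) * antipode k a := by
      intro t
      induction t with
      | zero => simp
      | add x y hx hy => simp only [map_add, add_mul, hx, hy]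
      | tmul x y => simp [μ, mul_assoc, hg.mul_antipode]
    rw [e, ← comul_antipode_apply, ← hg.comul_eq_tmul_self, ← Bialgebra.comul_mul,
      traceIntegral_rTensor hΛ, smul_mul_assoc, hg.mul_antipode, map_smul, antipode_one]
    rfl
  have hμ : IsDualIntegral μ := fun g => by
    refine WithConv.ofConv_injective (LinearMap.ext fun x => ?_)
    have e : ∀ t : H ⊗[k] H, g (TensorProduct.rid k H (μ.lTensor H t)) =
        LinearMap.mul' k k (TensorProduct.map g μ t) := by
      intro t
      induction t with
      | zero => simp
      | add x y hx hy => simp only [map_add, hx, hy]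
      | tmul x y => simp [mul_comm]
    refine (e _).symm.trans ?_
    rw [h1, map_smul, smul_eq_mul, mul_comm]
    rfl
  have h2 : μ Λ = 1 := by
    change traceIntegral k H (antipode k Λ * a) = 1
    rw [antipode_integral hΛ, hΛ.right, hg.counit_eq_one, one_smul, traceIntegral_integral hΛ]
  have h3 := LinearMap.congr_fun (hμ.eq_smul hΛ) x
  rwa [h2, one_smul] at h3

/-- Radford's formula for `S⁴`, for a unimodular Hopf algebra: `w a = a S⁴(w)`. -/
lemma mul_distinguished {Λ : H} (hΛ : IsNormalizedIntegral k Λ) (w : H) :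
    w * distinguished (k := k) Λ =
      distinguished (k := k) Λ * antipodeSq k H (antipodeSq k H w) := by
  set a := distinguished (k := k) Λ with ha
  have h : ∀ u w : H, traceIntegral k H (u * w * a) =
      traceIntegral k H (antipodeSq k H w * u * a) := by
    intro u w
    obtain ⟨z, rfl⟩ := (antipode_bijective hΛ).2 u
    obtain ⟨x, rfl⟩ := (antipode_bijective hΛ).2 w
    rw [← antipode_mul_antidistrib, traceIntegral_antipode_mul hΛ, traceIntegral_mul_comm,
      ← traceIntegral_antipode_mul hΛ, antipode_mul_antidistrib]
    rfl
  rw [← sub_eq_zero]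
  refine traceIntegral_nondegenerate hΛ fun u => ?_
  rw [mul_sub, map_sub, ← mul_assoc, h, mul_assoc, traceIntegral_mul_comm, ← mul_assoc, sub_self]
end Integral

/-! ### Traces on products of matrix algebras -/

section MatrixTrace
variable {k : Type u} [Field k]

/-- `Tr(y ↦ u y v) = ∑ᵢ tr(uᵢ) tr(vᵢ)` on a product of matrix algebras. -/
lemma trace_mulLeft_mulRight_pi_matrix {n : ℕ} {d : Fin n → ℕ}
    (u v : ∀ i, Matrix (Fin (d i)) (Fin (d i)) k) :
    LinearMap.trace k (∀ i, Matrix (Fin (d i)) (Fin (d i)) k)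
      (LinearMap.mulLeft k u ∘ₗ LinearMap.mulRight k v) =
        ∑ i, (u i).trace * (v i).trace := by
  have hr : ∀ (i : Fin n) (M : Matrix (Fin (d i)) (Fin (d i)) k) (x : Fin (d i) × Fin (d i)),
      (Matrix.stdBasis k (Fin (d i)) (Fin (d i))).repr M x = M x.1 x.2 := fun _ _ _ => rfl
  rw [LinearMap.trace_eq_matrix_trace k (Pi.basis fun i => Matrix.stdBasis k (Fin (d i)) (Fin (d i))),
    Matrix.trace, Fintype.sum_sigma]
  refine Finset.sum_congr rfl fun i _ => ?_
  rw [Matrix.trace, Matrix.trace, Finset.sum_mul_sum, ← Finset.sum_product']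
  refine Finset.sum_congr rfl fun x _ => ?_
  obtain ⟨r, c⟩ := x
  rw [Matrix.diag_apply, LinearMap.toMatrix_apply, Pi.basis_repr, hr, Pi.basis_apply,
    Matrix.stdBasis_eq_single]
  simp only [LinearMap.comp_apply, LinearMap.mulLeft_apply, LinearMap.mulRight_apply, Pi.mul_apply,
    Pi.single_eq_same, Matrix.diag_apply]
  rw [Matrix.mul_apply, Finset.sum_eq_single r]
  · simp
  · intro b _ hb
    rw [Matrix.single_mul_apply_of_ne _ _ _ _ _ hb, mul_zero]
  · simp

/-- The trace of an endomorphism of finite order and of its inverse. -/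
lemma exists_trace_eq_sum_rootsOfUnity [IsAlgClosed k] [CharZero k] {V : Type*} [AddCommGroup V]
    [Module k V] [FiniteDimensional k V] {f g : Module.End k V} {N : ℕ} (hN : 0 < N)
    (hf : f ^ N = 1) (hfg : g * f = 1) :
    ∃ d : k → ℕ, LinearMap.trace k V f = ∑ μ ∈ Polynomial.nthRootsFinset N (1 : k), d μ * μ ∧
      LinearMap.trace k V g = ∑ μ ∈ Polynomial.nthRootsFinset N (1 : k), d μ * μ⁻¹ := by
  classical
  have hN' : (N : k) ≠ 0 := Nat.cast_ne_zero.2 hN.ne'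
  have hss : f.IsSemisimple := by
    refine Module.End.isSemisimple_of_squarefree_aeval_eq_zero (p := Polynomial.X ^ N - 1)
      (Polynomial.X_pow_sub_one_separable_iff.2 hN').squarefree ?_
    simp [hf]
  let s := Polynomial.nthRootsFinset N (1 : k)
  let E : s → Submodule k V := fun μ => f.eigenspace μ
  have hE : DirectSum.IsInternal E := by
    rw [DirectSum.isInternal_submodule_iff_iSupIndep_and_iSup_eq_top]
    refine ⟨f.eigenspaces_iSupIndep.comp Subtype.val_injective, ?_⟩
    rw [eq_top_iff, ← hss.iSup_eigenspace_eq_top]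
    refine iSup_le fun μ x hx => ?_
    by_cases hx0 : x = 0
    · rw [hx0]; exact zero_mem _
    have hμ : μ ∈ s := by
      rw [Polynomial.mem_nthRootsFinset hN]
      have hv : f.HasEigenvector μ x := ⟨hx, hx0⟩
      have h := hv.pow_apply N
      rw [hf, Module.End.one_apply, eq_comm, ← sub_eq_zero, ← one_smul k x, smul_smul,
        ← sub_smul, mul_one] at h
      exact sub_eq_zero.1 ((smul_eq_zero.1 h).resolve_right (by simpa using hx0))
    exact (le_iSup E ⟨μ, hμ⟩) hx
  have hne : ∀ μ ∈ s, μ ≠ 0 := fun μ hμ h0 => by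
    rw [Polynomial.mem_nthRootsFinset hN, h0, zero_pow hN.ne'] at hμ
    exact zero_ne_one hμ
  have hfE : ∀ (i : s) (x) (_ : x ∈ E i), f x = (i : k) • x := fun i x hx =>
    Module.End.mem_eigenspace_iff.1 hx
  have hgE : ∀ (i : s) (x) (_ : x ∈ E i), g x = (i : k)⁻¹ • x := fun i x hx => by
    have h1 : g (f x) = x := LinearMap.congr_fun hfg x
    rw [hfE i x hx, map_smul] at h1
    rw [← h1, smul_smul, inv_mul_cancel₀ (hne i i.2), one_smul, h1]
  have key : ∀ (h : Module.End k V) (c : k → k), (∀ (i : s) (x) (_ : x ∈ E i), h x = c i • x) →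
      LinearMap.trace k V h = ∑ μ ∈ s, (Module.finrank k (f.eigenspace μ) : k) * c μ := by
    intro h c hc
    rw [LinearMap.trace_eq_sum_trace_restrict hE (fun i x hx => by
      rw [SetLike.mem_coe, hc i x hx]; exact (E i).smul_mem _ hx), ← Finset.sum_coe_sort s]
    refine Finset.sum_congr rfl fun i _ => ?_
    have hr : ∀ p, LinearMap.restrict h (p := E i) (q := E i) p = c i • LinearMap.id := fun p =>
      LinearMap.ext fun x => Subtype.ext (hc i x x.2)
    rw [hr, map_smul, LinearMap.trace_id, smul_eq_mul, mul_comm]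
  exact ⟨fun μ => Module.finrank k (f.eigenspace μ), key f id hfE, key g (·⁻¹) hgE⟩

/-- For matrices `Bᵢ` of finite order, `∑ᵢ tr(Bᵢ) tr(Bᵢ⁻¹)` is an algebraic number that any embedding
into `ℂ` sends to `∑ᵢ |tr(Bᵢ)|²`. -/
lemma sum_trace_mul_trace_inv_ne_zero [IsAlgClosed k] [CharZero k] {n N : ℕ} (hN : 0 < N)
    {d : Fin n → ℕ} (B B' : ∀ i, Matrix (Fin (d i)) (Fin (d i)) k) (hB : ∀ i, B i ^ N = 1)
    (hB' : ∀ i, B' i * B i = 1) (h0 : ∃ i, (B' i).trace ≠ 0) :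
    ∑ i, (B i).trace * (B' i).trace ≠ 0 := by
  have : Algebra.IsAlgebraic ℚ (AlgebraicClosure ℚ) := by
    convert AlgebraicClosure.isAlgebraic ℚ
    · rfl
    · exact Subsingleton.elim _ _
  let j : AlgebraicClosure ℚ →+* k := (IsAlgClosed.lift : _ →ₐ[ℚ] k).toRingHom
  let σ : AlgebraicClosure ℚ →+* ℂ := (IsAlgClosed.lift : _ →ₐ[ℚ] ℂ).toRingHom
  have : NeZero N := ⟨hN.ne'⟩
  obtain ⟨ζ, hζ⟩ := HasEnoughRootsOfUnity.exists_primitiveRoot (AlgebraicClosure ℚ) N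
  have hroot : ∀ μ : k, ∃ m : AlgebraicClosure ℚ, μ ∈ Polynomial.nthRootsFinset N (1 : k) → j m = μ ∧ m ^ N = 1 := by
    intro μ
    by_cases hμ : μ ∈ Polynomial.nthRootsFinset N (1 : k)
    · obtain ⟨i, -, hi⟩ := (hζ.map_of_injective j.injective).eq_pow_of_pow_eq_one
        ((Polynomial.mem_nthRootsFinset hN _).1 hμ)
      refine ⟨ζ ^ i, fun _ => ⟨by rw [map_pow, hi], ?_⟩⟩
      rw [← pow_mul, mul_comm, pow_mul, hζ.pow_eq_one, one_pow]
    · exact ⟨0, fun h => absurd h hμ⟩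
  choose m hm using hroot
  have hσ : ∀ μ ∈ Polynomial.nthRootsFinset N (1 : k), σ (m μ)⁻¹ = starRingEnd ℂ (σ (m μ)) := by
    intro μ hμ
    rw [map_inv₀]
    refine Complex.inv_eq_conj (Complex.norm_eq_one_of_pow_eq_one ?_ hN.ne')
    rw [← map_pow, (hm μ hμ).2, map_one]
  have key : ∀ i, ∃ z w : AlgebraicClosure ℚ, j z = (B i).trace ∧ j w = (B' i).trace ∧
      σ w = starRingEnd ℂ (σ z) := by
    intro i
    obtain ⟨c, h1, h2⟩ := exists_trace_eq_sum_rootsOfUnity (f := Matrix.toLin' (B i))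
      (g := Matrix.toLin' (B' i)) hN (by
        rw [← Matrix.toLin'_pow, hB, Matrix.toLin'_one]; rfl)
      (by rw [Module.End.mul_eq_comp, ← Matrix.toLin'_mul, hB', Matrix.toLin'_one]; rfl)
    rw [Matrix.trace_toLin'_eq] at h1 h2
    refine ⟨∑ μ ∈ Polynomial.nthRootsFinset N (1 : k), c μ * m μ,
      ∑ μ ∈ Polynomial.nthRootsFinset N (1 : k), c μ * (m μ)⁻¹, ?_, ?_, ?_⟩
    · rw [h1, map_sum]
      exact Finset.sum_congr rfl fun μ hμ => by rw [map_mul, map_natCast, (hm μ hμ).1]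
    · rw [h2, map_sum]
      exact Finset.sum_congr rfl fun μ hμ => by
        rw [map_mul, map_natCast, map_inv₀, (hm μ hμ).1]
    · rw [map_sum, map_sum, map_sum]
      exact Finset.sum_congr rfl fun μ hμ => by
        rw [map_mul, map_mul, map_mul, hσ μ hμ, map_natCast, map_natCast]
  choose z w hz hw hzw using key
  intro h
  have h1 : j (∑ i, z i * w i) = 0 := by
    rw [map_sum, ← h]
    exact Finset.sum_congr rfl fun i _ => by rw [map_mul, hz, hw]
  have h2 : ∑ i, Complex.normSq (σ (z i)) = 0 := by
    have h3 := congrArg σ ((map_eq_zero_iff j j.injective).1 h1)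
    rw [map_zero, map_sum] at h3
    rw [← Complex.ofReal_inj, Complex.ofReal_sum, Complex.ofReal_zero, ← h3]
    exact Finset.sum_congr rfl fun i _ => by rw [map_mul, hzw, Complex.mul_conj]
  obtain ⟨i, hi⟩ := h0
  have h4 := (Finset.sum_eq_zero_iff_of_nonneg fun i _ => Complex.normSq_nonneg _).1 h2 i
    (Finset.mem_univ i)
  have h5 : σ (w i) = 0 := by rw [hzw, Complex.normSq_eq_zero.1 h4, map_zero]
  exact hi (by rw [← hw, (map_eq_zero_iff σ σ.injective).1 h5, map_zero])

end MatrixTrace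

/-! ### The fourth power of the antipode of a semisimple Hopf algebra -/

section LarsonRadford
variable {k H : Type u} [Field k] [Ring H] [HopfAlgebra k H] [Module.Finite k H]
open HopfAlgebra Coalgebra

/-- A nondegenerate functional `l` on a product of matrix algebras with Nakayama automorphism `φ`, that
is `l(x z) = l(z φ(x))`, is `x ↦ ∑ᵢ tr(gᵢ xᵢ)` for a unit `g` with `g x = φ(x) g`. -/
lemma exists_unit_of_nondegenerate {n : ℕ} {d : Fin n → ℕ}
    (l : (∀ i, Matrix (Fin (d i)) (Fin (d i)) k) →ₗ[k] k)
    (φ : (∀ i, Matrix (Fin (d i)) (Fin (d i)) k) → (∀ i, Matrix (Fin (d i)) (Fin (d i)) k))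
    (hφ : ∀ x z, l (x * z) = l (z * φ x)) (hl : ∀ y, (∀ z, l (z * y) = 0) → y = 0)
    (hφ0 : ∀ x, φ x = 0 → x = 0) :
    ∃ g g' : ∀ i, Matrix (Fin (d i)) (Fin (d i)) k, g * g' = 1 ∧ g' * g = 1 ∧
      ∀ x, g * x = φ x * g := by
  let A := ∀ i, Matrix (Fin (d i)) (Fin (d i)) k
  let τ : A →ₗ[k] k := ∑ i, Matrix.traceLinearMap (Fin (d i)) k k ∘ₗ LinearMap.proj i
  have hτ : ∀ x : A, τ x = ∑ i, (x i).trace := fun x => LinearMap.sum_apply _ _ _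
  have hτc : ∀ x y : A, τ (x * y) = τ (y * x) := fun x y => by
    rw [hτ, hτ]
    exact Finset.sum_congr rfl fun i _ => Matrix.trace_mul_comm _ _
  have hτ0 : ∀ x : A, (∀ y, τ (x * y) = 0) → x = 0 := by
    intro x hx
    funext i
    rw [Pi.zero_apply, Matrix.ext_iff_trace_mul_right]
    intro M
    have h := hx (Pi.single i M)
    rw [hτ, Finset.sum_eq_single i] at h
    · rw [Matrix.zero_mul, Matrix.trace_zero, ← h, Pi.mul_apply, Pi.single_eq_same]
    · intro j _ hj
      rw [Pi.mul_apply, Pi.single_eq_of_ne hj, mul_zero, Matrix.trace_zero]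
    · simp
  let F : A →ₗ[k] Module.Dual k A := (LinearMap.mul k A).compr₂ τ
  have hF : Function.Surjective F := by
    refine (LinearMap.injective_iff_surjective_of_finrank_eq_finrank
      Subspace.dual_finrank_eq.symm).1 ((injective_iff_map_eq_zero F).2 fun x hx => hτ0 x fun y =>
        LinearMap.congr_fun hx y)
  obtain ⟨g, hg⟩ := hF l
  have hg : ∀ x, τ (g * x) = l x := fun x => LinearMap.congr_fun hg x
  have hgi : Function.Injective (LinearMap.mulLeft k g) := by
    refine (injective_iff_map_eq_zero _).2 fun y hy => hφ0 y (hl _ fun z => ?_)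
    rw [← hφ, ← hg, ← mul_assoc, show g * y = 0 from hy, zero_mul, map_zero]
  obtain ⟨g', hg'⟩ := LinearMap.injective_iff_surjective.1 hgi 1
  have hg' : g * g' = 1 := hg'
  refine ⟨g, g', hg', hgi ?_, fun x => ?_⟩
  · simp only [LinearMap.mulLeft_apply]
    rw [← mul_assoc, hg', one_mul, mul_one]
  · rw [← sub_eq_zero]
    refine hτ0 _ fun z => ?_
    rw [sub_mul, map_sub, mul_assoc, hg, hφ, ← hg, mul_assoc, hτc (φ x), mul_assoc, sub_self]

/-- The trace of `S²` on a semisimple Hopf algebra is not zero. As `S²` is the conjugation by some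
`g` and `S⁴` the conjugation by the inverse of a group-like element, `g` can be rescaled to have finite
order in each block, so that `Tr(S²) = ∑ᵢ tr(gᵢ) tr(gᵢ⁻¹)` is a sum of squared absolute values. -/
lemma traceIntegral_one_ne_zero [IsAlgClosed k] [CharZero k] [IsSemisimpleRing H] :
    traceIntegral k H 1 ≠ 0 := by
  obtain ⟨Λ, hΛ⟩ := exists_isNormalizedIntegral k H
  obtain ⟨n, d, hd, ⟨e⟩⟩ := IsSemisimpleRing.exists_algEquiv_pi_matrix_of_isAlgClosed k H
  let A := ∀ i, Matrix (Fin (d i)) (Fin (d i)) k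
  let σ := antipodeSq k H
  obtain ⟨g, g', hgg', hg'g, hg⟩ := exists_unit_of_nondegenerate
    (traceIntegral k H ∘ₗ e.symm.toLinearMap) (fun x => e (σ (e.symm x)))
    (fun x z => by
      change traceIntegral k H (e.symm (x * z)) = traceIntegral k H (e.symm (z * e _))
      rw [map_mul e.symm, map_mul e.symm, e.symm_apply_apply, traceIntegral_mul_comm])
    (fun y hy => by
      have : e.symm y = 0 := traceIntegral_nondegenerate hΛ fun z => by simpa using hy (e z)
      simpa using this)
    (fun x hx => by
      have h1 : σ (e.symm x) = 0 := by simpa using hx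
      have h2 : e.symm x = 0 := (antipode_bijective hΛ).1 <| (antipode_bijective hΛ).1 <| by
        simpa [σ, antipodeSq_apply] using h1
      simpa using h2)
  have hσ : ∀ x, e (σ x) = g * e x * g' := fun x => by
    have := hg (e x)
    rw [e.symm_apply_apply] at this
    rw [this, mul_assoc, hgg', mul_one]
  have htr : ∀ x, traceIntegral k H x = ∑ i, (e x i * g i).trace * (g' i).trace := by
    intro x
    rw [traceIntegral_apply, ← LinearMap.trace_conj' _ e.toLinearEquiv]
    refine Eq.trans ?_ (trace_mulLeft_mulRight_pi_matrix (e x * g) g')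
    congr 1
    refine LinearMap.ext fun y => ?_
    change e (x * σ (e.symm y)) = e x * g * (y * g')
    rw [map_mul, hσ, e.apply_symm_apply]
    simp only [mul_assoc]
  have h0 : ∃ i, (g' i).trace ≠ 0 := by
    by_contra! h
    have h1 := traceIntegral_integral hΛ
    rw [htr] at h1
    simp [h] at h1
  obtain ⟨N, hN, haN⟩ := (isGroupLikeElem_distinguished hΛ).exists_pow_eq_one
  set a := e (distinguished (k := k) Λ) with ha
  -- `a g²` is central, so it is a scalar in each block
  have hcentral : ∀ x, x * (a * g * g) = a * g * g * x := by
    intro x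
    have h1 := congrArg e (mul_distinguished hΛ (e.symm x))
    change e (_ * _) = e (_ * σ (σ _)) at h1
    rw [map_mul, map_mul, hσ, hσ, e.apply_symm_apply, ← ha] at h1
    calc x * (a * g * g) = (x * a) * g * g := by simp only [mul_assoc]
      _ = a * g * g * x * (g' * (g' * g) * g) := by rw [h1]; simp only [mul_assoc]
      _ = _ := by rw [hg'g, mul_one, hg'g, mul_one]
  have haN : a ^ N = 1 := by rw [ha, ← map_pow, haN, map_one]
  have hscalar : ∀ i, ∃ s : k, s ≠ 0 ∧ a i * g i * g i = Matrix.scalar _ (s ^ 2) := by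
    intro i
    have h1 : a i * g i * g i ∈ Set.range (Matrix.scalar (Fin (d i))) := by
      refine Matrix.mem_range_scalar_of_commute_single fun r c _ => ?_
      simpa [Commute, SemiconjBy] using congrFun (hcentral (Pi.single i (Matrix.single r c 1))) i
    obtain ⟨c, hc⟩ := h1
    obtain ⟨s, hs⟩ := IsAlgClosed.exists_pow_nat_eq c two_pos
    refine ⟨s, ?_, by rw [hs, hc]⟩
    rintro rfl
    rw [zero_pow two_ne_zero] at hs
    rw [← hs, map_zero] at hc
    have hai : a i ^ N = 1 := congrFun haN i
    have h2 : g i * g' i = 1 := congrFun hgg' i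
    have := hd i
    refine one_ne_zero (α := Matrix (Fin (d i)) (Fin (d i)) k) ?_
    calc (1 : Matrix (Fin (d i)) (Fin (d i)) k)
        = a i ^ (N - 1) * (a i * (g i * (g i * g' i) * g' i)) := by
          rw [h2, mul_one, h2, mul_one, ← pow_succ, Nat.sub_add_cancel hN, hai]
      _ = a i ^ (N - 1) * ((a i * g i * g i) * (g' i * g' i)) := by simp only [mul_assoc]
      _ = 0 := by rw [← hc, zero_mul, mul_zero]
  choose s hs0 hs using hscalar
  have hB : ∀ i, ((s i)⁻¹ • g i) ^ (2 * N) = 1 := by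
    intro i
    have h1 : a i * ((s i)⁻¹ • g i) ^ 2 = 1 := by
      rw [smul_pow, mul_smul_comm, pow_two (g i), ← mul_assoc, hs, inv_pow, Matrix.scalar_apply,
        ← Matrix.smul_one_eq_diagonal, smul_smul, inv_mul_cancel₀ (pow_ne_zero 2 (hs0 i)), one_smul]
    have h2 := mul_eq_one_comm.1 h1
    have h3 : Commute (a i) (((s i)⁻¹ • g i) ^ 2) := h1.trans h2.symm
    have h4 := h3.mul_pow N
    rw [h1, one_pow, show a i ^ N = 1 from congrFun haN i, one_mul, ← pow_mul] at h4
    exact h4.symm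
  have hne := sum_trace_mul_trace_inv_ne_zero (by omega : 0 < 2 * N) (fun i => (s i)⁻¹ • g i)
    (fun i => s i • g' i) hB (fun i => by
      rw [smul_mul_smul_comm, mul_inv_cancel₀ (hs0 i), one_smul]
      exact congrFun hg'g i)
    (by
      obtain ⟨i, hi⟩ := h0
      exact ⟨i, by rw [Matrix.trace_smul]; exact smul_ne_zero (hs0 i) hi⟩)
  rw [htr]
  refine fun h => hne (Eq.trans (Finset.sum_congr rfl fun i _ => ?_) h)
  rw [map_one, Pi.one_apply, one_mul, Matrix.trace_smul, Matrix.trace_smul, smul_eq_mul, smul_eq_mul]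
  field_simp [hs0 i]

/-- `S⁴ = 1`: as `λ(1) ≠ 0`, the identity `λ(x₍₁₎) x₍₂₎ = λ(x) a` at `x = 1` gives `a = 1`. -/
lemma antipodeSq_antipodeSq [IsAlgClosed k] [CharZero k] [IsSemisimpleRing H] (x : H) :
    antipodeSq k H (antipodeSq k H x) = x := by
  obtain ⟨Λ, hΛ⟩ := exists_isNormalizedIntegral k H
  have h1 := traceIntegral_rTensor hΛ (1 : H)
  rw [Bialgebra.comul_one, Algebra.TensorProduct.one_def, LinearMap.rTensor_tmul,
    TensorProduct.lid_tmul] at h1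
  have h2 := smul_right_injective H traceIntegral_one_ne_zero h1
  have h3 := mul_distinguished hΛ x
  rwa [← h2, mul_one, one_mul, eq_comm] at h3

end LarsonRadford

/-! ### The theorem of Larson and Radford -/

section LarsonRadford
variable {k H : Type u} [Field k] [Ring H] [HopfAlgebra k H] [Module.Finite k H]
open HopfAlgebra Coalgebra

/-- The action `x ↦ f(x₍₁₎) x₍₂₎` of a functional `f` on `H`. -/
def dualShift (f : H →ₗ[k] k) : Module.End k H :=
  (TensorProduct.lid k H).toLinearMap ∘ₗ f.rTensor H ∘ₗ comul

omit [Module.Finite k H] in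
/-- `w₍₁₎ Q_f(S(w₍₂₎) x) = Q_g(x)` with `g = f(S(w) · ?)`. -/
lemma mulLeft_dualShift_antipode (f : H →ₗ[k] k) (w x : H) (T : H ⊗[k] H →ₗ[k] Module.End k H)
    (hT : ∀ u v, T (u ⊗ₜ v) = LinearMap.mulLeft k u * dualShift f * LinearMap.mulLeft k (antipode k v)) :
    T (comul w) x = dualShift (f ∘ₗ LinearMap.mulLeft k (antipode k w)) x := by
  have e : ∀ t : H ⊗[k] H, T t x = TensorProduct.lid k H (f.rTensor H (TensorProduct.comm k H H
      (TensorProduct.map (LinearMap.mul' k H ∘ₗ (antipode k).lTensor H) (antipode k)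
        ((TensorProduct.assoc k H H H).symm (comul.lTensor H t))) * comul x)) := by
    intro t
    induction t with
    | zero => simp
    | add x y hx hy => simp only [map_add, add_mul, LinearMap.add_apply, hx, hy]
    | tmul u v =>
      rw [hT, LinearMap.lTensor_tmul, Module.End.mul_apply, Module.End.mul_apply, dualShift]
      simp only [LinearMap.mulLeft_apply, LinearMap.comp_apply, LinearEquiv.coe_coe,
        Bialgebra.comul_mul, comul_antipode_apply]
      generalize (comul (R := k) v) = s
      generalize (comul (R := k) x) = r
      induction s with
      | zero => simp
      | add x y hx hy => simp only [map_add, mul_add, add_mul, TensorProduct.tmul_add, hx, hy]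
      | tmul p q =>
        induction r with
        | zero => simp
        | add x y hx hy => simp only [map_add, mul_add, hx, hy]
        | tmul r r' => simp [mul_assoc]
  rw [e, coassoc_symm_apply, map_rTensor_comul (v := (1 : H)) fun y => by
      rw [LinearMap.comp_apply, mul_antipode_lTensor_comul_apply, Algebra.algebraMap_eq_smul_one]]
  rw [dualShift, LinearMap.comp_apply, LinearMap.comp_apply]
  generalize (comul (R := k) x) = r
  induction r with
  | zero => simp
  | add x y hx hy => simp only [map_add, mul_add, hx, hy]
  | tmul r r' => simp

/-- `Tr(Q_f ∘ S²) = Tr(S²) f(Λ)` for `Q_f(x) = f(x₍₁₎) x₍₂₎`: the element of the bidual given by the left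
hand side is an integral. -/
lemma trace_dualShift_antipodeSq {Λ : H} (hΛ : IsNormalizedIntegral k Λ) (f : H →ₗ[k] k) :
    LinearMap.trace k H (dualShift f * (antipodeSq k H).toLinearMap) =
      traceIntegral k H 1 * f Λ := by
  let σ : Module.End k H := (antipodeSq k H).toLinearMap
  let θ : Module.Dual k (Module.Dual k H) :=
    { toFun := fun f => LinearMap.trace k H (dualShift f * σ)
      map_add' := fun f g => by
        rw [← map_add, ← add_mul]
        congr 2
        ext x
        simp [dualShift, LinearMap.rTensor_add]
      map_smul' := fun c f => by
        rw [RingHom.id_apply, ← map_smul, ← smul_mul_assoc]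
        congr 2
        ext x
        simp [dualShift, LinearMap.rTensor_smul] }
  let t : H := (Module.evalEquiv k H).symm θ
  have ht : ∀ f : Module.Dual k H, f t = LinearMap.trace k H (dualShift f * σ) := fun f =>
    Module.apply_evalEquiv_symm_apply k H f θ
  have h1 : ∀ w, antipode k w * t = counit (R := k) w • t := by
    intro w
    refine sub_eq_zero.1 ((Module.forall_dual_apply_eq_zero_iff k _).1 fun f => ?_)
    let T : H ⊗[k] H →ₗ[k] Module.End k H := TensorProduct.lift (LinearMap.mk₂ k
      (fun u v => LinearMap.mulLeft k u * dualShift f * LinearMap.mulLeft k (antipode k v))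
      (fun u u' v => by ext x; simp [add_mul])
      (fun c u v => by ext x; simp)
      (fun u v v' => by ext x; simp [add_mul, mul_add])
      (fun c u v => by ext x; simp))
    have e : ∀ s : H ⊗[k] H, LinearMap.trace k H (T s * σ) = LinearMap.trace k H (dualShift f *
        LinearMap.mulLeft k (antipode k (LinearMap.mul' k H ((antipode k).rTensor H s))) * σ) := by
      intro s
      induction s with
      | zero => simp
      | add x y hx hy =>
        have e : ∀ a b : H, LinearMap.mulLeft k (a + b) = LinearMap.mulLeft k a +
          LinearMap.mulLeft k b := fun a b => by ext; simp [add_mul]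
        simp only [map_add, e, mul_add, add_mul, hx, hy]
      | tmul u v =>
        rw [TensorProduct.lift.tmul, LinearMap.mk₂_apply, mul_assoc, mul_assoc,
          LinearMap.trace_mul_comm, mul_assoc, mul_assoc, mul_assoc]
        congr 2
        ext x
        simp [σ, antipode_mul_antidistrib, antipodeSq_apply]
    have e2 : T (comul w) = dualShift (f ∘ₗ LinearMap.mulLeft k (antipode k w)) :=
      LinearMap.ext fun x => mulLeft_dualShift_antipode f w x T fun u v => rfl
    have e3 := e (comul w)
    rw [mul_antipode_rTensor_comul_apply, Algebra.algebraMap_eq_smul_one, map_smul, antipode_one, e2,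
      ← ht] at e3
    rw [map_sub, map_smul, ht f, sub_eq_zero]
    refine e3.trans ?_
    rw [← map_smul]
    congr 1
    ext x
    simp
  obtain ⟨w, hw⟩ := (antipode_bijective hΛ).2 Λ
  have h2 := h1 w
  rw [← counit_antipode, hw, hΛ.counit, one_smul, hΛ.right] at h2
  have h3 : counit (R := k) t = traceIntegral k H 1 := by
    rw [ht, traceIntegral_apply]
    congr 1
    ext x
    simp [dualShift, σ]
  have h4 := congrArg f h2
  rw [map_smul, smul_eq_mul] at h4
  rw [← h3]
  exact (ht f).symm.trans h4.symm

variable (k H) in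
/-- The character of the regular representation. -/
def regularCharacter : H →ₗ[k] k := LinearMap.trace k H ∘ₗ (Algebra.lmul k H).toLinearMap

lemma regularCharacter_integral {Λ : H} (hΛ : IsNormalizedIntegral k Λ) :
    regularCharacter k H Λ = 1 := by
  have h : LinearMap.mulLeft k Λ = (counit (R := k) (A := H)).smulRight Λ := by
    ext y
    simp [hΛ.right]
  change LinearMap.trace k H (LinearMap.mulLeft k Λ) = 1
  rw [h]
  exact (LinearMap.trace_smulRight _ _).trans hΛ.counit

/-- `χ χ = dim(H) χ` for the regular character `χ`, as `H ⊗ H` is isomorphic to `dim(H)` copies of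
`H` through `y ⊗ z ↦ y₍₁₎ ⊗ y₍₂₎ z`. -/
lemma regularCharacter_mul_self (x : H) :
    LinearMap.mul' k k (TensorProduct.map (regularCharacter k H) (regularCharacter k H) (comul x)) =
      Module.finrank k H * regularCharacter k H x := by
  let T : Module.End k (H ⊗[k] H) := (LinearMap.mul' k H).lTensor H ∘ₗ
    (TensorProduct.assoc k H H H).toLinearMap ∘ₗ comul.rTensor H
  let T' : Module.End k (H ⊗[k] H) := (LinearMap.mul' k H ∘ₗ (antipode k).rTensor H).lTensor H ∘ₗ
    (TensorProduct.assoc k H H H).toLinearMap ∘ₗ comul.rTensor H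
  let D : H ⊗[k] H →ₗ[k] Module.End k (H ⊗[k] H) := TensorProduct.homTensorHomMap (.id k) H H H H ∘ₗ
    TensorProduct.map (Algebra.lmul k H).toLinearMap (Algebra.lmul k H).toLinearMap
  have hD : ∀ t, LinearMap.trace k _ (D t) =
      LinearMap.mul' k k (TensorProduct.map (regularCharacter k H) (regularCharacter k H) t) := by
    intro t
    induction t with
    | zero => simp
    | add x y hx hy => simp only [map_add, hx, hy]
    | tmul u v => exact LinearMap.trace_tensorProduct' _ _
  have hDT : D (comul x) * T = T * TensorProduct.map (LinearMap.mulLeft k x) LinearMap.id := by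
    refine TensorProduct.ext' fun y z => ?_
    simp only [Module.End.mul_apply, T, LinearMap.comp_apply, LinearMap.rTensor_tmul,
      TensorProduct.map_tmul, LinearMap.mulLeft_apply, Bialgebra.comul_mul]
    generalize (comul (R := k) y) = s
    generalize (comul (R := k) x) = r
    induction s with
    | zero => simp
    | add x y hx hy => simp only [map_add, mul_add, TensorProduct.add_tmul, hx, hy]
    | tmul p q =>
      induction r with
      | zero => simp
      | add x y hx hy => simp only [map_add, add_mul, TensorProduct.add_tmul, LinearMap.add_apply,
          hx, hy]
      | tmul r r' => simp [D, mul_assoc]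
  have hTT' : T * T' = 1 := by
    refine TensorProduct.ext' fun y z => ?_
    have e : ∀ t : H ⊗[k] H, T ((LinearMap.mul' k H ∘ₗ (antipode k).rTensor H).lTensor H
        (TensorProduct.assoc k H H H (t ⊗ₜ z))) = (LinearMap.mulRight k z).lTensor H
          (TensorProduct.map LinearMap.id (LinearMap.mul' k H ∘ₗ (antipode k).lTensor H)
            (TensorProduct.assoc k H H H (comul.rTensor H t))) := by
      intro t
      induction t with
      | zero => simp
      | add x y hx hy => simp only [map_add, TensorProduct.add_tmul, hx, hy]
      | tmul u v =>
        simp only [T, TensorProduct.assoc_tmul, LinearMap.lTensor_tmul, LinearMap.comp_apply,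
          LinearMap.rTensor_tmul]
        generalize (comul (R := k) u) = s
        induction s with
        | zero => simp
        | add x y hx hy => simp only [map_add, TensorProduct.add_tmul, hx, hy]
        | tmul p q => simp [mul_assoc]
    refine (e (comul y)).trans ?_
    rw [coassoc_apply, map_lTensor_comul (v := (1 : H)) fun y => by
      rw [LinearMap.comp_apply, mul_antipode_lTensor_comul_apply, Algebra.algebraMap_eq_smul_one]]
    simp
  have hT'T : T' * T = 1 := mul_eq_one_comm.1 hTT'
  rw [← hD, ← mul_one (D _), ← hTT', ← mul_assoc, hDT, LinearMap.trace_mul_comm, ← mul_assoc, hT'T,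
    one_mul, LinearMap.trace_tensorProduct', LinearMap.trace_id, mul_comm]
  rfl

/-- The trace of an endomorphism `R` with `R³ = R` is an integer, the difference of the ranks of the
idempotents `(R² ± R) / 2`. -/
lemma exists_int_eq_trace [CharZero k] {V : Type*} [AddCommGroup V] [Module k V]
    [FiniteDimensional k V] {R : Module.End k V} (hR : R * R * R = R) :
    ∃ z : ℤ, LinearMap.trace k V R = z := by
  have h2 : (2 : k) ≠ 0 := two_ne_zero
  have hR4 : R * R * (R * R) = R * R := by rw [← mul_assoc, hR]
  have hR3 : R * (R * R) = R := by rw [← mul_assoc, hR]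
  have hp : IsIdempotentElem ((2 : k)⁻¹ • (R * R + R)) := by
    rw [IsIdempotentElem, smul_mul_smul_comm, add_mul, mul_add, mul_add, hR4, hR3, hR]
    module
  have hm : IsIdempotentElem ((2 : k)⁻¹ • (R * R - R)) := by
    rw [IsIdempotentElem, smul_mul_smul_comm, sub_mul, mul_sub, mul_sub, hR4, hR3, hR]
    module
  refine ⟨(Module.finrank k (LinearMap.range ((2 : k)⁻¹ • (R * R + R))) : ℤ) -
    Module.finrank k (LinearMap.range ((2 : k)⁻¹ • (R * R - R))), ?_⟩
  push_cast
  rw [← (LinearMap.IsIdempotentElem.isProj_range _ hp).trace,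
    ← (LinearMap.IsIdempotentElem.isProj_range _ hm).trace, ← map_sub]
  congr 1
  module

/-- The theorem of Larson and Radford: the antipode of a finite-dimensional semisimple Hopf algebra in
characteristic zero is an involution. The trace of `S²`, which is not zero, is `dim(H)` times the
trace of an endomorphism `R` with `R³ = R`. As `S⁴ = 1`, this leaves only `S² = 1`. -/
theorem antipode_antipode_of_isSemisimpleRing [IsAlgClosed k] [CharZero k] [IsSemisimpleRing H]
    (x : H) : antipode k (antipode k x) = x := by
  obtain ⟨Λ, hΛ⟩ := exists_isNormalizedIntegral k H
  have : Nontrivial H := ⟨⟨Λ, 0, fun h => by simpa [h] using hΛ.counit⟩⟩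
  let σ : Module.End k H := (antipodeSq k H).toLinearMap
  have hσ : σ * σ = 1 := LinearMap.ext antipodeSq_antipodeSq
  let n := Module.finrank k H
  have hn : 0 < n := Module.finrank_pos
  have hn0 : (n : k) ≠ 0 := Nat.cast_ne_zero.2 hn.ne'
  let Q := dualShift (regularCharacter k H)
  have hQ : ∀ y, Q y = TensorProduct.lid k H ((regularCharacter k H).rTensor H (comul y)) :=
    fun _ => rfl
  have hχ : ∀ y, regularCharacter k H (antipodeSq k H y) = regularCharacter k H y := by
    intro y
    change LinearMap.trace k H (LinearMap.mulLeft k (σ y)) = LinearMap.trace k H (LinearMap.mulLeft k y)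
    have h : LinearMap.mulLeft k (σ y) = σ * (LinearMap.mulLeft k y * σ) := by
      ext z
      simp only [Module.End.mul_apply, LinearMap.mulLeft_apply]
      change σ y * z = σ (y * σ z)
      exact ((map_mul (antipodeSq k H) _ _).trans (congrArg (σ y * ·) (antipodeSq_antipodeSq z))).symm
    rw [h, LinearMap.trace_mul_comm, mul_assoc, hσ, mul_one]
  have hQσ : Q * σ = σ * Q := by
    ext y
    simp only [Module.End.mul_apply, hQ, σ, AlgHom.toLinearMap_apply, comul_antipodeSq]
    generalize (comul (R := k) y) = s
    induction s with
    | zero => simp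
    | add x y hx hy => simp only [map_add, hx, hy]
    | tmul p q => simp [hχ]
  have hQQ : Q * Q = (n : k) • Q := by
    ext y
    have e : ∀ t : H ⊗[k] H, Q (TensorProduct.lid k H ((regularCharacter k H).rTensor H t)) =
        TensorProduct.lid k H ((LinearMap.mul' k k ∘ₗ TensorProduct.map (regularCharacter k H)
          (regularCharacter k H)).rTensor H ((TensorProduct.assoc k H H H).symm
            (comul.lTensor H t))) := by
      intro t
      induction t with
      | zero => simp
      | add x y hx hy => simp only [map_add, hx, hy]
      | tmul u v =>
        simp only [LinearMap.rTensor_tmul, LinearMap.lTensor_tmul, TensorProduct.lid_tmul, map_smul,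
          hQ]
        generalize (comul (R := k) v) = s
        induction s with
        | zero => simp
        | add x y hx hy => simp only [map_add, smul_add, TensorProduct.tmul_add, hx, hy]
        | tmul a b => simp [smul_smul]
    rw [Module.End.mul_apply, LinearMap.smul_apply, hQ y, e, coassoc_symm_apply, ← LinearMap.rTensor_comp_apply]
    have e' : (LinearMap.mul' k k ∘ₗ TensorProduct.map (regularCharacter k H)
        (regularCharacter k H)) ∘ₗ comul = (n : k) • regularCharacter k H :=
      LinearMap.ext regularCharacter_mul_self
    rw [e', LinearMap.rTensor_smul, LinearMap.smul_apply, map_smul]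
  have htr : LinearMap.trace k H (Q * σ) = LinearMap.trace k H σ := by
    rw [trace_dualShift_antipodeSq hΛ, regularCharacter_integral hΛ, mul_one, traceIntegral_apply,
      LinearMap.mulLeft_one, LinearMap.id_comp]
  have hR : ((n : k)⁻¹ • (Q * σ)) * ((n : k)⁻¹ • (Q * σ)) * ((n : k)⁻¹ • (Q * σ)) =
      (n : k)⁻¹ • (Q * σ) := by
    have h1 : Q * σ * (Q * σ) = (n : k) • Q := by
      rw [mul_assoc, ← mul_assoc σ, ← hQσ, mul_assoc Q, hσ, mul_one, hQQ]
    rw [smul_mul_smul_comm, h1, smul_mul_smul_comm, smul_mul_assoc, ← mul_assoc, hQQ,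
      smul_mul_assoc, smul_smul, smul_smul]
    congr 1
    field_simp
  obtain ⟨z, hz⟩ := exists_int_eq_trace hR
  rw [map_smul, htr, smul_eq_mul, inv_mul_eq_iff_eq_mul₀ hn0] at hz
  have hz0 : z ≠ 0 := by
    rintro rfl
    apply traceIntegral_one_ne_zero (k := k) (H := H)
    rw [traceIntegral_apply, LinearMap.mulLeft_one, LinearMap.id_comp]
    exact hz.trans (by simp)
  -- the idempotent `(1 + S²) / 2` has rank `dim(H) (1 + z) / 2`
  let q : Module.End k H := (2 : k)⁻¹ • (1 + σ)
  have hq : IsIdempotentElem q := by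
    rw [IsIdempotentElem, smul_mul_smul_comm, add_mul, mul_add, mul_add, hσ, one_mul, one_mul, mul_one]
    module
  have hqp := LinearMap.IsIdempotentElem.isProj_range _ hq
  have hr : 2 * (Module.finrank k (LinearMap.range q) : ℤ) = n * (1 + z) := by
    have h1 := hqp.trace
    rw [map_smul, map_add, hz, LinearMap.trace_one, smul_eq_mul,
      inv_mul_eq_iff_eq_mul₀ (two_ne_zero)] at h1
    have h2 : ((n * (1 + z) : ℤ) : k) = ((2 * (Module.finrank k (LinearMap.range q) : ℤ) : ℤ) : k) := by
      push_cast
      rw [← h1, mul_add, mul_one]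
    exact (Int.cast_injective h2).symm
  have hle : Module.finrank k (LinearMap.range q) ≤ n := Submodule.finrank_le _
  have hq1 : q 1 = 1 := by
    change (2 : k)⁻¹ • ((1 : H) + antipodeSq k H 1) = 1
    rw [map_one, ← two_smul k (1 : H), smul_smul, inv_mul_cancel₀ two_ne_zero, one_smul]
  have hpos : 0 < Module.finrank k (LinearMap.range q) := by
    rw [Module.finrank_pos_iff_exists_ne_zero]
    exact ⟨⟨1, 1, hq1⟩, fun h => one_ne_zero (congrArg Subtype.val h)⟩
  have hz1 : z = 1 := by
    have h1 : (0 : ℤ) < n * (1 + z) := by omega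
    have h2 : 0 < 1 + z := by
      by_contra! h
      nlinarith
    have h3 : 1 + z ≤ 2 := by
      by_contra! h
      nlinarith
    omega
  have htop : LinearMap.range q = ⊤ := by
    apply Submodule.eq_top_of_finrank_eq
    rw [hz1] at hr
    omega
  have hqx : q x = x := hqp.map_id x (htop ▸ Submodule.mem_top)
  change (2 : k)⁻¹ • (x + antipode k (antipode k x)) = x at hqx
  rw [inv_smul_eq_iff₀ two_ne_zero, two_smul] at hqx
  exact add_left_cancel hqx

end LarsonRadford

/-! ### Slices of tensors, and the one-sided coactions of a bicomodule algebra -/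

section Slice
variable {k : Type u} [Field k] {E H : Type u} [AddCommGroup E] [Module k E] [AddCommGroup H]
  [Module k H]

/-- The functional `f` applied to the second factor of an element of `E ⊗ H`. -/
def slice : E ⊗[k] H →ₗ[k] (H →ₗ[k] k) →ₗ[k] E :=
  LinearMap.mk₂ k (fun t f => TensorProduct.rid k E (f.lTensor E t))
    (fun t t' f => by simp) (fun c t f => by simp)
    (fun t f f' => by simp [LinearMap.lTensor_add])
    (fun c t f => by simp [LinearMap.lTensor_smul])

lemma slice_apply (t : E ⊗[k] H) (f : H →ₗ[k] k) :
    slice t f = TensorProduct.rid k E (f.lTensor E t) := rfl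

@[simp] lemma slice_tmul (a : E) (h : H) (f : H →ₗ[k] k) : slice (a ⊗ₜ h) f = f h • a := by
  simp [slice_apply]

lemma slice_injective : Function.Injective (slice (k := k) (E := E) (H := H)) := by
  classical
  intro t t' h
  let b := Module.Basis.ofVectorSpace k H
  have e : ∀ (t : E ⊗[k] H) i,
      TensorProduct.equivFinsuppOfBasisRight (M := E) b t i = slice t (b.coord i) := by
    intro t i
    induction t with
    | zero => simp
    | add x y hx hy => simp only [map_add, LinearMap.add_apply, Finsupp.add_apply, hx, hy]
    | tmul a h => simp
  apply (TensorProduct.equivFinsuppOfBasisRight (M := E) b).injective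
  ext i
  rw [e, e, h]

/-- Functionals on `H` and `H'` separate the elements of `E ⊗ (H ⊗ H')`. -/
lemma ext_slice_slice {H' : Type u} [AddCommGroup H'] [Module k H'] {t t' : E ⊗[k] (H ⊗[k] H')}
    (h : ∀ (f : H →ₗ[k] k) (g : H' →ₗ[k] k),
      slice t (LinearMap.mul' k k ∘ₗ TensorProduct.map f g) =
        slice t' (LinearMap.mul' k k ∘ₗ TensorProduct.map f g)) : t = t' := by
  refine (TensorProduct.assoc k E H H').symm.injective ?_
  refine slice_injective (LinearMap.ext fun g => slice_injective (LinearMap.ext fun f => ?_))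
  have e : ∀ t : E ⊗[k] (H ⊗[k] H'), slice (slice ((TensorProduct.assoc k E H H').symm t) g) f =
      slice t (LinearMap.mul' k k ∘ₗ TensorProduct.map f g) := by
    intro t
    induction t with
    | zero => simp
    | add x y hx hy => simp only [map_add, LinearMap.add_apply, hx, hy]
    | tmul a t =>
      induction t with
      | zero => simp
      | add x y hx hy => simp only [map_add, LinearMap.add_apply, TensorProduct.tmul_add, hx, hy]
      | tmul x y => simp [smul_smul, mul_comm]
  rw [e, e, h]

/-- The element of `E ⊗ H` with given slices. -/
def ofSlice [Module.Finite k H] (φ : (H →ₗ[k] k) →ₗ[k] E) : E ⊗[k] H :=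
  ∑ i, φ ((Module.finBasis k H).coord i) ⊗ₜ Module.finBasis k H i

@[simp] lemma slice_ofSlice [Module.Finite k H] (φ : (H →ₗ[k] k) →ₗ[k] E) :
    slice (ofSlice φ) = φ := by
  ext f
  rw [ofSlice, map_sum, LinearMap.sum_apply]
  simp_rw [slice_tmul, ← map_smul]
  rw [← map_sum, Module.Basis.sum_dual_apply_smul_coord]

end Slice

namespace BicomoduleAlgebra
variable {k : Type u} [Field k] {H₁ : HopfAlgCat.{u} k} {K : AlgCat.{u} k} {H₂ : HopfAlgCat.{u} k}
  (b : BicomoduleAlgebra H₁ K H₂)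

/-- The isomorphism `h ⊗ (x ⊗ (g ⊗ g')) ↦ (h ⊗ (x ⊗ g)) ⊗ g'`. -/
def regroup (H₁ K H₂ : Type u) [AddCommGroup H₁] [Module k H₁]
    [AddCommGroup K] [Module k K] [AddCommGroup H₂] [Module k H₂] :
    H₁ ⊗[k] (K ⊗[k] (H₂ ⊗[k] H₂)) ≃ₗ[k] (H₁ ⊗[k] (K ⊗[k] H₂)) ⊗[k] H₂ :=
  LinearEquiv.lTensor H₁ (TensorProduct.assoc k K H₂ H₂).symm ≪≫ₗ
    (TensorProduct.assoc k H₁ (K ⊗[k] H₂) H₂).symm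

@[simp] lemma regroup_tmul {H₁ K H₂ : Type u} [AddCommGroup H₁] [Module k H₁]
    [AddCommGroup K] [Module k K] [AddCommGroup H₂] [Module k H₂] (h : H₁) (x : K) (g g' : H₂) :
    regroup (k := k) H₁ K H₂ (h ⊗ₜ (x ⊗ₜ (g ⊗ₜ g'))) = (h ⊗ₜ (x ⊗ₜ g)) ⊗ₜ g' := rfl

lemma leftCoact_apply (x : K) : b.leftCoact x =
    ((TensorProduct.rid k K).toLinearMap ∘ₗ Coalgebra.counit.lTensor K).lTensor H₁ (b.coact x) := rfl

lemma rightCoact_apply (x : K) : b.rightCoact x =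
    TensorProduct.lid k (K ⊗[k] H₂) (Coalgebra.counit.rTensor (K ⊗[k] H₂) (b.coact x)) := rfl

/-- Coassociativity for the full coaction after the right coaction. -/
lemma rTensor_coact_rightCoact (x : K) :
    b.coact.toLinearMap.rTensor H₂ (b.rightCoact x) =
      regroup H₁ K H₂ ((Coalgebra.comul.lTensor K).lTensor H₁ (b.coact x)) := by
  have h1 : ∀ t : H₁ ⊗[k] (K ⊗[k] H₂), b.coact.toLinearMap.rTensor H₂
      (TensorProduct.lid k (K ⊗[k] H₂) (Coalgebra.counit.rTensor (K ⊗[k] H₂) t)) =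
      TensorProduct.lid k _ (Coalgebra.counit.rTensor _
        ((b.coact.toLinearMap.rTensor H₂).lTensor H₁ t)) := by
    intro t
    induction t with
    | zero => simp
    | add x y hx hy => simp only [map_add, hx, hy]
    | tmul x y => simp
  have h2 : ∀ (s : H₁ ⊗[k] H₁) (w : K ⊗[k] (H₂ ⊗[k] H₂)),
      TensorProduct.lid k _ (Coalgebra.counit.rTensor _ (bicomoduleAssoc k H₁ K H₂ (s ⊗ₜ w))) =
        regroup H₁ K H₂ (TensorProduct.lid k H₁ (Coalgebra.counit.rTensor H₁ s) ⊗ₜ w) := by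
    intro s w
    induction s with
    | zero => simp
    | add x y hx hy => simp only [map_add, TensorProduct.add_tmul, hx, hy]
    | tmul h h' => simp [bicomoduleAssoc, regroup, ← TensorProduct.smul_tmul']
  have h3 : ∀ t : H₁ ⊗[k] (K ⊗[k] H₂), TensorProduct.lid k _ (Coalgebra.counit.rTensor _
      (bicomoduleAssoc k H₁ K H₂ (TensorProduct.map Coalgebra.comul (Coalgebra.comul.lTensor K) t))) =
        regroup H₁ K H₂ ((Coalgebra.comul.lTensor K).lTensor H₁ t) := by
    intro t
    induction t with
    | zero => simp
    | add x y hx hy => simp only [map_add, hx, hy]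
    | tmul x y => rw [TensorProduct.map_tmul, h2, Coalgebra.rTensor_counit_comul]; simp
  rw [rightCoact_apply, h1, b.coassoc, h3]

lemma rTensor_leftCoact_rightCoact (x : K) :
    b.leftCoact.toLinearMap.rTensor H₂ (b.rightCoact x) =
      (TensorProduct.assoc k H₁ K H₂).symm (b.coact x) := by
  have h1 : b.leftCoact.toLinearMap =
    ((TensorProduct.rid k K).toLinearMap ∘ₗ Coalgebra.counit.lTensor K).lTensor H₁ ∘ₗ b.coact.toLinearMap := rfl
  rw [h1, LinearMap.rTensor_comp, LinearMap.comp_apply, rTensor_coact_rightCoact]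
  generalize b.coact x = t
  induction t with
  | zero => simp
  | add x y hx hy => simp only [map_add, hx, hy]
  | tmul h t =>
    induction t with
    | zero => simp
    | add x y hx hy => simp only [map_add, TensorProduct.tmul_add, hx, hy]
    | tmul x g =>
      simp only [LinearMap.lTensor_tmul, TensorProduct.assoc_symm_tmul]
      have h2 : ∀ s : H₂ ⊗[k] H₂, (((TensorProduct.rid k K).toLinearMap ∘ₗ
          Coalgebra.counit.lTensor K).lTensor H₁).rTensor H₂ (regroup H₁ K H₂ (h ⊗ₜ (x ⊗ₜ s))) =
          (h ⊗ₜ x) ⊗ₜ TensorProduct.lid k H₂ (Coalgebra.counit.rTensor H₂ s) := by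
        intro s
        induction s with
        | zero => simp
        | add x y hx hy => simp only [map_add, TensorProduct.tmul_add, hx, hy]
        | tmul g g' => simp [TensorProduct.smul_tmul']
      rw [h2, Coalgebra.rTensor_counit_comul]
      simp

lemma rTensor_rightCoact_rightCoact (x : K) :
    b.rightCoact.toLinearMap.rTensor H₂ (b.rightCoact x) =
      (TensorProduct.assoc k K H₂ H₂).symm (Coalgebra.comul.lTensor K (b.rightCoact x)) := by
  have h1 : b.rightCoact.toLinearMap = ((TensorProduct.lid k (K ⊗[k] H₂)).toLinearMap ∘ₗ
    Coalgebra.counit.rTensor (K ⊗[k] H₂)) ∘ₗ b.coact.toLinearMap := rfl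
  rw [h1, LinearMap.rTensor_comp, LinearMap.comp_apply, rTensor_coact_rightCoact, rightCoact_apply]
  generalize b.coact x = t
  induction t with
  | zero => simp
  | add x y hx hy => simp only [map_add, hx, hy]
  | tmul h t =>
    induction t with
    | zero => simp
    | add x y hx hy => simp only [map_add, TensorProduct.tmul_add, hx, hy]
    | tmul x g =>
      simp only [LinearMap.lTensor_tmul, LinearMap.rTensor_tmul, TensorProduct.lid_tmul, map_smul]
      generalize Coalgebra.comul (R := k) g = s
      induction s with
      | zero => simp
      | add x y hx hy => simp only [map_add, TensorProduct.tmul_add, smul_add, hx, hy]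
      | tmul g g' => simp [TensorProduct.smul_tmul']

lemma lTensor_counit_rightCoact (x : K) :
    TensorProduct.rid k K (Coalgebra.counit.lTensor K (b.rightCoact x)) = x := by
  conv_rhs => rw [← b.counit x]
  rw [rightCoact_apply]
  generalize b.coact x = t
  induction t with
  | zero => simp
  | add x y hx hy => simp only [map_add, hx, hy]
  | tmul h t => simp

lemma rTensor_counit_leftCoact (x : K) :
    TensorProduct.lid k K (Coalgebra.counit.rTensor K (b.leftCoact x)) = x := by
  conv_rhs => rw [← b.counit x]
  rw [leftCoact_apply]
  generalize b.coact x = t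
  induction t with
  | zero => simp
  | add x y hx hy => simp only [map_add, hx, hy]
  | tmul h t => simp

end BicomoduleAlgebra

/-! ### Elements that intertwine the left and the right coaction -/

section Intertwining
variable {k : Type u} [Field k] {H₁ : HopfAlgCat.{u} k} {K : AlgCat.{u} k} {H₂ : HopfAlgCat.{u} k}
  (b : BicomoduleAlgebra H₁ K H₂) {E H : Type u} [Ring E] [Algebra k E] [Ring H] [Algebra k H]
  (ψ : K →ₐ[k] E) (l : H₁ →ₐ[k] H) (r : H₂ →ₐ[k] H) (r' : H₂ →ₗ[k] H) (D : E ⊗[k] H)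

/-- The algebra map `x ↦ ψ(x₍₀₎) ⊗ l(x₍₋₁₎)`. -/
def leftHat : K →ₐ[k] E ⊗[k] H :=
  ((Algebra.TensorProduct.map ψ l).comp (Algebra.TensorProduct.comm k H₁ K).toAlgHom).comp
    b.leftCoact

/-- The algebra map `x ↦ ψ(x₍₀₎) ⊗ r(x₍₁₎)`. -/
def rightHat : K →ₐ[k] E ⊗[k] H := (Algebra.TensorProduct.map ψ r).comp b.rightCoact

/-- The map `h ⊗ (x ⊗ g) ↦ (1 ⊗ r'(g)) D (ψ(x) ⊗ l(h))`. -/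
def twist : H₁ ⊗[k] (K ⊗[k] H₂) →ₗ[k] E ⊗[k] H :=
  TensorProduct.lift ((LinearMap.mul k (E ⊗[k] H)).flip.compl₁₂
    (LinearMap.mulLeft k D ∘ₗ (Algebra.TensorProduct.map ψ l).toLinearMap ∘ₗ
      (TensorProduct.comm k H₁ K).toLinearMap) (TensorProduct.mk k E H 1 ∘ₗ r')) ∘ₗ
    (TensorProduct.assoc k H₁ K H₂).symm.toLinearMap

@[simp] lemma twist_tmul (h : H₁) (x : K) (g : H₂) :
    twist ψ l r' D (h ⊗ₜ (x ⊗ₜ g)) = 1 ⊗ₜ r' g * (D * ψ x ⊗ₜ l h) := rfl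

variable {ψ l r r' D}

/-- The two forms of the compatibility of `D` with the coactions determine each other: in
`x₍₀₎ ⊗ r(x₍₁₎)` one can move the second factor to the other side if `r'` inverts `r`. -/
lemma mul_leftHat_iff
    (h₁ : ∀ g, LinearMap.mul' k H (TensorProduct.map r.toLinearMap r'
      (TensorProduct.comm k H₂ H₂ (Coalgebra.comul (R := k) g))) =
        algebraMap k H (Coalgebra.counit (R := k) g))
    (h₂ : ∀ g, LinearMap.mul' k H (TensorProduct.map r' r.toLinearMap
      (TensorProduct.comm k H₂ H₂ (Coalgebra.comul (R := k) g))) =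
        algebraMap k H (Coalgebra.counit (R := k) g)) :
    (∀ x, D * leftHat b ψ l x = rightHat b ψ r x * D) ↔
      ∀ x, ψ x ⊗ₜ 1 * D = twist ψ l r' D (b.coact x) := by
  constructor
  · intro hB x
    have e1 : ∀ t : K ⊗[k] H₂, twist ψ l r' D (TensorProduct.assoc k H₁ K H₂
        (b.leftCoact.toLinearMap.rTensor H₂ t)) = LinearMap.mul' k (E ⊗[k] H)
          (TensorProduct.map (TensorProduct.mk k E H 1 ∘ₗ r') (Algebra.TensorProduct.map ψ r).toLinearMap
            (TensorProduct.comm k _ _ (b.rightCoact.toLinearMap.rTensor H₂ t))) * D := by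
      intro t
      induction t with
      | zero => simp
      | add x y hx hy => simp only [map_add, add_mul, hx, hy]
      | tmul x g =>
        have := hB x
        simp only [leftHat, rightHat, AlgHom.comp_apply] at this
        simp only [LinearMap.rTensor_tmul, AlgHom.toLinearMap_apply, TensorProduct.comm_tmul,
          TensorProduct.map_tmul, LinearMap.mul'_apply, mul_assoc, LinearMap.comp_apply,
          TensorProduct.mk_apply, ← this]
        generalize b.leftCoact x = t
        induction t with
        | zero => simp
        | add x y hx hy => simp only [map_add, mul_add, TensorProduct.add_tmul, hx, hy]
        | tmul h x => simp
    have e2 : ∀ t : K ⊗[k] H₂, LinearMap.mul' k (E ⊗[k] H)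
          (TensorProduct.map (TensorProduct.mk k E H 1 ∘ₗ r') (Algebra.TensorProduct.map ψ r).toLinearMap
            (TensorProduct.comm k _ _ ((TensorProduct.assoc k K H₂ H₂).symm
              (Coalgebra.comul.lTensor K t)))) =
            ψ (TensorProduct.rid k K (Coalgebra.counit.lTensor K t)) ⊗ₜ 1 := by
      intro t
      induction t with
      | zero => simp
      | add x y hx hy => simp only [map_add, TensorProduct.add_tmul, hx, hy]
      | tmul x g =>
        have e3 : ∀ s : H₂ ⊗[k] H₂, LinearMap.mul' k (E ⊗[k] H)
          (TensorProduct.map (TensorProduct.mk k E H 1 ∘ₗ r') (Algebra.TensorProduct.map ψ r).toLinearMap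
            (TensorProduct.comm k _ _ ((TensorProduct.assoc k K H₂ H₂).symm (x ⊗ₜ s)))) =
          ψ x ⊗ₜ LinearMap.mul' k H (TensorProduct.map r' r.toLinearMap
            (TensorProduct.comm k H₂ H₂ s)) := by
          intro s
          induction s with
          | zero => simp
          | add x y hx hy => simp only [map_add, TensorProduct.tmul_add, hx, hy]
          | tmul g g' => simp
        rw [LinearMap.lTensor_tmul, e3, h₂]
        simp [Algebra.algebraMap_eq_smul_one, TensorProduct.smul_tmul']
    have e3 := e1 (b.rightCoact x)
    rw [b.rTensor_leftCoact_rightCoact, LinearEquiv.apply_symm_apply,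
      b.rTensor_rightCoact_rightCoact, e2, b.lTensor_counit_rightCoact] at e3
    exact e3.symm
  · intro hC x
    let Z : (E ⊗[k] H) ⊗[k] H₂ →ₗ[k] E ⊗[k] H := LinearMap.mul' k (E ⊗[k] H) ∘ₗ
      TensorProduct.map (TensorProduct.mk k E H 1 ∘ₗ r.toLinearMap) LinearMap.id ∘ₗ
        (TensorProduct.comm k _ _).toLinearMap
    have hZ : ∀ t g, Z (t ⊗ₜ g) = 1 ⊗ₜ r g * t := fun t g => rfl
    have e1 : ∀ t : K ⊗[k] H₂, Algebra.TensorProduct.map ψ r t * D =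
        Z ((twist ψ l r' D).rTensor H₂ (b.coact.toLinearMap.rTensor H₂ t)) := by
      intro t
      induction t with
      | zero => simp
      | add x y hx hy => simp only [map_add, add_mul, hx, hy]
      | tmul x g =>
        simp only [LinearMap.rTensor_tmul, AlgHom.toLinearMap_apply, hZ, ← hC]
        simp [← mul_assoc]
    have e2 : ∀ t : H₁ ⊗[k] (K ⊗[k] H₂), Z ((twist ψ l r' D).rTensor H₂
        (BicomoduleAlgebra.regroup H₁ K H₂ ((Coalgebra.comul.lTensor K).lTensor H₁ t))) =
        D * Algebra.TensorProduct.map ψ l (TensorProduct.comm k H₁ K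
          (((TensorProduct.rid k K).toLinearMap ∘ₗ Coalgebra.counit.lTensor K).lTensor H₁ t)) := by
      intro t
      induction t with
      | zero => simp
      | add x y hx hy => simp only [map_add, mul_add, hx, hy]
      | tmul h t =>
        induction t with
        | zero => simp
        | add x y hx hy => simp only [map_add, TensorProduct.tmul_add, mul_add, hx, hy]
        | tmul x g =>
          have e3 : ∀ s : H₂ ⊗[k] H₂, Z ((twist ψ l r' D).rTensor H₂
              (BicomoduleAlgebra.regroup H₁ K H₂ (h ⊗ₜ (x ⊗ₜ s)))) =
              1 ⊗ₜ LinearMap.mul' k H (TensorProduct.map r.toLinearMap r'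
                (TensorProduct.comm k H₂ H₂ s)) * (D * ψ x ⊗ₜ l h) := by
            intro s
            induction s with
            | zero => simp
            | add x y hx hy => simp only [map_add, TensorProduct.tmul_add, add_mul, hx, hy]
            | tmul g g' => simp [hZ, ← mul_assoc]
          simp only [LinearMap.lTensor_tmul]
          rw [e3, h₁]
          simp [Algebra.algebraMap_eq_smul_one, TensorProduct.tmul_smul,
            ← Algebra.TensorProduct.one_def]
    rw [rightHat, AlgHom.comp_apply, e1, b.rTensor_coact_rightCoact, e2]
    rfl

end Intertwining

/-! ### Algebra maps on crossed products -/

namespace CrossedProduct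
variable {k A K E : Type u} [Field k] [Ring A] [Algebra k A] [Ring K] [Algebra k K] [Ring E]
  [Algebra k E] {Θ : K →ₐ[k] Module.End k A ⊗[k] K} (φ : A →ₐ[k] E) (ψ : K →ₐ[k] E)

/-- The map `T ⊗ μ ↦ φ(T a) ψ(μ)`. -/
def straight (a : A) : Module.End k A ⊗[k] K →ₗ[k] E :=
  TensorProduct.lift ((LinearMap.mul k E).compl₁₂ (φ.toLinearMap ∘ₗ LinearMap.applyₗ a) ψ.toLinearMap)

@[simp] lemma straight_tmul (a : A) (T : Module.End k A) (μ : K) :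
    straight φ ψ a (T ⊗ₜ μ) = φ (T a) * ψ μ := rfl

/-- The map `a ⊗ x ↦ φ(a) ψ(x)`. -/
def liftLin : A ⊗[k] K →ₗ[k] E :=
  TensorProduct.lift ((LinearMap.mul k E).compl₁₂ φ.toLinearMap ψ.toLinearMap)

@[simp] lemma liftLin_tmul (a : A) (x : K) : liftLin φ ψ (a ⊗ₜ x) = φ a * ψ x := rfl

lemma liftLin_crossedLeft (a : A) (z : A ⊗[k] K) :
    liftLin φ ψ (crossedLeft a z) = φ a * liftLin φ ψ z := by
  induction z with
  | zero => simp
  | add x y hx hy => simp only [map_add, mul_add, hx, hy]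
  | tmul b x => simp [mul_assoc]

lemma liftLin_crossedHat (t : Module.End k A ⊗[k] K) (a : A) (x : K) :
    liftLin φ ψ (crossedHat t (a ⊗ₜ x)) = straight φ ψ a t * ψ x := by
  induction t with
  | zero => simp
  | add x y hx hy => simp only [map_add, LinearMap.add_apply, add_mul, hx, hy]
  | tmul T μ => simp [mul_assoc]

/-- The algebra map on the crossed product that is given by algebra maps on `A` and `K` that satisfy
the relation `x a = (x₍₋₁₎.a) x₍₀₎`. -/
def lift (h : IsCrossed Θ) (hφψ : ∀ x a, ψ x * φ a = straight φ ψ a (Θ x)) :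
    CrossedProduct h →ₐ[k] E :=
  AlgHom.ofLinearMap (liftLin φ ψ) (by
      change liftLin φ ψ (1 ⊗ₜ 1) = 1
      simp) fun z w => by
    suffices e : ∀ z w : A ⊗[k] K,
      liftLin φ ψ (crossedMul Θ z w) = liftLin φ ψ z * liftLin φ ψ w from e z w
    intro z w
    induction z using TensorProduct.induction_on with
    | zero => simp only [map_zero, zero_mul, LinearMap.zero_apply]
    | add x y hx hy => simp only [map_add, LinearMap.add_apply, add_mul, hx, hy]
    | tmul a x =>
      induction w using TensorProduct.induction_on with
      | zero => simp only [map_zero, mul_zero]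
      | add x y hx hy => simp only [map_add, mul_add, hx, hy]
      | tmul b y =>
        rw [crossedMul_tmul, Module.End.mul_apply, liftLin_crossedLeft, liftLin_crossedHat,
          ← hφψ]
        simp only [liftLin_tmul, mul_assoc]

lemma lift_inclLeft (h : IsCrossed Θ) (hφψ : ∀ x a, ψ x * φ a = straight φ ψ a (Θ x)) (a : A) :
    lift φ ψ h hφψ (inclLeft h a) = φ a := by
  change liftLin φ ψ (a ⊗ₜ 1) = _
  simp

lemma lift_inclRight (h : IsCrossed Θ) (hφψ : ∀ x a, ψ x * φ a = straight φ ψ a (Θ x)) (x : K) :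
    lift φ ψ h hφψ (inclRight h x) = ψ x := by
  change liftLin φ ψ (1 ⊗ₜ x) = _
  simp

lemma induction_incl (h : IsCrossed Θ) {p : CrossedProduct h → Prop} (hzero : p 0)
    (hadd : ∀ z w, p z → p w → p (z + w)) (hmul : ∀ a x, p (inclLeft h a * inclRight h x))
    (z : CrossedProduct h) : p z := by
  induction z using TensorProduct.induction_on with
  | zero => exact hzero
  | add x y hx hy => exact hadd x y hx hy
  | tmul a x =>
    have e : (a ⊗ₜ[k] x : A ⊗[k] K) = inclLeft h a * inclRight h x := by
      change _ = crossedMul Θ (a ⊗ₜ 1) (1 ⊗ₜ x)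
      rw [crossedMul_tmul, map_one, map_one, mul_one, crossedLeft_tmul, mul_one]
    exact (congrArg p e).mpr (hmul a x)

/-- The commutation relation of the two subalgebras of the crossed product. -/
lemma inclRight_mul_inclLeft (h : IsCrossed Θ) (x : K) (a : A) :
    inclRight h x * inclLeft h a = straight (inclLeft h) (inclRight h) a (Θ x) := by
  change crossedMul Θ (1 ⊗ₜ x) (a ⊗ₜ 1) = _
  rw [crossedMul_tmul, map_one, one_mul]
  generalize Θ x = t
  induction t with
  | zero => rw [map_zero, map_zero]; rfl
  | add x y hx hy => rw [map_add, LinearMap.add_apply, hx, hy, map_add]; rfl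
  | tmul T μ =>
    rw [crossedHat_tmul, straight_tmul, mul_one]
    change _ = crossedMul Θ (T a ⊗ₜ 1) (1 ⊗ₜ μ)
    rw [crossedMul_tmul, map_one, map_one, mul_one, crossedLeft_tmul, mul_one]

/-- The elements `x` that satisfy the relation with all `a`. -/
def straightSubalgebra (Θ : K →ₐ[k] Module.End k A ⊗[k] K) : Subalgebra k K where
  carrier := {x | ∀ a, ψ x * φ a = straight φ ψ a (Θ x)}
  mul_mem' {x y} hx hy a := by
    have e : ∀ t, ψ x * straight φ ψ a t = straight φ ψ a (Θ x * t) := by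
      intro t
      induction t with
      | zero => simp
      | add x y hx hy => simp only [map_add, mul_add, hx, hy]
      | tmul T μ =>
        rw [straight_tmul, ← mul_assoc, hx]
        generalize Θ x = s
        induction s with
        | zero => simp
        | add x y hx hy => simp only [map_add, add_mul, hx, hy]
        | tmul T' μ' => simp [mul_assoc]
    rw [map_mul ψ, mul_assoc, hy, e, map_mul Θ]
  add_mem' {x y} hx hy a := by rw [map_add, add_mul, hx, hy, map_add, map_add]
  algebraMap_mem' c a := by
    rw [AlgHom.commutes, AlgHom.commutes, Algebra.algebraMap_eq_smul_one,
      Algebra.algebraMap_eq_smul_one, map_smul, Algebra.TensorProduct.one_def, straight_tmul]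
    simp

/-- The elements `a` that satisfy the relation with all elements of a subalgebra of `K` that is
stable under `Θ`. -/
def straightSubalgebra' {K₀ : Type u} [Ring K₀] [Algebra k K₀] (s : K₀ →ₐ[k] K)
    (Θ₀ : K₀ → Module.End k A ⊗[k] K₀) (h : IsCrossed Θ)
    (hs : ∀ y, Θ (s y) = s.toLinearMap.lTensor _ (Θ₀ y)) : Subalgebra k A where
  carrier := {a | ∀ y, ψ (s y) * φ a = straight φ ψ a (Θ (s y))}
  mul_mem' {a b} ha hb y := by
    have e1 : ∀ t : Module.End k A ⊗[k] K₀, straight φ ψ a (s.toLinearMap.lTensor _ t) * φ b =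
        liftLin φ ψ (crossedP Θ a (s.toLinearMap.lTensor _ t) (b ⊗ₜ 1)) := by
      intro t
      induction t with
      | zero => simp
      | add x y hx hy => simp only [map_add, LinearMap.add_apply, add_mul, hx, hy]
      | tmul T μ =>
        have := hb μ
        simp only [LinearMap.lTensor_tmul, straight_tmul, crossedP_tmul, Module.End.mul_apply,
          liftLin_crossedLeft, liftLin_crossedHat, AlgHom.toLinearMap_apply, mul_assoc, map_one,
          mul_one, this]
    rw [map_mul, ← mul_assoc, ha, hs, e1, ← hs, h.straighten, Module.End.mul_apply, crossedLeft_tmul,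
      liftLin_crossedHat, map_one, mul_one]
  add_mem' {a b} ha hb y := by
    have e : ∀ t, straight φ ψ (a + b) t = straight φ ψ a t + straight φ ψ b t := by
      intro t
      induction t with
      | zero => simp
      | add x y hx hy => rw [map_add, map_add, map_add, hx, hy]; abel
      | tmul T μ => simp [add_mul]
    rw [map_add, mul_add, ha, hb, e]
  algebraMap_mem' c y := by
    have e : straight φ ψ (algebraMap k A c) (Θ (s y)) =
        c • liftLin φ ψ (crossedHat (Θ (s y)) (1 ⊗ₜ 1)) := by
      rw [liftLin_crossedHat, map_one, mul_one, Algebra.algebraMap_eq_smul_one]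
      generalize Θ (s y) = t
      induction t with
      | zero => simp
      | add x y hx hy => rw [map_add, map_add, smul_add, hx, hy]
      | tmul T μ => simp
    rw [e, h.unit, liftLin_tmul, AlgHom.commutes, Algebra.algebraMap_eq_smul_one]
    simp

end CrossedProduct

/-! ### The coactions and actions seen from one site -/

/-- If `S² = 1`, then `g₍₂₎ S(g₍₁₎) = ε(g) = S(g₍₂₎) g₍₁₎`. -/
lemma antipode_sandwich {k H : Type u} [Field k] [Ring H] [HopfAlgebra k H]
    (hS : ∀ x : H, HopfAlgebra.antipode k (HopfAlgebra.antipode k x) = x) (g : H) :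
    LinearMap.mul' k H (TensorProduct.map LinearMap.id (HopfAlgebra.antipode k)
      (TensorProduct.comm k H H (Coalgebra.comul (R := k) g))) =
        algebraMap k H (Coalgebra.counit (R := k) g) ∧
    LinearMap.mul' k H (TensorProduct.map (HopfAlgebra.antipode k) LinearMap.id
      (TensorProduct.comm k H H (Coalgebra.comul (R := k) g))) =
        algebraMap k H (Coalgebra.counit (R := k) g) := by
  have hinj : Function.Injective (HopfAlgebra.antipode k : H → H) :=
    Function.LeftInverse.injective hS
  constructor
  · apply hinj
    have e : ∀ t : H ⊗[k] H, HopfAlgebra.antipode k (LinearMap.mul' k H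
        (TensorProduct.map LinearMap.id (HopfAlgebra.antipode k) (TensorProduct.comm k H H t))) =
        LinearMap.mul' k H ((HopfAlgebra.antipode k).lTensor H t) := by
      intro t
      induction t with
      | zero => simp
      | add x y hx hy => simp only [map_add, hx, hy]
      | tmul x y => simp [HopfAlgebra.antipode_mul_antidistrib, hS]
    rw [e, HopfAlgebra.mul_antipode_lTensor_comul_apply, Algebra.algebraMap_eq_smul_one, map_smul,
      HopfAlgebra.antipode_one]
  · apply hinj
    have e : ∀ t : H ⊗[k] H, HopfAlgebra.antipode k (LinearMap.mul' k H
        (TensorProduct.map (HopfAlgebra.antipode k) LinearMap.id (TensorProduct.comm k H H t))) =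
        LinearMap.mul' k H ((HopfAlgebra.antipode k).rTensor H t) := by
      intro t
      induction t with
      | zero => simp
      | add x y hx hy => simp only [map_add, hx, hy]
      | tmul x y => simp [HopfAlgebra.antipode_mul_antidistrib, hS]
    rw [e, HopfAlgebra.mul_antipode_rTensor_comul_apply, Algebra.algebraMap_eq_smul_one, map_smul,
      HopfAlgebra.antipode_one]

/-- The maps `g ↦ g^⟨ε⟩` and `g ↦ g^⟨-ε⟩` are inverse to each other with respect to the coopposite
comultiplication. For the sign `-1` this is the antipode axiom, for `+1` it uses `S² = 1`. -/
lemma signPow_sandwich {k : Type u} [Field k] (H : HopfAlgCat.{u} k)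
    (hS : ∀ x : H, HopfAlgebra.antipode k (HopfAlgebra.antipode k x) = x) :
    (ε : Bool) → (g : signedHopf ε H) →
    LinearMap.mul' k H (TensorProduct.map (signPow H ε).toLinearMap
      ((MulOpposite.opLinearEquiv k).symm.toLinearMap ∘ₗ (signNegPow H ε).toLinearMap)
      (TensorProduct.comm k _ _ (Coalgebra.comul (R := k) g))) =
        algebraMap k H (Coalgebra.counit (R := k) g) ∧
    LinearMap.mul' k H (TensorProduct.map
      ((MulOpposite.opLinearEquiv k).symm.toLinearMap ∘ₗ (signNegPow H ε).toLinearMap)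
      (signPow H ε).toLinearMap (TensorProduct.comm k _ _ (Coalgebra.comul (R := k) g))) =
        algebraMap k H (Coalgebra.counit (R := k) g)
  | true, g => antipode_sandwich hS g
  | false, g => by
    have h1 := HopfAlgebra.mul_antipode_rTensor_comul_apply (R := k) (A := H) g.unop
    have h2 := HopfAlgebra.mul_antipode_lTensor_comul_apply (R := k) (A := H) g.unop
    have e1 : ∀ t : H ⊗[k] H, LinearMap.mul' k H (TensorProduct.map (antipodeOp k H).toLinearMap
        (MulOpposite.opLinearEquiv k).symm.toLinearMap (TensorProduct.comm k _ _
          (TensorProduct.map (MulOpposite.opLinearEquiv k).toLinearMap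
            (MulOpposite.opLinearEquiv k).toLinearMap (TensorProduct.comm k H H t)))) =
        LinearMap.mul' k H ((HopfAlgebra.antipode k).rTensor H t) := by
      intro t
      induction t with
      | zero => simp
      | add x y hx hy => simp only [map_add, hx, hy]
      | tmul x y => rfl
    have e2 : ∀ t : H ⊗[k] H, LinearMap.mul' k H (TensorProduct.map
        (MulOpposite.opLinearEquiv k).symm.toLinearMap (antipodeOp k H).toLinearMap
          (TensorProduct.comm k _ _
          (TensorProduct.map (MulOpposite.opLinearEquiv k).toLinearMap
            (MulOpposite.opLinearEquiv k).toLinearMap (TensorProduct.comm k H H t)))) =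
        LinearMap.mul' k H ((HopfAlgebra.antipode k).lTensor H t) := by
      intro t
      induction t with
      | zero => simp
      | add x y hx hy => simp only [map_add, hx, hy]
      | tmul x y => rfl
    exact ⟨(e1 _).trans h1, (e2 _).trans h2⟩

section
variable {k : Type u} [Field k] {ι : Type} [DecidableEq ι] {B : ι → Type u}
  [∀ i, Ring (B i)] [∀ i, Algebra k (B i)]

lemma endSingle_single (i : ι) (T : Module.End k (B i)) (x : B i) :
    endSingle i T (PiTensorProduct.singleAlgHom (R := k) (A := B) i x) =
      PiTensorProduct.singleAlgHom i (T x) := by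
  rw [PiTensorProduct.singleAlgHom_apply, PiTensorProduct.singleAlgHom_apply, endSingle_tprod]
  congr 1
  ext j
  by_cases h : j = i
  · subst h; simp
  · simp [h]

lemma endSingle_single_of_ne {i j : ι} (h : j ≠ i) {T : Module.End k (B j)} {c : k}
    (hT : T 1 = c • 1) (x : B i) :
    endSingle j T (PiTensorProduct.singleAlgHom (R := k) (A := B) i x) =
      c • PiTensorProduct.singleAlgHom i x := by
  rw [PiTensorProduct.singleAlgHom_apply, endSingle_tprod, MonoidHom.mulSingle_apply,
    Pi.mulSingle_eq_of_ne h, hT, MultilinearMap.map_update_smul]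
  congr 2
  refine Function.update_eq_self_iff.2 ?_
  rw [Pi.mulSingle_eq_of_ne h]

end

namespace DecoratedCircle
variable {k : Type u} [Field k] (C : DecoratedCircle k)

/-- The inclusion of a tensor factor of `⨂_p H_p^*`. -/
def singleDual (p : C.Site) : HopfDual (C.H p) →ₐ[k] C.DualAlg :=
  PiTensorProduct.singleAlgHom (R := k) (A := fun p : C.Site => HopfDual (C.H p)) p

lemma endSite_singleDual (p : C.Site) (T : Module.End k (HopfDual (C.H p))) (f : HopfDual (C.H p)) :
    C.endSite p T (C.singleDual p f) = C.singleDual p (T f) :=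
  endSingle_single (k := k) (B := fun p : C.Site => HopfDual (C.H p)) p T f

lemma endSite_singleDual_of_ne {p q : C.Site} (h : q ≠ p) {T : Module.End k (HopfDual (C.H q))}
    {c : k} (hT : T 1 = c • 1) (f : HopfDual (C.H p)) :
    C.endSite q T (C.singleDual p f) = c • C.singleDual p f :=
  endSingle_single_of_ne (k := k) (B := fun p : C.Site => HopfDual (C.H p)) h hT f

lemma lco_single (p : C.pt) (y : C.signedK p) : C.lco p (C.single p y) =
    Algebra.TensorProduct.map (AlgHom.id k _) (C.single p) ((C.bi p).leftCoact y) := by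
  refine (C.liftK_single _ _ p y).trans ?_
  rw [Function.update_self]
  rfl

lemma lco_single_of_ne {i p : C.pt} (h : i ≠ p) (y : C.signedK i) :
    C.lco p (C.single i y) = 1 ⊗ₜ C.single i y := by
  refine (C.liftK_single _ _ i y).trans ?_
  rw [Function.update_of_ne h]
  rfl

lemma rco_single (d : C.pt) (y : C.signedK d) : C.rco d (C.single d y) =
    Algebra.TensorProduct.map (C.single d) (AlgHom.id k _) ((C.bi d).rightCoact y) := by
  refine (C.liftK_single _ _ d y).trans ?_
  rw [Function.update_self]
  rfl

lemma rco_single_of_ne {i d : C.pt} (h : i ≠ d) (y : C.signedK i) :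
    C.rco d (C.single i y) = C.single i y ⊗ₜ 1 := by
  refine (C.liftK_single _ _ i y).trans ?_
  rw [Function.update_of_ne h]
  rfl

/-- The left coaction of `H_p^ε` on `⨂ᵢ K_i^ε`, in the form `x ↦ x₍₀₎ ⊗ x₍₋₁₎^⟨ε⟩`. -/
def lcoHat (p : C.pt) : C.KAlg →ₐ[k] C.KAlg ⊗[k] C.H p :=
  ((Algebra.TensorProduct.comm k _ _).toAlgHom.comp
    (Algebra.TensorProduct.map (signPow (C.H p) (C.sgn p)) (AlgHom.id k C.KAlg))).comp (C.lco p)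

/-- The right coaction of `H_{nxt d}^ε` on `⨂ᵢ K_i^ε`, in the form `x ↦ x₍₀₎ ⊗ x₍₁₎^⟨ε⟩`. -/
def rcoHat (d : C.pt) : C.KAlg →ₐ[k] C.KAlg ⊗[k] C.H (C.nxt d) :=
  (Algebra.TensorProduct.map (AlgHom.id k C.KAlg) (signPow (C.H (C.nxt d)) (C.sgn d))).comp (C.rco d)

lemma regL_algebraMap (H : HopfAlgCat.{u} k) (c : k) (f : HopfDual H) :
    regL H (algebraMap k H c) f = c • f := by
  rw [AlgHom.commutes, Module.algebraMap_end_apply]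

lemma regR_algebraMap (H : HopfAlgCat.{u} k) (c : k) (f : HopfDual H) :
    regR H (algebraMap k Hᵐᵒᵖ c) f = c • f := by
  rw [AlgHom.commutes, Module.algebraMap_end_apply]

/-- Seen from a site, the left coaction on each factor `K_i^ε` is composed with an algebra map to the
Hopf algebra of the site. It is trivial unless the site is to the left of `i`. -/
lemma exists_left (i p : C.pt) (hp : C.isSite p) :
    ∃ l : signedHopf (C.sgn i) (C.H i) →ₐ[k] C.H p,
      (∀ h f, C.actL i (C.sgn i) h (C.singleDual ⟨p, hp⟩ f) =
        C.singleDual ⟨p, hp⟩ (regL (C.H p) (l h) f)) ∧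
      ∀ y, C.lcoHat p (C.single i y) = leftHat (C.bi i) (C.single i) l y := by
  by_cases hi : i = p
  · subst hi
    refine ⟨signPow (C.H i) (C.sgn i), fun h f => ?_, fun y => ?_⟩
    · rw [actL, dif_pos hp]
      exact C.endSite_singleDual ⟨i, hp⟩ _ f
    · rw [lcoHat, AlgHom.comp_apply, lco_single, leftHat,
        AlgHom.comp_apply, AlgHom.comp_apply]
      generalize (C.bi i).leftCoact y = t
      induction t with
      | zero => simp only [map_zero]
      | add x y hx hy => simp only [map_add, hx, hy]
      | tmul h x => rfl
  · refine ⟨(Algebra.ofId k _).comp (Bialgebra.counitAlgHom k _), fun h f => ?_, fun y => ?_⟩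
    · rw [AlgHom.comp_apply, Algebra.ofId_apply, regL_algebraMap, map_smul, actL]
      split_ifs with hs
      · exact C.endSite_singleDual_of_ne (p := ⟨p, hp⟩) (q := ⟨i, hs⟩)
          (fun e => hi (congrArg Subtype.val e))
          ((regL_moduleAlgebra (signPow (C.H i) (C.sgn i)) (comul_signPow _ _)
            (counit_signPow _ _)).one h) f
      · exact trivialAct_apply _ _ _ _
    · rw [lcoHat, AlgHom.comp_apply, C.lco_single_of_ne hi, leftHat,
        AlgHom.comp_apply, AlgHom.comp_apply]
      conv_lhs => rw [← (C.bi i).rTensor_counit_leftCoact y]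
      generalize (C.bi i).leftCoact y = t
      induction t with
      | zero => simp only [map_zero, TensorProduct.tmul_zero]
      | add x y hx hy => simp only [map_add, TensorProduct.tmul_add, hx, hy]
      | tmul h x =>
        change (C.single i (Coalgebra.counit (R := k) h • x)) ⊗ₜ (signPow _ _ 1) =
          C.single i x ⊗ₜ algebraMap k _ (Coalgebra.counit (R := k) h)
        rw [map_smul, map_one, Algebra.algebraMap_eq_smul_one, TensorProduct.smul_tmul]

/-- Seen from a site, the right coaction on each factor `K_i^ε` is composed with an algebra map `r`
to the Hopf algebra of the site, while the action on the dual uses an algebra map `r'` to the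
opposite. They are trivial unless the site is to the right of `i`. If the sign is `+1`, then `r = id`
and `r' = S`, and they are inverse to each other with respect to the coopposite comultiplication
because `S² = id`. -/
lemma exists_right (i d : C.pt) (hd : C.isSite (C.nxt d))
    (hS : ∀ x : C.H (C.nxt d), HopfAlgebra.antipode k (HopfAlgebra.antipode k x) = x) :
    ∃ (r : signedHopf (C.sgn i) (C.H (C.nxt i)) →ₐ[k] C.H (C.nxt d))
      (r' : signedHopf (C.sgn i) (C.H (C.nxt i)) →ₗ[k] C.H (C.nxt d)),
      (∀ g f, C.actR (C.nxt i) (C.sgn i) g (C.singleDual ⟨C.nxt d, hd⟩ f) =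
        C.singleDual ⟨C.nxt d, hd⟩ (regR (C.H (C.nxt d)) (MulOpposite.op (r' g)) f)) ∧
      (∀ y, C.rcoHat d (C.single i y) = rightHat (C.bi i) (C.single i) r y) ∧
      (∀ g, LinearMap.mul' k _ (TensorProduct.map r.toLinearMap r'
        (TensorProduct.comm k _ _ (Coalgebra.comul (R := k) g))) =
          algebraMap k _ (Coalgebra.counit (R := k) g)) ∧
      (∀ g, LinearMap.mul' k _ (TensorProduct.map r' r.toLinearMap
        (TensorProduct.comm k _ _ (Coalgebra.comul (R := k) g))) =
          algebraMap k _ (Coalgebra.counit (R := k) g)) := by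
  by_cases hi : i = d
  · subst hi
    refine ⟨signPow (C.H (C.nxt i)) (C.sgn i),
      (MulOpposite.opLinearEquiv k).symm.toLinearMap ∘ₗ
        (signNegPow (C.H (C.nxt i)) (C.sgn i)).toLinearMap, fun h f => ?_, fun y => ?_,
      fun g => (signPow_sandwich _ hS _ g).1, fun g => (signPow_sandwich _ hS _ g).2⟩
    · rw [actR, dif_pos hd]
      exact C.endSite_singleDual ⟨C.nxt i, hd⟩ _ f
    · rw [rcoHat, AlgHom.comp_apply, rco_single, rightHat,
        AlgHom.comp_apply]
      generalize (C.bi i).rightCoact y = t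
      induction t with
      | zero => simp only [map_zero]
      | add x y hx hy => simp only [map_add, hx, hy]
      | tmul h x => rfl
  · have hni : C.nxt i ≠ C.nxt d := fun e => hi (C.nxt.injective e)
    have hc : ∀ g : signedHopf (C.sgn i) (C.H (C.nxt i)), LinearMap.mul' k (C.H (C.nxt d))
        (TensorProduct.map (Algebra.linearMap k _ ∘ₗ Coalgebra.counit)
          (Algebra.linearMap k _ ∘ₗ Coalgebra.counit)
        (TensorProduct.comm k _ _ (Coalgebra.comul (R := k) g))) =
          algebraMap k _ (Coalgebra.counit (R := k) g) := by
      intro g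
      have e : ∀ t : signedHopf (C.sgn i) (C.H (C.nxt i)) ⊗[k] signedHopf (C.sgn i) (C.H (C.nxt i)),
        LinearMap.mul' k (C.H (C.nxt d))
        (TensorProduct.map (Algebra.linearMap k _ ∘ₗ Coalgebra.counit)
          (Algebra.linearMap k _ ∘ₗ Coalgebra.counit)
        (TensorProduct.comm k _ _ t)) = algebraMap k _ (LinearMap.mul' k k (TensorProduct.map
          (Coalgebra.counit (A := signedHopf (C.sgn i) (C.H (C.nxt i)))) Coalgebra.counit t)) := by
        intro t
        induction t with
        | zero => simp
        | add x y hx hy => simp only [map_add, hx, hy]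
        | tmul x y =>
          change algebraMap k (C.H (C.nxt d)) (Coalgebra.counit y) * algebraMap k _ (Coalgebra.counit x)
            = algebraMap k _ (Coalgebra.counit x * Coalgebra.counit y)
          rw [← map_mul, mul_comm]
      rw [e, mul_counit_counit]
    refine ⟨(Algebra.ofId k _).comp (Bialgebra.counitAlgHom k _),
      Algebra.linearMap k _ ∘ₗ Coalgebra.counit, fun h f => ?_, fun y => ?_, hc, hc⟩
    · have e : MulOpposite.op ((Algebra.linearMap k (C.H (C.nxt d)) ∘ₗ Coalgebra.counit) h) =
        algebraMap k (C.H (C.nxt d))ᵐᵒᵖ (Coalgebra.counit (R := k) h) := rfl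
      rw [e, regR_algebraMap, map_smul, actR]
      split_ifs with hs
      · exact C.endSite_singleDual_of_ne (p := ⟨C.nxt d, hd⟩) (q := ⟨C.nxt i, hs⟩)
          (fun e => hni (congrArg Subtype.val e))
          ((regR_moduleAlgebra (signNegPow (C.H (C.nxt i)) (C.sgn i)) (comul_signNegPow _ _)
            (counit_signNegPow _ _)).one h) f
      · exact trivialAct_apply _ _ _ _
    · rw [rcoHat, AlgHom.comp_apply, C.rco_single_of_ne hi, rightHat,
        AlgHom.comp_apply]
      conv_lhs => rw [← (C.bi i).lTensor_counit_rightCoact y]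
      generalize (C.bi i).rightCoact y = t
      induction t with
      | zero => simp only [map_zero, TensorProduct.zero_tmul]
      | add x y hx hy => simp only [map_add, TensorProduct.add_tmul, hx, hy]
      | tmul x h =>
        change (C.single i (TensorProduct.rid k _ (x ⊗ₜ Coalgebra.counit (R := k) h))) ⊗ₜ
            (signPow _ _ 1) =
          C.single i x ⊗ₜ algebraMap k _ (Coalgebra.counit (R := k) h)
        rw [TensorProduct.rid_tmul, map_smul, map_one, Algebra.algebraMap_eq_smul_one,
          TensorProduct.smul_tmul]

end DecoratedCircle

/-! ### Elements of End(V) ⊗ H acting on tensor products -/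

section TensorAction
variable {k : Type u} [Field k]

section
variable {E H : Type u} [Ring E] [Algebra k E] [Ring H] [Algebra k H]

lemma slice_tmul_mul (a : E) (h : H) (t : E ⊗[k] H) (f : H →ₗ[k] k) :
    slice (a ⊗ₜ h * t) f = a * slice t (f ∘ₗ LinearMap.mulLeft k h) := by
  induction t with
  | zero => simp
  | add x y hx hy => simp only [map_add, mul_add, LinearMap.add_apply, hx, hy]
  | tmul b g => simp

lemma slice_mul_tmul (a : E) (h : H) (t : E ⊗[k] H) (f : H →ₗ[k] k) :
    slice (t * a ⊗ₜ h) f = slice t (f ∘ₗ LinearMap.mulRight k h) * a := by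
  induction t with
  | zero => simp
  | add x y hx hy => simp only [map_add, add_mul, LinearMap.add_apply, hx, hy]
  | tmul b g => simp

end

section
variable {E H H' : Type u} [Ring E] [Algebra k E] [AddCommGroup H] [Module k H] [AddCommGroup H']
  [Module k H']

/-- The product `(a ⊗ h) ⊗ (b ⊗ g) ↦ a b ⊗ (h ⊗ g)`. In leg notation it is `s₁₂ t₁₃`. -/
def legMul : (E ⊗[k] H) ⊗[k] (E ⊗[k] H') →ₗ[k] E ⊗[k] (H ⊗[k] H') :=
  (LinearMap.mul' k E).rTensor (H ⊗[k] H') ∘ₗ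
    (TensorProduct.tensorTensorTensorComm k E H E H').toLinearMap

@[simp] lemma legMul_tmul (a b : E) (h : H) (g : H') :
    legMul (k := k) ((a ⊗ₜ h) ⊗ₜ (b ⊗ₜ g)) = (a * b) ⊗ₜ (h ⊗ₜ g) := rfl

lemma slice_legMul (s : E ⊗[k] H) (t : E ⊗[k] H') (f : H →ₗ[k] k) (g : H' →ₗ[k] k) :
    slice (legMul (s ⊗ₜ t)) (LinearMap.mul' k k ∘ₗ TensorProduct.map f g) = slice s f * slice t g := by
  induction s with
  | zero => simp
  | add x y hx hy => simp only [map_add, TensorProduct.add_tmul, LinearMap.add_apply, add_mul, hx, hy]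
  | tmul a h =>
    induction t with
    | zero => simp
    | add x y hx hy =>
      simp only [map_add, TensorProduct.tmul_add, LinearMap.add_apply, mul_add, hx, hy]
    | tmul b g => simp [smul_smul, mul_comm]

/-- In leg notation: `t₁₂ s₁₃` is `s₁₂ t₁₃` with the last two factors exchanged if the slices commute. -/
lemma legMul_comm {s : E ⊗[k] H} {t : E ⊗[k] H'}
    (h : ∀ f g, Commute (slice s f) (slice t g)) :
    legMul (t ⊗ₜ s) = (TensorProduct.comm k H H').toLinearMap.lTensor E (legMul (s ⊗ₜ t)) := by
  refine ext_slice_slice fun g f => ?_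
  have e : ∀ u : E ⊗[k] (H ⊗[k] H'), slice ((TensorProduct.comm k H H').toLinearMap.lTensor E u)
      (LinearMap.mul' k k ∘ₗ TensorProduct.map g f) =
        slice u (LinearMap.mul' k k ∘ₗ TensorProduct.map f g) := by
    intro u
    induction u with
    | zero => simp
    | add x y hx hy => simp only [map_add, LinearMap.add_apply, hx, hy]
    | tmul a u =>
      rw [LinearMap.lTensor_tmul, slice_tmul, slice_tmul]
      congr 1
      induction u with
      | zero => simp
      | add x y hx hy => simp only [map_add, hx, hy]
      | tmul x y => simp [mul_comm]
  rw [slice_legMul, e, slice_legMul, (h f g).eq]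

end

section
variable {E : Type u} [Ring E] [Algebra k E] {H : HopfAlgCat.{u} k} {D : E ⊗[k] H}
  {φ : HopfDual H →ₐ[k] E}

/-- If the slices of `D` form a multiplicative map `φ` on `H^*`, then `(1 ⊗ Δ) D = D₁₂ D₁₃`. -/
lemma lTensor_comul_eq_legMul (hD : ∀ f : HopfDual H, slice D f.ofConv = φ f) :
    (Coalgebra.comul (R := k) (A := H)).lTensor E D = legMul (D ⊗ₜ D) := by
  refine ext_slice_slice fun f g => ?_
  have e : ∀ t : E ⊗[k] H, slice ((Coalgebra.comul (R := k) (A := H)).lTensor E t)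
      (LinearMap.mul' k k ∘ₗ TensorProduct.map f g) =
      slice t (WithConv.toConv f * WithConv.toConv g : HopfDual H).ofConv := by
    intro t
    induction t with
    | zero => simp
    | add x y hx hy => simp only [map_add, LinearMap.add_apply, hx, hy]
    | tmul a h =>
      rw [LinearMap.lTensor_tmul, slice_tmul, slice_tmul]
      rfl
  rw [e, hD, map_mul, slice_legMul]
  exact (congrArg₂ _ (hD _) (hD _)).symm

/-- An element of `E ⊗ H` that corresponds to an algebra map `H^* → E` is invertible. -/
lemma mul_lTensor_antipode (hD : ∀ f : HopfDual H, slice D f.ofConv = φ f) :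
    D * (HopfAlgebra.antipode k).lTensor E D = 1 ∧
      (HopfAlgebra.antipode k).lTensor E D * D = 1 := by
  have h1 := lTensor_comul_eq_legMul hD
  have h2 : slice D (Coalgebra.counit (R := k) (A := H)) ⊗ₜ[k] (1 : H) = 1 := by
    have h := hD 1
    rw [map_one] at h
    exact (congrArg (· ⊗ₜ[k] (1 : H)) h).trans Algebra.TensorProduct.one_def.symm
  have e2 : ∀ (F : H ⊗[k] H →ₗ[k] H)
      (_ : ∀ h, F (Coalgebra.comul h) = algebraMap k H (Coalgebra.counit h)) (t : E ⊗[k] H),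
      F.lTensor E ((Coalgebra.comul (R := k) (A := H)).lTensor E t) =
      slice t (Coalgebra.counit (R := k) (A := H)) ⊗ₜ[k] (1 : H) := by
    intro F hF t
    induction t with
    | zero => simp
    | add x y hx hy => simp only [map_add, LinearMap.add_apply, TensorProduct.add_tmul, hx, hy]
    | tmul a h =>
      rw [LinearMap.lTensor_tmul, LinearMap.lTensor_tmul, hF, slice_tmul,
        Algebra.algebraMap_eq_smul_one, TensorProduct.smul_tmul]
  have e3 : ∀ s t : E ⊗[k] H, (LinearMap.mul' k H ∘ₗ (HopfAlgebra.antipode k).lTensor H).lTensor E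
        (legMul (s ⊗ₜ t)) = s * (HopfAlgebra.antipode k).lTensor E t ∧
      (LinearMap.mul' k H ∘ₗ (HopfAlgebra.antipode k).rTensor H).lTensor E
        (legMul (s ⊗ₜ t)) = (HopfAlgebra.antipode k).lTensor E s * t := by
    intro s t
    induction s with
    | zero => simp
    | add x y hx hy =>
      simp only [map_add, TensorProduct.add_tmul, add_mul, hx.1, hy.1, hx.2, hy.2, and_self]
    | tmul a h =>
      induction t with
      | zero => simp
      | add x y hx hy =>
        simp only [map_add, TensorProduct.tmul_add, mul_add, hx.1, hy.1, hx.2, hy.2, and_self]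
      | tmul b g => simp
  exact ⟨by rw [← h2, ← e2 (LinearMap.mul' k H ∘ₗ (HopfAlgebra.antipode k).lTensor H)
      HopfAlgebra.mul_antipode_lTensor_comul_apply D, h1, (e3 D D).1],
    by rw [← h2, ← e2 (LinearMap.mul' k H ∘ₗ (HopfAlgebra.antipode k).rTensor H)
      HopfAlgebra.mul_antipode_rTensor_comul_apply D, h1, (e3 D D).2]⟩

end

section
variable {V : Type u} [AddCommGroup V] [Module k V] {H : Type u} [Ring H] [Algebra k H]

/-- The action of `End(V) ⊗ H` on `V ⊗ X` for an `H`-module `X`. -/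
def actOn (V : Type u) [AddCommGroup V] [Module k V] (X : FDMod k H) :
    Module.End k V ⊗[k] H →ₐ[k] Module.End k (V ⊗[k] X.V) :=
  (Module.endTensorEndAlgHom (R := k) (S := k) (A := k) (M := V) (N := X.V)).comp
    (Algebra.TensorProduct.map (AlgHom.id k _) X.ρ)

@[simp] lemma actOn_tmul (X : FDMod k H) (T : Module.End k V) (h : H) (m : V) (v : X.V) :
    actOn V X (T ⊗ₜ h) (m ⊗ₜ v) = T m ⊗ₜ X.ρ h v := rfl

/-- The evaluation `T ⊗ h ↦ T m ⊗ h`. -/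
def evalFst (m : V) : Module.End k V ⊗[k] H →ₗ[k] V ⊗[k] H :=
  LinearMap.rTensor H (LinearMap.applyₗ m : Module.End k V →ₗ[k] V)

@[simp] lemma evalFst_tmul (m : V) (T : Module.End k V) (h : H) :
    evalFst (k := k) m (T ⊗ₜ h) = T m ⊗ₜ h := rfl

lemma actOn_apply (X : FDMod k H) (t : Module.End k V ⊗[k] H) (m : V) (v : X.V) :
    actOn V X t (m ⊗ₜ v) =
      (LinearMap.applyₗ v ∘ₗ X.ρ.toLinearMap).lTensor V (evalFst m t) := by
  induction t with
  | zero => simp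
  | add x y hx hy => simp only [map_add, LinearMap.add_apply, hx, hy]
  | tmul T h => simp

lemma slice_evalFst (t : Module.End k V ⊗[k] H) (m : V) (f : H →ₗ[k] k) :
    slice (evalFst m t) f = slice t f m := by
  induction t with
  | zero => simp
  | add x y hx hy => simp only [map_add, LinearMap.add_apply, hx, hy]
  | tmul T h => simp

lemma actOn_regular_one [Module.Finite k H] (t : Module.End k V ⊗[k] H) (m : V) :
    actOn V (FDMod.regular k H) t (m ⊗ₜ (1 : H)) = evalFst m t := by
  induction t with
  | zero => simp
  | add x y hx hy => simp only [map_add, LinearMap.add_apply, hx, hy]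
  | tmul T h =>
    refine (actOn_tmul (FDMod.regular k H) T h m (1 : H)).trans ?_
    exact congrArg (T m ⊗ₜ[k] ·) (mul_one h)

lemma actOn_regular_injective [Module.Finite k H] :
    Function.Injective (actOn (k := k) V (FDMod.regular k H)) := by
  intro s t h
  refine slice_injective (LinearMap.ext fun f => LinearMap.ext fun m => ?_)
  rw [← slice_evalFst, ← slice_evalFst, ← actOn_regular_one, ← actOn_regular_one, h]

end

section
variable {V : Type u} [AddCommGroup V] [Module k V] {H H' : Type u} [Ring H] [Algebra k H]
  [Ring H'] [Algebra k H']

/-- The map `T ⊗ (h ⊗ g) ↦ (T m ⊗ h.x) ⊗ g.y` for elements `x` and `y` of an `H`-module and an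
`H'`-module. -/
def evalLegs (X : FDMod k H) (Y : FDMod k H') (m : V) (x : X.V) (y : Y.V) :
    Module.End k V ⊗[k] (H ⊗[k] H') →ₗ[k] (V ⊗[k] X.V) ⊗[k] Y.V :=
  TensorProduct.map (TensorProduct.map (LinearMap.applyₗ m : Module.End k V →ₗ[k] V)
    (LinearMap.applyₗ x ∘ₗ X.ρ.toLinearMap)) (LinearMap.applyₗ y ∘ₗ Y.ρ.toLinearMap) ∘ₗ
    (TensorProduct.assoc k _ _ _).symm.toLinearMap

@[simp] lemma evalLegs_tmul (X : FDMod k H) (Y : FDMod k H') (m : V) (x : X.V) (y : Y.V)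
    (T : Module.End k V) (h : H) (g : H') :
    evalLegs X Y m x y (T ⊗ₜ (h ⊗ₜ g)) = (T m ⊗ₜ X.ρ h x) ⊗ₜ Y.ρ g y := rfl

lemma actOn_rTensor_actOn (X : FDMod k H) (Y : FDMod k H') (m : V) (x : X.V) (y : Y.V)
    (s : Module.End k V ⊗[k] H) (t : Module.End k V ⊗[k] H') :
    (actOn V X s ∘ₗ (TensorProduct.comm k X.V V).toLinearMap).rTensor Y.V
      ((TensorProduct.assoc k X.V V Y.V).symm (x ⊗ₜ actOn V Y t (m ⊗ₜ y))) =
      evalLegs X Y m x y (legMul (s ⊗ₜ t)) := by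
  induction s with
  | zero => simp
  | add u w hu hw =>
    simp only [map_add, TensorProduct.add_tmul, LinearMap.add_comp, LinearMap.rTensor_add,
      LinearMap.add_apply, hu, hw]
  | tmul S h =>
    induction t with
    | zero => simp
    | add u w hu hw =>
      simp only [map_add, TensorProduct.tmul_add, LinearMap.add_apply, hu, hw]
    | tmul T g => simp

lemma evalLegs_comm (X : FDMod k H) (Y : FDMod k H') (m : V) (x : X.V) (y : Y.V)
    (u : Module.End k V ⊗[k] (H ⊗[k] H')) :
    evalLegs Y X m y x ((TensorProduct.comm k H H').toLinearMap.lTensor _ u) =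
      TensorProduct.rightComm k V X.V Y.V (evalLegs X Y m x y u) := by
  induction u with
  | zero => simp
  | add u w hu hw => simp only [map_add, hu, hw]
  | tmul T u =>
    induction u with
    | zero => simp
    | add u w hu hw => simp only [map_add, TensorProduct.tmul_add, hu, hw]
    | tmul h g => simp

end

end TensorAction

section
variable {k : Type u} [Field k] {H₁ : HopfAlgCat.{u} k} {K : AlgCat.{u} k} {H₂ : HopfAlgCat.{u} k}
  (b : BicomoduleAlgebra H₁ K H₂) {A E H : Type u} [Ring A] [Algebra k A] [Ring E] [Algebra k E]
  [Ring H] [Algebra k H]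

lemma map_leftHat (ψ : A →ₐ[k] E) (s : K →ₐ[k] A) (l : H₁ →ₐ[k] H) (x : K) :
    Algebra.TensorProduct.map ψ (AlgHom.id k H) (leftHat b s l x) = leftHat b (ψ.comp s) l x := by
  suffices e : ∀ t : H₁ ⊗[k] K, Algebra.TensorProduct.map ψ (AlgHom.id k H)
      (Algebra.TensorProduct.map s l (Algebra.TensorProduct.comm k H₁ K t)) =
      Algebra.TensorProduct.map (ψ.comp s) l (Algebra.TensorProduct.comm k H₁ K t) from e _
  intro t
  induction t with
  | zero => simp only [map_zero]
  | add x y hx hy => simp only [map_add, hx, hy]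
  | tmul h x => rfl

lemma map_rightHat (ψ : A →ₐ[k] E) (s : K →ₐ[k] A) (r : H₂ →ₐ[k] H) (x : K) :
    Algebra.TensorProduct.map ψ (AlgHom.id k H) (rightHat b s r x) = rightHat b (ψ.comp s) r x := by
  suffices e : ∀ t : K ⊗[k] H₂, Algebra.TensorProduct.map ψ (AlgHom.id k H)
      (Algebra.TensorProduct.map s r t) = Algebra.TensorProduct.map (ψ.comp s) r t from e _
  intro t
  induction t with
  | zero => simp only [map_zero]
  | add x y hx hy => simp only [map_add, hx, hy]
  | tmul h x => rfl

end

namespace DecoratedCircle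
variable {k : Type u} [Field k] (C : DecoratedCircle k) {E : Type u} [Ring E] [Algebra k E]
  (φ : C.DualAlg →ₐ[k] E) (ψ : C.KAlg →ₐ[k] E)

/-- The elements of `⨂ᵢ K_i^ε` that `D` intertwines form a subalgebra, so the tensor factors suffice. -/
lemma intertwine_iff_single (d : C.pt) (D : E ⊗[k] C.H (C.nxt d)) :
    (∀ x, D * Algebra.TensorProduct.map ψ (AlgHom.id k _) (C.lcoHat (C.nxt d) x) =
        Algebra.TensorProduct.map ψ (AlgHom.id k _) (C.rcoHat d x) * D) ↔
      ∀ i y, D * Algebra.TensorProduct.map ψ (AlgHom.id k _) (C.lcoHat (C.nxt d) (C.single i y)) =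
        Algebra.TensorProduct.map ψ (AlgHom.id k _) (C.rcoHat d (C.single i y)) * D := by
  refine ⟨fun h i y => h _, fun h => ?_⟩
  let T : Subalgebra k C.KAlg :=
    { carrier := {x | D * Algebra.TensorProduct.map ψ (AlgHom.id k _) (C.lcoHat (C.nxt d) x) =
        Algebra.TensorProduct.map ψ (AlgHom.id k _) (C.rcoHat d x) * D}
      mul_mem' := fun {x y} hx hy => by
        rw [Set.mem_ofPred_eq] at hx hy ⊢
        rw [map_mul, map_mul, ← mul_assoc, hx, mul_assoc, hy, ← mul_assoc, map_mul, map_mul]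
      add_mem' := fun {x y} hx hy => by
        rw [Set.mem_ofPred_eq] at hx hy ⊢
        rw [map_add, map_add, mul_add, hx, hy, map_add, map_add, add_mul]
      algebraMap_mem' := fun c => by
        rw [Set.mem_ofPred_eq, AlgHom.commutes, AlgHom.commutes, AlgHom.commutes, AlgHom.commutes,
          Algebra.commutes] }
  have hT : T = ⊤ := C.eq_top_of_mem_single T h
  intro x
  exact (hT ▸ Algebra.mem_top : x ∈ T)

/-- Intertwining the two coactions on `⨂ᵢ K_i^ε` amounts to the relation that defines the crossed
product, restricted to the tensor factor `H_p^*`. -/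
lemma intertwine_iff_straight
    (hS : ∀ i (x : C.H i), HopfAlgebra.antipode k (HopfAlgebra.antipode k x) = x)
    (d : C.pt) (hd : C.isSite (C.nxt d)) {D : E ⊗[k] C.H (C.nxt d)}
    (hD : ∀ f : HopfDual (C.H (C.nxt d)), slice D f.ofConv = φ (C.singleDual ⟨C.nxt d, hd⟩ f)) :
    (∀ x, D * Algebra.TensorProduct.map ψ (AlgHom.id k _) (C.lcoHat (C.nxt d) x) =
        Algebra.TensorProduct.map ψ (AlgHom.id k _) (C.rcoHat d x) * D) ↔
      ∀ i y f, ψ (C.single i y) * φ (C.singleDual ⟨C.nxt d, hd⟩ f) =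
        CrossedProduct.straight φ ψ (C.singleDual ⟨C.nxt d, hd⟩ f) (C.act (C.single i y)) := by
  rw [intertwine_iff_single]
  refine forall_congr' fun i => ?_
  obtain ⟨l, hl, hl'⟩ := C.exists_left i (C.nxt d) hd
  obtain ⟨r, r', hr, hr', h₁, h₂⟩ := C.exists_right i d hd (hS _)
  simp_rw [hl', hr', map_leftHat, map_rightHat]
  rw [mul_leftHat_iff (C.bi i) h₁ h₂]
  refine forall_congr' fun y => ?_
  have e : ∀ (f : HopfDual (C.H (C.nxt d))) t,
      slice (twist (ψ.comp (C.single i)) l r' D t) f.ofConv =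
      CrossedProduct.straight φ ψ (C.singleDual ⟨C.nxt d, hd⟩ f)
        (actPair (C.actL i (C.sgn i)) (C.actR (C.nxt i) (C.sgn i)) (C.hlr i) (C.single i) t) := by
    intro f t
    induction t with
    | zero => simp only [map_zero, LinearMap.zero_apply]
    | add x y hx hy => simp only [map_add, LinearMap.add_apply, hx, hy]
    | tmul h t =>
      induction t with
      | zero => simp only [map_zero, LinearMap.zero_apply, TensorProduct.tmul_zero]
      | add x y hx hy => simp only [map_add, LinearMap.add_apply, TensorProduct.tmul_add, hx, hy]
      | tmul x g =>
        rw [twist_tmul, slice_tmul_mul, slice_mul_tmul, one_mul, actPair_tmul,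
          CrossedProduct.straight_tmul, Module.End.mul_apply, hr, hl, ← hD]
        rfl
  rw [act_single, factorAct, AlgHom.comp_apply]
  have e2 : ∀ f : HopfDual (C.H (C.nxt d)), slice ((ψ.comp (C.single i)) y ⊗ₜ[k] 1 * D) f.ofConv =
      ψ (C.single i y) * slice D f.ofConv := by
    intro f
    rw [slice_tmul_mul]
    simp [LinearMap.mulLeft_one]
  constructor
  · intro h f
    rw [← hD]
    exact (e2 f).symm.trans ((congrArg (fun t => slice t f.ofConv) h).trans (e f _))
  · intro h
    refine slice_injective (LinearMap.ext fun f => ?_)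
    have h' := h (WithConv.toConv f)
    rw [← hD] at h'
    exact (e2 (WithConv.toConv f)).trans (h'.trans (e (WithConv.toConv f) _).symm)

end DecoratedCircle

/-! ### From balancings to modules over the vertex algebra -/

namespace FDMod
variable {k : Type u} [Field k] {A : Type u} [Ring A] [Algebra k A]

/-- The morphism with a given underlying linear map. -/
def mkHom {M N : FDMod k A} (f : M.V →ₗ[k] N.V) (hf : ∀ a, f ∘ₗ M.ρ a = N.ρ a ∘ₗ f) : M ⟶ N :=
  ⟨f, hf⟩

lemma lin_comm {M N : FDMod k A} (f : M ⟶ N) (a : A) : lin f ∘ₗ M.ρ a = N.ρ a ∘ₗ lin f := f.2 a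

lemma hom_ext {M N : FDMod k A} {f g : M ⟶ N} (h : lin f = lin g) : f = g := Subtype.ext h

/-- The isomorphism with a given underlying linear equivalence. -/
def mkIso {M N : FDMod k A} (e : M.V ≃ₗ[k] N.V)
    (he : ∀ a, e.toLinearMap ∘ₗ M.ρ a = N.ρ a ∘ₗ e.toLinearMap) : M ≅ N where
  hom := mkHom e.toLinearMap he
  inv := mkHom e.symm.toLinearMap fun a => by
    refine LinearMap.ext fun x => e.injective ?_
    have h := LinearMap.congr_fun (he a) (e.symm x)
    simp only [LinearMap.comp_apply, LinearEquiv.coe_coe, LinearEquiv.apply_symm_apply] at h ⊢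
    exact h.symm
  hom_inv_id := hom_ext (LinearMap.ext e.symm_apply_apply)
  inv_hom_id := hom_ext (LinearMap.ext e.apply_symm_apply)

section
variable {H : Type u} [Ring H] [HopfAlgebra k H] [Module.Finite k H]

lemma tensorH_regular_apply (a : H) (t : H ⊗[k] H) :
    ((regular k H).tensorH (regular k H)).ρ a t = Coalgebra.comul (R := k) a * t := by
  suffices e : ∀ s : H ⊗[k] H, Module.endTensorEndAlgHom (R := k) (S := k) (A := k)
      (Algebra.TensorProduct.map (Algebra.lmul k H) (Algebra.lmul k H) s) t = s * t from e _
  intro s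
  induction s with
  | zero => rw [map_zero, map_zero, zero_mul, LinearMap.zero_apply]
  | add x y hx hy => rw [map_add, map_add, add_mul, LinearMap.add_apply, hx, hy]
  | tmul x y =>
    induction t with
    | zero => rw [map_zero, mul_zero]
    | add x y hx hy => rw [map_add, mul_add, hx, hy]
    | tmul z w => exact (Algebra.TensorProduct.tmul_mul_tmul x z y w).symm

variable (k H) in
/-- The comultiplication as a morphism of modules. -/
def comulHom : regular k H ⟶ (regular k H).tensorH (regular k H) :=
  mkHom (Coalgebra.comul (R := k)) fun a => LinearMap.ext fun b =>
    (Bialgebra.comul_mul (R := k) a b).trans (tensorH_regular_apply a _).symm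

variable (k H) in
/-- The counit as a morphism of modules. -/
def counitHom : regular k H ⟶ unitH k H :=
  mkHom (Coalgebra.counit (R := k)) fun a => LinearMap.ext fun b => Bialgebra.counit_mul (R := k) a b

/-- The morphism of modules `h ↦ h.v`. -/
def orbitHom (X : FDMod k H) (v : X.V) : regular k H ⟶ X :=
  mkHom (LinearMap.applyₗ v ∘ₗ X.ρ.toLinearMap) fun a => LinearMap.ext fun b =>
    LinearMap.congr_fun (map_mul X.ρ a b) v

end

end FDMod

section Coaction
variable {k : Type u} [Field k] {V : Type u} [AddCommGroup V] [Module k V] {H : HopfAlgCat.{u} k}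

/-- The action `f.m = m₍₀₎ f(m₍₁₎)` of `H^*` on a comodule of `H`. -/
def coactionAct (δ : V →ₗ[k] V ⊗[k] H)
    (h1 : ∀ m, (Coalgebra.counit (R := k) (A := H)).lTensor V (δ m) = m ⊗ₜ 1)
    (h2 : ∀ m, (Coalgebra.comul (R := k) (A := H)).lTensor V (δ m) =
      TensorProduct.assoc k V H H (δ.rTensor H (δ m))) : HopfDual H →ₐ[k] Module.End k V :=
  AlgHom.ofLinearMap
    { toFun := fun f => (TensorProduct.rid k V).toLinearMap ∘ₗ f.ofConv.lTensor V ∘ₗ δ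
      map_add' := fun f g => LinearMap.ext fun m => map_add (slice (δ m)) f.ofConv g.ofConv
      map_smul' := fun c f => LinearMap.ext fun m => map_smul (slice (δ m)) c f.ofConv }
    (LinearMap.ext fun m => (congrArg (TensorProduct.rid k V) (h1 m)).trans
      (TensorProduct.rid_tmul m (1 : k) |>.trans (one_smul k m)))
    fun f g => LinearMap.ext fun m => by
      change slice (δ m) ((LinearMap.mul' k k ∘ₗ TensorProduct.map f.ofConv g.ofConv) ∘ₗ
        Coalgebra.comul) = slice (δ (slice (δ m) g.ofConv)) f.ofConv
      rw [slice_apply, LinearMap.lTensor_comp, LinearMap.comp_apply, h2, ← slice_apply]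
      generalize f.ofConv = f
      generalize g.ofConv = g
      generalize δ m = t
      induction t with
      | zero => simp
      | add x y hx hy => simp only [map_add, LinearMap.add_apply, hx, hy]
      | tmul x h =>
        rw [LinearMap.rTensor_tmul, slice_tmul, map_smul, map_smul]
        generalize δ x = t
        induction t with
        | zero => simp
        | add x y hx hy =>
          simp only [map_add, LinearMap.add_apply, LinearMap.smul_apply, TensorProduct.add_tmul,
            smul_add] at hx hy ⊢
          rw [hx, hy]
        | tmul y h' => simp [smul_smul, mul_comm]

lemma rTensor_assoc_symm_tmul {W X Y : Type u} [AddCommGroup W] [Module k W] [AddCommGroup X]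
    [Module k X] [AddCommGroup Y] [Module k Y]
    (β : X ⊗[k] V →ₗ[k] W) (x : X) (t : V ⊗[k] Y) :
    β.rTensor Y ((TensorProduct.assoc k X V Y).symm (x ⊗ₜ t)) =
      (β ∘ₗ TensorProduct.mk k X V x).rTensor Y t := by
  induction t with
  | zero => simp
  | add x y hx hy => simp only [map_add, TensorProduct.tmul_add, hx, hy]
  | tmul x h => rfl

lemma slice_rTensor {W Y : Type u} [AddCommGroup W] [Module k W] [AddCommGroup Y] [Module k Y]
    (δ : V →ₗ[k] W) (t : V ⊗[k] Y) (f : Y →ₗ[k] k) : slice (δ.rTensor Y t) f = δ (slice t f) := by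
  induction t with
  | zero => simp
  | add x y hx hy => simp only [map_add, LinearMap.add_apply, hx, hy]
  | tmul x h => simp

lemma slice_rightComm {X Y : Type u} [AddCommGroup X] [Module k X] [AddCommGroup Y] [Module k Y]
    (t : (V ⊗[k] X) ⊗[k] Y) (f : X →ₗ[k] k) (g : Y →ₗ[k] k) :
    slice (slice (TensorProduct.rightComm k V X Y t) f) g = slice (slice t g) f := by
  induction t with
  | zero => simp
  | add x y hx hy => simp only [map_add, LinearMap.add_apply, hx, hy]
  | tmul t y =>
    induction t with
    | zero => simp
    | add u w hx hy =>
      simp only [map_add, LinearMap.add_apply, TensorProduct.add_tmul, hx, hy]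
    | tmul v x => simp [smul_smul, mul_comm]

lemma slice_commute {X Y : Type u} [AddCommGroup X] [Module k X] [AddCommGroup Y] [Module k Y]
    (β : X ⊗[k] V →ₗ[k] V ⊗[k] X) (β' : Y ⊗[k] V →ₗ[k] V ⊗[k] Y) (x : X) (y : Y) (m : V)
    (h : β'.rTensor X ((TensorProduct.assoc k Y V X).symm (y ⊗ₜ β (x ⊗ₜ m))) =
      TensorProduct.rightComm k V X Y (β.rTensor Y
        ((TensorProduct.assoc k X V Y).symm (x ⊗ₜ β' (y ⊗ₜ m)))))
    (f : X →ₗ[k] k) (g : Y →ₗ[k] k) :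
    slice (β' (y ⊗ₜ slice (β (x ⊗ₜ m)) f)) g = slice (β (x ⊗ₜ slice (β' (y ⊗ₜ m)) g)) f := by
  have h2 := congrArg (fun t : (V ⊗[k] Y) ⊗[k] X => slice (slice t f) g) h
  simp only [slice_rightComm] at h2
  rwa [rTensor_assoc_symm_tmul β', rTensor_assoc_symm_tmul β, slice_rTensor, slice_rTensor] at h2

lemma hexagon_one (β : H ⊗[k] V →ₗ[k] V ⊗[k] H) (m : V) :
    TensorProduct.assoc k V H H (β.rTensor H ((TensorProduct.assoc k H V H).symm (β.lTensor H
      (TensorProduct.assoc k H H V (Coalgebra.comul (R := k) (1 : H) ⊗ₜ m))))) =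
      TensorProduct.assoc k V H H ((β ∘ₗ TensorProduct.mk k H V (1 : H)).rTensor H (β ((1 : H) ⊗ₜ m))) := by
  rw [Bialgebra.comul_one, Algebra.TensorProduct.one_def, TensorProduct.assoc_tmul,
    LinearMap.lTensor_tmul, rTensor_assoc_symm_tmul β]

lemma comp_comm_injective {X W : Type u} [AddCommGroup X] [Module k X] [AddCommGroup W] [Module k W]
    {f g : V ⊗[k] X →ₗ[k] W} (h : f ∘ₗ (TensorProduct.comm k X V).toLinearMap =
      g ∘ₗ (TensorProduct.comm k X V).toLinearMap) : f = g :=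
  TensorProduct.ext' fun v x => LinearMap.congr_fun h (x ⊗ₜ v)

end Coaction

namespace DecoratedCircle
variable {k : Type u} [Field k] {C : DecoratedCircle k}

lemma lact_comm (d : C.pt) (X : FDMod k (C.H d)) (M : FDMod k C.KAlg) (x : C.KAlg) :
    (TensorProduct.comm k X.V M.V).toLinearMap ∘ₗ (C.lact d X M).ρ x =
      actOn M.V X (Algebra.TensorProduct.map M.ρ (AlgHom.id k _) (C.lcoHat d x)) ∘ₗ
        (TensorProduct.comm k X.V M.V).toLinearMap := by
  suffices e : ∀ t : signedHopf (C.sgn d) (C.H d) ⊗[k] C.KAlg,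
      (TensorProduct.comm k X.V M.V).toLinearMap ∘ₗ
        ((X.restrict (signPow (C.H d) (C.sgn d))).tensor M).ρ t =
      actOn M.V X (Algebra.TensorProduct.map M.ρ (AlgHom.id k _)
        (Algebra.TensorProduct.comm k _ _ (Algebra.TensorProduct.map (signPow (C.H d) (C.sgn d))
          (AlgHom.id k C.KAlg) t))) ∘ₗ (TensorProduct.comm k X.V M.V).toLinearMap from e _
  intro t
  induction t with
  | zero => simp only [map_zero, LinearMap.comp_zero, LinearMap.zero_comp]
  | add x y hx hy => simp only [map_add, LinearMap.comp_add, LinearMap.add_comp, hx, hy]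
  | tmul h x => exact TensorProduct.ext' fun v m => rfl

lemma ract_eq (d : C.pt) (M : FDMod k C.KAlg) (X : FDMod k (C.H (C.nxt d))) (x : C.KAlg) :
    (C.ract d M X).ρ x =
      actOn M.V X (Algebra.TensorProduct.map M.ρ (AlgHom.id k _) (C.rcoHat d x)) := by
  suffices e : ∀ t : C.KAlg ⊗[k] signedHopf (C.sgn d) (C.H (C.nxt d)),
      (M.tensor (X.restrict (signPow (C.H (C.nxt d)) (C.sgn d)))).ρ t =
      actOn M.V X (Algebra.TensorProduct.map M.ρ (AlgHom.id k _)
        (Algebra.TensorProduct.map (AlgHom.id k C.KAlg) (signPow (C.H (C.nxt d)) (C.sgn d)) t)) from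
    e _
  intro t
  induction t with
  | zero => simp only [map_zero]
  | add x y hx hy => simp only [map_add, hx, hy]
  | tmul x h => exact TensorProduct.ext' fun v m => rfl

instance : Fintype C.Site := Fintype.ofFinite _

namespace GluingCategory
variable (M : C.GluingCategory) (d : C.pt) (hd : C.isSite (C.nxt d))

/-- The coaction `m ↦ β(1 ⊗ m)` of `H_p` that is given by the balancing at the regular module. -/
def delta : M.obj.V →ₗ[k] M.obj.V ⊗[k] C.H (C.nxt d) :=
  M.balancing d hd (FDMod.regular k (C.H (C.nxt d))) ∘ₗ
    TensorProduct.mk k (C.H (C.nxt d)) M.obj.V 1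

lemma balancing_natural {X Y : FDMod k (C.H (C.nxt d))} (f : X ⟶ Y) (v : X.V) (m : M.obj.V) :
    M.balancing d hd Y (FDMod.lin f v ⊗ₜ m) =
      (FDMod.lin f).lTensor M.obj.V (M.balancing d hd X (v ⊗ₜ m)) :=
  LinearMap.congr_fun (M.natural d hd f) (v ⊗ₜ m)

/-- The balancing at any module is determined by that at the regular module. -/
lemma balancing_tmul (X : FDMod k (C.H (C.nxt d))) (v : X.V) (m : M.obj.V) :
    M.balancing d hd X (v ⊗ₜ m) =
      (LinearMap.applyₗ v ∘ₗ X.ρ.toLinearMap).lTensor M.obj.V (M.delta d hd m) := by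
  have h := M.balancing_natural d hd (FDMod.orbitHom X v) (1 : C.H (C.nxt d)) m
  refine Eq.trans ?_ h
  congr 2
  exact (LinearMap.congr_fun (map_one X.ρ) v).symm

lemma lTensor_counit_delta (m : M.obj.V) :
    (Coalgebra.counit (R := k) (A := C.H (C.nxt d))).lTensor M.obj.V (M.delta d hd m) = m ⊗ₜ 1 := by
  refine (M.balancing_natural d hd (FDMod.counitHom k (C.H (C.nxt d))) (1 : C.H (C.nxt d)) m).symm.trans
    ((LinearMap.congr_fun (M.unit d hd) _).trans ?_)
  change (TensorProduct.rid k M.obj.V).symm (TensorProduct.lid k M.obj.V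
    (Coalgebra.counit (R := k) (1 : C.H (C.nxt d)) ⊗ₜ m)) = _
  rw [Bialgebra.counit_one, TensorProduct.lid_tmul, one_smul, TensorProduct.rid_symm_apply]

lemma lTensor_comul_delta (m : M.obj.V) :
    (Coalgebra.comul (R := k) (A := C.H (C.nxt d))).lTensor M.obj.V (M.delta d hd m) =
      TensorProduct.assoc k M.obj.V (C.H (C.nxt d)) (C.H (C.nxt d))
        ((M.delta d hd).rTensor (C.H (C.nxt d)) (M.delta d hd m)) := by
  refine (M.balancing_natural d hd (FDMod.comulHom k (C.H (C.nxt d))) (1 : C.H (C.nxt d)) m).symm.trans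
    ((LinearMap.congr_fun (M.hexagon d hd _ _) _).trans ?_)
  exact hexagon_one (M.balancing d hd (FDMod.regular k (C.H (C.nxt d)))) m

/-- The action of `H_p^*` for the site `p = nxt d`, that is `f.m = (id ⊗ f)(β(1 ⊗ m))`. -/
def dualAct : HopfDual (C.H (C.nxt d)) →ₐ[k] Module.End k M.obj.V :=
  coactionAct (M.delta d hd) (M.lTensor_counit_delta d hd) (M.lTensor_comul_delta d hd)

lemma dualAct_apply (f : HopfDual (C.H (C.nxt d))) (m : M.obj.V) :
    M.dualAct d hd f m = slice (M.delta d hd m) f.ofConv := rfl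

/-- The element of `End(M) ⊗ H_p` that corresponds to the coaction. -/
def elt : Module.End k M.obj.V ⊗[k] C.H (C.nxt d) :=
  ofSlice ((M.dualAct d hd).toLinearMap ∘ₗ (WithConv.linearEquiv k _).symm.toLinearMap)

lemma slice_elt (f : HopfDual (C.H (C.nxt d))) :
    slice (M.elt d hd) f.ofConv = M.dualAct d hd f := by
  rw [elt, slice_ofSlice]
  rfl

lemma evalFst_elt (m : M.obj.V) : evalFst m (M.elt d hd) = M.delta d hd m := by
  refine slice_injective (LinearMap.ext fun f => ?_)
  rw [slice_evalFst]
  exact LinearMap.congr_fun (M.slice_elt d hd (WithConv.toConv f)) m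

lemma balancing_eq (X : FDMod k (C.H (C.nxt d))) : M.balancing d hd X =
    actOn M.obj.V X (M.elt d hd) ∘ₗ (TensorProduct.comm k X.V M.obj.V).toLinearMap := by
  refine TensorProduct.ext' fun v m => ?_
  rw [balancing_tmul, LinearMap.comp_apply, LinearEquiv.coe_coe, TensorProduct.comm_tmul,
    actOn_apply, evalFst_elt]

lemma balancing_comp_lact (X : FDMod k (C.H (C.nxt d))) (x : C.KAlg) :
    M.balancing d hd X ∘ₗ (C.lact (C.nxt d) X M.obj).ρ x =
      (C.ract d M.obj X).ρ x ∘ₗ M.balancing d hd X :=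
  FDMod.lin_comm (M.iso d hd X).hom x

lemma actOn_elt_intertwines (X : FDMod k (C.H (C.nxt d))) (x : C.KAlg) :
    actOn M.obj.V X (M.elt d hd *
        Algebra.TensorProduct.map M.obj.ρ (AlgHom.id k _) (C.lcoHat (C.nxt d) x)) =
      actOn M.obj.V X (Algebra.TensorProduct.map M.obj.ρ (AlgHom.id k _) (C.rcoHat d x) *
        M.elt d hd) := by
  rw [map_mul, map_mul]
  have h := M.balancing_comp_lact d hd X x
  rw [balancing_eq, LinearMap.comp_assoc, lact_comm, ract_eq] at h
  exact comp_comm_injective h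

lemma elt_intertwines (x : C.KAlg) :
    M.elt d hd * Algebra.TensorProduct.map M.obj.ρ (AlgHom.id k _) (C.lcoHat (C.nxt d) x) =
      Algebra.TensorProduct.map M.obj.ρ (AlgHom.id k _) (C.rcoHat d x) * M.elt d hd :=
  actOn_regular_injective (M.actOn_elt_intertwines d hd _ x)

lemma dualAct_commute {d d' : C.pt} (hd : C.isSite (C.nxt d)) (hd' : C.isSite (C.nxt d'))
    (hdd : d ≠ d') (f : HopfDual (C.H (C.nxt d))) (g : HopfDual (C.H (C.nxt d'))) :
    Commute (M.dualAct d hd f) (M.dualAct d' hd' g) := by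
  refine LinearMap.ext fun m => ?_
  exact (slice_commute (M.balancing d hd (FDMod.regular k (C.H (C.nxt d))))
    (M.balancing d' hd' (FDMod.regular k (C.H (C.nxt d')))) (1 : C.H (C.nxt d)) (1 : C.H (C.nxt d'))
    m (LinearMap.congr_fun (M.compat d d' hd hd' hdd (FDMod.regular k (C.H (C.nxt d)))
      (FDMod.regular k (C.H (C.nxt d'))))
      ((1 : C.H (C.nxt d)) ⊗ₜ[k] ((1 : C.H (C.nxt d')) ⊗ₜ[k] m))) f.ofConv g.ofConv).symm

/-- The actions of the `H_p^*`, indexed by the sites rather than by the marked points before them. -/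
lemma exists_siteAct : ∃ φ : ∀ q : C.Site, HopfDual (C.H q) →ₐ[k] Module.End k M.obj.V,
    ∀ d hd, φ ⟨C.nxt d, hd⟩ = M.dualAct d hd := by
  have h : ∀ q : C.Site, ∃ φ : HopfDual (C.H q) →ₐ[k] Module.End k M.obj.V,
      ∀ d hd (e : ⟨C.nxt d, hd⟩ = q), φ = e ▸ M.dualAct d hd := by
    rintro ⟨q, hq⟩
    obtain ⟨d, rfl⟩ := C.nxt.surjective q
    refine ⟨M.dualAct d hq, fun d' hd' e => ?_⟩
    obtain rfl : d' = d := C.nxt.injective (congrArg Subtype.val e)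
    rfl
  choose φ hφ using h
  exact ⟨φ, fun d hd => hφ _ d hd rfl⟩

/-- The action of `H_q^*` for a site `q`. -/
def siteAct (q : C.Site) : HopfDual (C.H q) →ₐ[k] Module.End k M.obj.V := M.exists_siteAct.choose q

lemma siteAct_nxt : M.siteAct ⟨C.nxt d, hd⟩ = M.dualAct d hd := M.exists_siteAct.choose_spec d hd

lemma siteAct_commute : Pairwise fun p q => ∀ f g, Commute (M.siteAct p f) (M.siteAct q g) := by
  rintro ⟨p, hp⟩ ⟨q, hq⟩ h f g
  obtain ⟨d, rfl⟩ := C.nxt.surjective p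
  obtain ⟨d', rfl⟩ := C.nxt.surjective q
  rw [siteAct_nxt, siteAct_nxt]
  exact M.dualAct_commute hp hq (fun e => h (by subst e; rfl)) f g

/-- The action of `⨂_p H_p^*`. -/
def dualAlgAct : C.DualAlg →ₐ[k] Module.End k M.obj.V := piLift M.siteAct M.siteAct_commute

lemma dualAlgAct_singleDual (q : C.Site) (f : HopfDual (C.H q)) :
    M.dualAlgAct (C.singleDual q f) = M.siteAct q f := piLift_single M.siteAct M.siteAct_commute q f

end GluingCategory
end DecoratedCircle

/-! ### The equivalence -/

/-- The elements of an algebra whose actions on two modules are intertwined by a given linear map. -/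
def intertwiners {k A V W : Type u} [Field k] [Ring A] [Algebra k A] [AddCommGroup V] [Module k V]
    [AddCommGroup W] [Module k W] (ρ : A →ₐ[k] Module.End k V) (σ : A →ₐ[k] Module.End k W)
    (g : V →ₗ[k] W) : Subalgebra k A where
  carrier := {a | g ∘ₗ ρ a = σ a ∘ₗ g}
  mul_mem' {a b} ha hb := by
    rw [Set.mem_ofPred_eq] at ha hb ⊢
    rw [map_mul, map_mul, Module.End.mul_eq_comp, Module.End.mul_eq_comp, ← LinearMap.comp_assoc, ha,
      LinearMap.comp_assoc, hb, LinearMap.comp_assoc]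
  add_mem' {a b} ha hb := by
    rw [Set.mem_ofPred_eq] at ha hb ⊢
    rw [map_add, map_add, LinearMap.comp_add, LinearMap.add_comp, ha, hb]
  algebraMap_mem' c := by
    rw [Set.mem_ofPred_eq, AlgHom.commutes, AlgHom.commutes]
    ext
    simp

namespace DecoratedCircle
variable {k : Type u} [Field k] {C : DecoratedCircle k}

lemma eq_top_of_mem_singleDual (T : Subalgebra k C.DualAlg) (hT : ∀ q f, C.singleDual q f ∈ T) :
    T = ⊤ :=
  eq_top_of_single (k := k) (B := fun p : C.Site => HopfDual (C.H p)) T hT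

lemma act_single_eq_lTensor (i : C.pt) (y : C.signedK i) :
    C.act (C.single i y) = (C.single i).toLinearMap.lTensor _
      (actPair (C.actL i (C.sgn i)) (C.actR (C.nxt i) (C.sgn i)) (C.hlr i)
        (AlgHom.id k (C.signedK i)) ((C.bi i).coact y)) := by
  rw [act_single, factorAct, AlgHom.comp_apply]
  generalize (C.bi i).coact y = t
  induction t with
  | zero => simp only [map_zero]
  | add x y hx hy => simp only [map_add, hx, hy]
  | tmul h t =>
    induction t with
    | zero => simp only [map_zero, TensorProduct.tmul_zero]
    | add x y hx hy => simp only [map_add, TensorProduct.tmul_add, hx, hy]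
    | tmul x g => rw [actPair_tmul, actPair_tmul, LinearMap.lTensor_tmul]; rfl

/-- The relation of the crossed product has to be checked on the tensor factors only. -/
lemma straight_of_singleDual {E : Type u} [Ring E] [Algebra k E] (φ : C.DualAlg →ₐ[k] E)
    (ψ : C.KAlg →ₐ[k] E)
    (h : ∀ i y q f, ψ (C.single i y) * φ (C.singleDual q f) =
      CrossedProduct.straight φ ψ (C.singleDual q f) (C.act (C.single i y))) (x : C.KAlg)
    (a : C.DualAlg) : ψ x * φ a = CrossedProduct.straight φ ψ a (C.act x) := by
  have h1 : CrossedProduct.straightSubalgebra φ ψ C.act = ⊤ :=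
    C.eq_top_of_mem_single _ fun i y a => by
      have h2 : CrossedProduct.straightSubalgebra' φ ψ (C.single i) _ C.isCrossed_act
          (act_single_eq_lTensor i) = ⊤ :=
        eq_top_of_mem_singleDual _ fun q f y => h i y q f
      exact (h2 ▸ Algebra.mem_top : a ∈ CrossedProduct.straightSubalgebra' φ ψ (C.single i) _
        C.isCrossed_act (act_single_eq_lTensor i)) y
  exact (h1 ▸ Algebra.mem_top : x ∈ CrossedProduct.straightSubalgebra φ ψ C.act) a

namespace GluingCategory
variable (hS : ∀ i (x : C.H i), HopfAlgebra.antipode k (HopfAlgebra.antipode k x) = x)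

/-- The action of the vertex algebra on an object with balancings. -/
def vertexAct (M : C.GluingCategory) : C.VertexAlgebra →ₐ[k] Module.End k M.obj.V :=
  CrossedProduct.lift M.dualAlgAct M.obj.ρ C.isCrossed_act <|
    straight_of_singleDual _ _ fun i y q f => by
      obtain ⟨q, hq⟩ := q
      obtain ⟨d, rfl⟩ := C.nxt.surjective q
      exact (C.intertwine_iff_straight M.dualAlgAct M.obj.ρ hS d hq (D := M.elt d hq) fun f => by
        rw [slice_elt, dualAlgAct_singleDual, siteAct_nxt]).1 (M.elt_intertwines d hq) i y f

lemma vertexAct_inclLeft (M : C.GluingCategory) (a : C.DualAlg) :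
    M.vertexAct hS (CrossedProduct.inclLeft C.isCrossed_act a) = M.dualAlgAct a :=
  CrossedProduct.lift_inclLeft ..

lemma vertexAct_incK (M : C.GluingCategory) (x : C.KAlg) :
    M.vertexAct hS (C.incK x) = M.obj.ρ x :=
  CrossedProduct.lift_inclRight ..

lemma vertexAct_incDual (M : C.GluingCategory) (d : C.pt) (hd : C.isSite (C.nxt d))
    (f : HopfDual (C.H (C.nxt d))) :
    M.vertexAct hS (C.incDual ⟨C.nxt d, hd⟩ f) = M.dualAct d hd f := by
  refine (M.vertexAct_inclLeft hS (C.singleDual ⟨C.nxt d, hd⟩ f)).trans ?_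
  rw [dualAlgAct_singleDual, siteAct_nxt]

/-- The crossed product is generated by `K_v` and the duals at the sites, so linearity over these
suffices. -/
lemma comp_vertexAct {M N : C.GluingCategory} {g : M.obj.V →ₗ[k] N.obj.V}
    (hg : ∀ x, g ∘ₗ M.obj.ρ x = N.obj.ρ x ∘ₗ g)
    (hg' : ∀ d hd f, g ∘ₗ M.dualAct d hd f = N.dualAct d hd f ∘ₗ g) (z : C.VertexAlgebra) :
    g ∘ₗ M.vertexAct hS z = N.vertexAct hS z ∘ₗ g := by
  have h1 : intertwiners M.dualAlgAct N.dualAlgAct g = ⊤ :=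
    eq_top_of_mem_singleDual _ fun q f => by
      obtain ⟨q, hq⟩ := q
      obtain ⟨d, rfl⟩ := C.nxt.surjective q
      change g ∘ₗ _ = _ ∘ₗ g
      rw [dualAlgAct_singleDual, dualAlgAct_singleDual, siteAct_nxt, siteAct_nxt, hg']
  have h2 : ∀ z, z ∈ intertwiners (M.vertexAct hS) (N.vertexAct hS) g := fun z =>
    CrossedProduct.induction_incl C.isCrossed_act (zero_mem _) (fun _ _ => add_mem)
      (fun a x => mul_mem (by
        change g ∘ₗ _ = _ ∘ₗ g
        rw [vertexAct_inclLeft, vertexAct_inclLeft]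
        exact (h1 ▸ Algebra.mem_top : a ∈ intertwiners M.dualAlgAct N.dualAlgAct g))
        ((congrArg (g ∘ₗ ·) (M.vertexAct_incK hS x)).trans ((hg x).trans
          (congrArg (· ∘ₗ g) (N.vertexAct_incK hS x)).symm))) z
  exact h2 z

/-- Linearity over `H_p^*` is compatibility with the coaction of `H_p`. -/
lemma comp_dualAct_iff {M N : C.GluingCategory} (g : M.obj.V →ₗ[k] N.obj.V) (d : C.pt)
    (hd : C.isSite (C.nxt d)) :
    (∀ f, g ∘ₗ M.dualAct d hd f = N.dualAct d hd f ∘ₗ g) ↔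
      ∀ m, N.delta d hd (g m) = g.rTensor (C.H (C.nxt d)) (M.delta d hd m) := by
  have e : ∀ (f : HopfDual (C.H (C.nxt d))) m,
      g (M.dualAct d hd f m) = slice (g.rTensor (C.H (C.nxt d)) (M.delta d hd m)) f.ofConv :=
    fun f m => (slice_rTensor g (M.delta d hd m) f.ofConv).symm
  constructor
  · intro h m
    refine slice_injective (LinearMap.ext fun f => ?_)
    exact ((e (WithConv.toConv f) m).symm.trans (LinearMap.congr_fun (h (WithConv.toConv f)) m)).symm
  · intro h f
    refine LinearMap.ext fun m => (e f m).trans ?_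
    rw [← h]
    rfl

lemma delta_hom {M N : C.GluingCategory} (g : M ⟶ N) (d : C.pt) (hd : C.isSite (C.nxt d))
    (m : M.obj.V) : N.delta d hd (FDMod.lin g.1 m) =
      (FDMod.lin g.1).rTensor (C.H (C.nxt d)) (M.delta d hd m) :=
  LinearMap.congr_fun (g.2 d hd (FDMod.regular k (C.H (C.nxt d)))) ((1 : C.H (C.nxt d)) ⊗ₜ m)

/-- The module over the vertex algebra that corresponds to an object with balancings. -/
def vertexMod (M : C.GluingCategory) : FDMod k C.VertexAlgebra where
  V := M.obj.V
  ρ := M.vertexAct hS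

/-- The functor that sends an object with balancings to the corresponding module over the vertex
algebra. It does not change the underlying vector spaces and linear maps. -/
def toVertexMod : C.GluingCategory ⥤ FDMod k C.VertexAlgebra where
  obj M := M.vertexMod hS
  map {M N} g := FDMod.mkHom (M := M.vertexMod hS) (N := N.vertexMod hS)
    (FDMod.lin (M := M.obj) (N := N.obj) g.1) <|
    comp_vertexAct hS (FDMod.lin_comm (M := M.obj) (N := N.obj) g.1)
      fun d hd => (comp_dualAct_iff _ d hd).2 (delta_hom g d hd)

instance : (toVertexMod hS).Faithful where
  map_injective {M N} _ _ h := Subtype.ext (FDMod.hom_ext (M := M.obj) (N := N.obj)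
    (congrArg (FDMod.lin (M := M.vertexMod hS) (N := N.vertexMod hS)) h))

instance : (toVertexMod hS).Full where
  map_surjective {M N} g := by
    let g' : M.obj.V →ₗ[k] N.obj.V := FDMod.lin (M := M.vertexMod hS) (N := N.vertexMod hS) g
    have hg : ∀ z, g' ∘ₗ M.vertexAct hS z = N.vertexAct hS z ∘ₗ g' :=
      FDMod.lin_comm (M := M.vertexMod hS) (N := N.vertexMod hS) g
    have hK : ∀ x, g' ∘ₗ M.obj.ρ x = N.obj.ρ x ∘ₗ g' := fun x => by
      have h := hg (C.incK x)
      rwa [vertexAct_incK, vertexAct_incK] at h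
    have hD : ∀ d hd f, g' ∘ₗ M.dualAct d hd f = N.dualAct d hd f ∘ₗ g' := fun d hd f => by
      have h := hg (C.incDual ⟨C.nxt d, hd⟩ f)
      rwa [vertexAct_incDual, vertexAct_incDual] at h
    refine ⟨⟨FDMod.mkHom (M := M.obj) (N := N.obj) g' hK, fun d hd X =>
      TensorProduct.ext' fun v m => ?_⟩, rfl⟩
    have h := (comp_dualAct_iff g' d hd).1 (hD d hd) m
    change N.balancing d hd X (v ⊗ₜ g' m) = g'.rTensor X.V (M.balancing d hd X (v ⊗ₜ m))
    rw [balancing_tmul, balancing_tmul, h]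
    exact LinearMap.congr_fun ((LinearMap.lTensor_comp_rTensor ..).trans
      (LinearMap.rTensor_comp_lTensor ..).symm) (M.delta d hd m)

end GluingCategory

section OfModule
variable (N : FDMod k C.VertexAlgebra) (d : C.pt) (hd : C.isSite (C.nxt d))

/-- The element of `End(N) ⊗ H_p` that corresponds to the action of `H_p^*` on a module over the
vertex algebra, for the site `p = nxt d`. -/
def modElt : Module.End k N.V ⊗[k] C.H (C.nxt d) :=
  ofSlice ((N.ρ.comp (C.incDual ⟨C.nxt d, hd⟩)).toLinearMap ∘ₗ
    (WithConv.linearEquiv k _).symm.toLinearMap)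

lemma slice_modElt (f : HopfDual (C.H (C.nxt d))) :
    slice (modElt N d hd) f.ofConv = N.ρ.comp (C.incDual ⟨C.nxt d, hd⟩) f := by
  rw [modElt, slice_ofSlice]
  rfl

variable (hS : ∀ i (x : C.H i), HopfAlgebra.antipode k (HopfAlgebra.antipode k x) = x)

include hS in
lemma modElt_intertwines (x : C.KAlg) :
    modElt N d hd * Algebra.TensorProduct.map (N.ρ.comp C.incK) (AlgHom.id k _)
        (C.lcoHat (C.nxt d) x) =
      Algebra.TensorProduct.map (N.ρ.comp C.incK) (AlgHom.id k _) (C.rcoHat d x) *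
        modElt N d hd := by
  refine (C.intertwine_iff_straight (N.ρ.comp (CrossedProduct.inclLeft C.isCrossed_act))
    (N.ρ.comp C.incK) hS d hd (slice_modElt N d hd)).2 (fun i y f => ?_) x
  have h := congrArg N.ρ (CrossedProduct.inclRight_mul_inclLeft C.isCrossed_act (C.single i y)
    (C.singleDual ⟨C.nxt d, hd⟩ f))
  rw [map_mul] at h
  refine h.trans ?_
  generalize C.act (C.single i y) = t
  induction t with
  | zero => simp only [map_zero]
  | add x y hx hy => simp only [map_add, hx, hy]
  | tmul T μ =>
    exact map_mul N.ρ (CrossedProduct.inclLeft C.isCrossed_act (T (C.singleDual ⟨C.nxt d, hd⟩ f)))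
      (CrossedProduct.inclRight C.isCrossed_act μ)

lemma modElt_commute {d d' : C.pt} (hd : C.isSite (C.nxt d)) (hd' : C.isSite (C.nxt d'))
    (hdd : d ≠ d') (f : C.H (C.nxt d) →ₗ[k] k) (g : C.H (C.nxt d') →ₗ[k] k) :
    Commute (slice (modElt N d hd) f) (slice (modElt N d' hd') g) := by
  have h1 := slice_modElt N d hd (WithConv.toConv f)
  have h2 := slice_modElt N d' hd' (WithConv.toConv g)
  rw [WithConv.ofConv_toConv] at h1 h2
  rw [h1, h2]
  have h : (⟨C.nxt d, hd⟩ : C.Site) ≠ ⟨C.nxt d', hd'⟩ := fun e =>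
    hdd (C.nxt.injective (congrArg Subtype.val e))
  exact (((commute_single (k := k) (B := fun p : C.Site => HopfDual (C.H p)) h (WithConv.toConv f)
    (WithConv.toConv g)).map (CrossedProduct.inclLeft C.isCrossed_act))).map N.ρ

/-- The balancing of a module over the vertex algebra, as a linear isomorphism. -/
def modBalancing (X : FDMod k (C.H (C.nxt d))) : X.V ⊗[k] N.V ≃ₗ[k] N.V ⊗[k] X.V :=
  TensorProduct.comm k X.V N.V ≪≫ₗ LinearEquiv.ofLinearMap (actOn N.V X (modElt N d hd))
    (actOn N.V X ((HopfAlgebra.antipode k).lTensor _ (modElt N d hd)))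
    ((map_mul (actOn N.V X) _ _).symm.trans
      ((congrArg (actOn N.V X) (mul_lTensor_antipode (slice_modElt N d hd)).1).trans (map_one _)))
    ((map_mul (actOn N.V X) _ _).symm.trans
      ((congrArg (actOn N.V X) (mul_lTensor_antipode (slice_modElt N d hd)).2).trans (map_one _)))

lemma modBalancing_eq (X : FDMod k (C.H (C.nxt d))) : (modBalancing N d hd X).toLinearMap =
    actOn N.V X (modElt N d hd) ∘ₗ (TensorProduct.comm k X.V N.V).toLinearMap := rfl

lemma actOn_natural {V H : Type u} [AddCommGroup V] [Module k V] [Ring H] [Algebra k H]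
    {X Y : FDMod k H} (f : X ⟶ Y) (t : Module.End k V ⊗[k] H) (m : V) (v : X.V) :
    actOn V Y t (m ⊗ₜ FDMod.lin f v) = (FDMod.lin f).lTensor V (actOn V X t (m ⊗ₜ v)) := by
  induction t with
  | zero => simp
  | add x y hx hy => simp only [map_add, LinearMap.add_apply, hx, hy]
  | tmul T h =>
    rw [actOn_tmul, actOn_tmul, LinearMap.lTensor_tmul]
    exact congrArg (T m ⊗ₜ[k] ·) (LinearMap.congr_fun (FDMod.lin_comm f h) v).symm

lemma actOn_tensorH {V : Type u} [AddCommGroup V] [Module k V] {H : HopfAlgCat.{u} k}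
    (X Y : FDMod k H) (t : Module.End k V ⊗[k] H) (m : V) (x : X.V) (y : Y.V) :
    actOn V (X.tensorH Y) t (m ⊗ₜ (x ⊗ₜ[k] y : X.V ⊗[k] Y.V)) = TensorProduct.assoc k V X.V Y.V
      (evalLegs X Y m x y ((Coalgebra.comul (R := k) (A := H)).lTensor _ t)) := by
  induction t with
  | zero => simp
  | add x y hx hy => simp only [map_add, LinearMap.add_apply, hx, hy]
  | tmul T h =>
    rw [LinearMap.lTensor_tmul]
    refine (actOn_tmul (X.tensorH Y) T h m (x ⊗ₜ[k] y : X.V ⊗[k] Y.V)).trans ?_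
    change T m ⊗ₜ[k] (Module.endTensorEndAlgHom (R := k) (S := k) (A := k)
      (Algebra.TensorProduct.map X.ρ Y.ρ (Coalgebra.comul (R := k) h)) (x ⊗ₜ[k] y)) = _
    generalize Coalgebra.comul (R := k) h = s
    induction s with
    | zero => simp
    | add x y hx hy => simp only [map_add, LinearMap.add_apply, TensorProduct.tmul_add, hx, hy]
    | tmul h g => rfl

lemma actOn_unitH {V : Type u} [AddCommGroup V] [Module k V] {H : HopfAlgCat.{u} k}
    (t : Module.End k V ⊗[k] H) (m : V) (c : k) :
    actOn V (FDMod.unitH k H) t (m ⊗ₜ c) =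
      slice t (Coalgebra.counit (R := k) (A := H)) m ⊗ₜ[k] c := by
  induction t with
  | zero => simp
  | add x y hx hy =>
    simp only [map_add, LinearMap.add_apply, TensorProduct.add_tmul, hx, hy]
  | tmul T h =>
    rw [slice_tmul, LinearMap.smul_apply, TensorProduct.smul_tmul]
    exact actOn_tmul (FDMod.unitH k H) T h m c

include hS in
lemma modBalancing_comp_lact (X : FDMod k (C.H (C.nxt d))) (x : C.KAlg) :
    (modBalancing N d hd X).toLinearMap ∘ₗ (C.lact (C.nxt d) X (N.restrict C.incK)).ρ x =
      (C.ract d (N.restrict C.incK) X).ρ x ∘ₗ (modBalancing N d hd X).toLinearMap := by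
  have h := congrArg (actOn N.V X) (modElt_intertwines N d hd hS x)
  rw [map_mul, map_mul, Module.End.mul_eq_comp, Module.End.mul_eq_comp] at h
  rw [ract_eq, modBalancing_eq, LinearMap.comp_assoc]
  refine (congrArg (actOn N.V X (modElt N d hd) ∘ₗ ·)
    (lact_comm (C.nxt d) X (N.restrict C.incK) x)).trans ?_
  exact congrArg (· ∘ₗ (TensorProduct.comm k X.V N.V).toLinearMap) h

/-- A module over the vertex algebra as an object with balancings. -/
def ofModule : C.GluingCategory where
  obj := N.restrict C.incK
  iso d hd X := FDMod.mkIso (M := C.lact (C.nxt d) X (N.restrict C.incK))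
    (N := C.ract d (N.restrict C.incK) X) (modBalancing N d hd X)
    (modBalancing_comp_lact N d hd hS X)
  natural d hd X Y f := TensorProduct.ext' fun v m => actOn_natural f (modElt N d hd) m v
  hexagon d hd X Y := by
    refine TensorProduct.ext_threefold fun x y m => ?_
    refine (actOn_tensorH X Y (modElt N d hd) m x y).trans ?_
    rw [lTensor_comul_eq_legMul (slice_modElt N d hd)]
    exact congrArg (TensorProduct.assoc k N.V X.V Y.V) (actOn_rTensor_actOn X Y m x y _ _).symm
  unit d hd := TensorProduct.ext' fun c m => by
    refine (actOn_unitH (modElt N d hd) m c).trans ?_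
    have h : slice (modElt N d hd) (Coalgebra.counit (R := k) (A := C.H (C.nxt d))) = 1 :=
      (slice_modElt N d hd 1).trans (map_one _)
    rw [h]
    change m ⊗ₜ[k] c = (c • m) ⊗ₜ[k] (1 : k)
    rw [TensorProduct.smul_tmul, smul_eq_mul, mul_one]
  compat d d' hd hd' hdd X Y := by
    refine TensorProduct.ext (LinearMap.ext fun x => TensorProduct.ext' fun y m => ?_)
    refine (actOn_rTensor_actOn Y X m y x (modElt N d' hd') (modElt N d hd)).trans ?_
    rw [legMul_comm (modElt_commute N hd hd' hdd), evalLegs_comm]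
    exact congrArg (TensorProduct.rightComm k N.V X.V Y.V)
      (actOn_rTensor_actOn X Y m x y (modElt N d hd) (modElt N d' hd')).symm

lemma delta_ofModule (m : N.V) :
    (ofModule N hS).delta d hd m = evalFst m (modElt N d hd) :=
  actOn_regular_one (modElt N d hd) m

lemma dualAct_ofModule (f : HopfDual (C.H (C.nxt d))) :
    (ofModule N hS).dualAct d hd f = N.ρ (C.incDual ⟨C.nxt d, hd⟩ f) := by
  refine LinearMap.ext fun m => ?_
  refine ((ofModule N hS).dualAct_apply d hd f m).trans
    ((congrArg (fun t : N.V ⊗[k] C.H (C.nxt d) => slice t f.ofConv) (delta_ofModule N d hd hS m)).trans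
      ?_)
  exact (slice_evalFst _ _ _).trans (LinearMap.congr_fun (slice_modElt N d hd f) m)

/-- The module obtained from the balancings of `ofModule` is the original one. -/
lemma vertexAct_ofModule : (ofModule N hS).vertexAct hS = N.ρ := by
  have h1 : AlgHom.equalizer (ofModule N hS).dualAlgAct
      (N.ρ.comp (CrossedProduct.inclLeft C.isCrossed_act)) = ⊤ :=
    eq_top_of_mem_singleDual _ fun q f => by
      obtain ⟨q, hq⟩ := q
      obtain ⟨d, rfl⟩ := C.nxt.surjective q
      refine ((ofModule N hS).dualAlgAct_singleDual _ f).trans ?_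
      rw [GluingCategory.siteAct_nxt]
      exact dualAct_ofModule N d hq hS f
  have h2 : ∀ z, z ∈ AlgHom.equalizer ((ofModule N hS).vertexAct hS) N.ρ := fun z =>
    CrossedProduct.induction_incl C.isCrossed_act (zero_mem _) (fun _ _ => add_mem)
      (fun a x => mul_mem (((ofModule N hS).vertexAct_inclLeft hS a).trans
        (h1 ▸ Algebra.mem_top : a ∈ AlgHom.equalizer (ofModule N hS).dualAlgAct
          (N.ρ.comp (CrossedProduct.inclLeft C.isCrossed_act))))
        ((ofModule N hS).vertexAct_incK hS x)) z
  exact AlgHom.ext h2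

instance : (GluingCategory.toVertexMod hS).EssSurj where
  mem_essImage N := ⟨ofModule N hS, ⟨FDMod.mkIso (M := (ofModule N hS).vertexMod hS) (N := N)
    (LinearEquiv.refl k N.V) fun a => by
      change (ofModule N hS).vertexAct hS a = N.ρ a
      rw [vertexAct_ofModule]
      rfl⟩⟩

end OfModule

instance (hS : ∀ i (x : C.H i), HopfAlgebra.antipode k (HopfAlgebra.antipode k x) = x) :
    (GluingCategory.toVertexMod hS).IsEquivalence where

end DecoratedCircle

theorem mainTheorem5 {k : Type u} [Field k] [IsAlgClosed k] [CharZero k]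
    (S : CellDecomposition) (L : Labelling k S) (v : S.Vertex) :
    ∃ Φ : (L.circle v).GluingCategory ≌ FDMod k (L.circle v).VertexAlgebra,
      Φ.functor.Additive ∧ Φ.functor.Linear k ∧
      ∃ ι : Φ.functor ⋙ FDMod.restrictFunctor (L.circle v).incK ≅
          DecoratedCircle.GluingCategory.forget (L.circle v),
        ∀ (N : (L.circle v).GluingCategory) (d : (L.circle v).pt)
          (hd : (L.circle v).isSite ((L.circle v).nxt d))
          (f : HopfDual ((L.circle v).H ((L.circle v).nxt d))) (x : (Φ.functor.obj N).V),
          FDMod.lin (ι.hom.app N)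
              ((Φ.functor.obj N).ρ ((L.circle v).incDual ⟨(L.circle v).nxt d, hd⟩ f) x) =
            TensorProduct.rid k N.obj.V (f.ofConv.lTensor N.obj.V
              (N.balancing d hd (FDMod.regular k ((L.circle v).H ((L.circle v).nxt d)))
                (1 ⊗ₜ[k] FDMod.lin (ι.hom.app N) x))) := by
  have hS : ∀ i (x : (L.circle v).H i),
      HopfAlgebra.antipode k (HopfAlgebra.antipode k x) = x := fun i x =>
    haveI := L.semisimpleH (S.leftFace i.1)
    antipode_antipode_of_isSemisimpleRing (k := k) (H := L.H (S.leftFace i.1)) x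
  let F := DecoratedCircle.GluingCategory.toVertexMod hS
  refine ⟨F.asEquivalence, { }, { }, NatIso.ofComponents (fun M =>
    FDMod.mkIso (M := (M.vertexMod hS).restrict (L.circle v).incK) (N := M.obj)
      (LinearEquiv.refl k M.obj.V) fun x => M.vertexAct_incK hS x) fun g => rfl,
    fun N d hd f x => ?_⟩
  exact LinearMap.congr_fun (N.vertexAct_incDual hS d hd f) x

end
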